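/- Fix a finite alphabet $\Sigma$ and an injective encoding of $\Sigma$ by the integers $0,\dots,|\Sigma|-1$ (a symbol is identified with its code). Let $\mathbb X$ be a finite nonempty linearly ordered set of string variables, and let - $\mathcal R'$ be a conjunction of memberships $x\in L(A_x)$, one for each $x\in\mathbb X$, where $A_x$ is a nondeterministic finite automaton (NFA) over $\Sigma$, the state sets being pairwise disjoint; $|\mathcal R'|$ is the total number of states of all $A_x$; - $\mathcal I$ be a conjunction of finitely many inequalities $t\le u$ between linear terms over integer variables (with no string lengths); - $L_D\ne R_D$, $1\le D\le n$, be disequalities between finite concatenations of variables of $\mathbb X$ (repetitions allowed); $m$ is the maximal number of variable occurrences in any $L_D$ or $R_D$. **Tag automaton.** A tag automaton is an NFA whose transitions $q\xrightarrow{\,Z\,}r$ carry finite sets $Z$ of tags. Replace every transition $q\xrightarrow{a}r$ of $A_x$ by $q\xrightarrow{\{S_a,\,\mathsf L_x\}}r$, and let $A_\circ$ (states $Q_\circ$) be the concatenation of these automata for all $x\in\mathbb X$ in the order of the variables: consecutive automata are joined by transitions with the empty tag set from the final states of the first to the initial states of the second; the initial states are those of the first automaton and the final states those of the last. The automaton $A$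 has states $(q,i)$ with $q\in Q_\circ$, $1\le i\le 2n+1$; initial states $(q,1)$ with $q$ initial in $A_\circ$; final states $(q,i)$ with $q$ final in $A_\circ$ and $i$ odd; and, for all disequalities $D$ and sides $s\in\{\mathsf l,\mathsf r\}$, the transitions - $(q,i)\xrightarrow{\{S_a,\mathsf L_z,\mathsf P_{i,z}\}}(r,i)$ for $1\le i\le 2n+1$, and $(q,i)\xrightarrow{\{S_a,\,\mathsf M_{i,z,D,s,a},\,\mathsf L_z,\,\mathsf P_{i+1,z}\}}(r,i+1)$ for $1\le i\le 2n$, whenever $q\xrightarrow{\{S_a,\mathsf L_z\}}r$ in $A_\circ$; - $(q,i)\xrightarrow{\emptyset}(r,i)$ for $1\le i\le 2n+1$, whenever $q\xrightarrow{\emptyset}r$ in $A_\circ$; - $(q,i)\xrightarrow{\{\mathsf C_{i,x,D,s}\}}(q,i+1)$ for $2\le i\le 2n$, $q\in Q_\circ$, $x\in\mathbb X$. The tag set consists of all $S_a$, $\mathsf L_x$, $\mathsf M_{i,x,D,s,a}$ and $\mathsf C_{i,x,D,s}$ ($1\le i\le 2n$), and $\mathsf P_{i,x}$ ($1\le i\le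 2n+1$). **Formula.** All formulas below are quantifier-free formulas of linear integer arithmetic (LIA); all variables are integer-valued, and satisfiable means having an integer model. Let $Q,\Delta,I,F$ be the states, transitions, initial and final states of $A$. The Parikh tag formula $PF_{tag}(A)$, with variables $\iota_q,f_q,\sigma_q$ ($q\in Q$), $\#t$ ($t\in\Delta$) and $\#\tau$ ($\tau$ a tag), is the conjunction of - $\#t\ge 0$ for $t\in\Delta$; $0\le\iota_q\le1$ for $q\in I$, $\iota_q=0$ for $q\notin I$, $\sum_{q\in I}\iota_q=1$; $0\le f_q\le1$ for $q\in F$, $f_q=0$ for $q\notin F$; - for every $q\in Q$: $\iota_q+\sum_{t\text{ into }q}\#t=f_q+\sum_{t\text{ out of }q}\#t$; - for every $q\in Q$: $\sigma_q=0\leftrightarrow\iota_q=1$; $\ \sigma_q\le-1\to(\iota_q=0\wedge\bigwedge_{t\text{ into }q}\#t=0)$; $\ \sigma_q>0\to\bigvee_{t=(q',Z,q)\in\Delta}(\#t>0\wedge\sigma_{q'}\ge0\wedge\sigma_q=\sigma_{q'}+1)$; - for every tag $\tau$: $\#\tau=\sum\{\#t: t=(q,Z,r)\in\Delta,\ \tau\in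 Z\}$. Further integer variables are $m_{D,s}$, $c_i$ ($0\le i\le 2n$) and $p_{D,s}$. Write $\mu_{i,x,D,s}=\sum_{a\in\Sigma}\#\mathsf M_{i,x,D,s,a}$. Define - $\varphi_{Fair}$: for all $D,s$: $\sum_{1\le i\le 2n,\ x\in\mathbb X}(\mu_{i,x,D,s}+\#\mathsf C_{i,x,D,s})\le1$; - $\varphi_{Consist}$: for all $D,s$, $a\in\Sigma$, $1\le i\le 2n$: $\big(\sum_x\#\mathsf M_{i,x,D,s,a}=1\big)\to c_i=m_{D,s}=a$, and $\big(\sum_x\#\mathsf C_{i,x,D,s}=1\big)\to c_i=m_{D,s}=c_{i-1}$; - $\varphi_{Copies}$: for all $x$ and $1\le i<2n$: $\sum_{D,s}\mu_{i,x,D,s}+\sum_{D,s}\#\mathsf C_{i,x,D,s}=0\ \to\ \sum_{D,s}\#\mathsf C_{i+1,x,D,s}=0$; and for all $x$ and $2\le i\le 2n$: $\sum_{D,s}\#\mathsf C_{i,x,D,s}=1\ \to\ \#\mathsf P_{i,x}-\sum_{D,s}\mu_{i-1,x,D,s}=0$. For $D$ with $L_D=x_1\cdots x_N$ and $R_D=y_1\cdots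 y_M$ let - $\varphi^D_{Len}$: $\sum_{i=1}^N\#\mathsf L_{x_i}\ne\sum_{j=1}^M\#\mathsf L_{y_j}$; $\qquad\varphi^D_{Sym}$: $m_{D,\mathsf l}\ne m_{D,\mathsf r}$; - $\varphi^D_{Pos}(s,v)$: for $1\le l\le 2n$: $\mu_{l,v,D,s}>0\to p_{D,s}=\sum_{k=1}^{l}\#\mathsf P_{k,v}$; and for $2\le l\le 2n$: $\#\mathsf C_{l,v,D,s}>0\to p_{D,s}=\big(\sum_{k=1}^{l}\#\mathsf P_{k,v}\big)-1$; - $\varphi^D_{Align}(i,j)$: $\sum_{l<i}\#\mathsf L_{x_l}+p_{D,\mathsf l}=\sum_{l<j}\#\mathsf L_{y_l}+p_{D,\mathsf r}$; - $\varphi^D_{\exists}(s,v)$: $\mu_{1,v,D,s}+\sum_{2\le l\le 2n}(\mu_{l,v,D,s}+\#\mathsf C_{l,v,D,s})>0$; - $\varphi^D_{Mis}=\bigvee_{1\le i\le N,\,1\le j\le M}\big(\varphi^D_{Pos}(\mathsf l,x_i)\wedge\varphi^D_{Pos}(\mathsf r,y_j)\wedge\varphi^D_{Align}(i,j)\wedge\varphi^D_{\exists}(\mathsf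 l,x_i)\wedge\varphi^D_{\exists}(\mathsf r,y_j)\big)$. Finally $$\varphi^{MultiDiseq}=PF_{tag}(A)\wedge\varphi_{Fair}\wedge\varphi_{Consist}\wedge\varphi_{Copies}\wedge\bigwedge_{D}\big(\varphi^D_{Len}\vee(\varphi^D_{Mis}\wedge\varphi^D_{Sym})\big),$$ whose variables are disjoint from those of $\mathcal I$. The size of a formula is its number of symbols, integer constants being written in binary. **Theorem.** The string constraint $\mathcal R'\wedge\mathcal I\wedge\bigwedge_{1\le D\le n}L_D\ne R_D$ is satisfiable (by an assignment of words over $\Sigma$ to the string variables and of integers to the integer variables) if and only if the LIA formula $\mathcal I\wedge\varphi^{MultiDiseq}$ is satisfiable. Moreover, there is a polynomial $P$, depending only on $\Sigma$, such that the size of $\varphi^{MultiDiseq}$ is at most $P(mn\cdot|\mathcal R'|)$ whenever $n\ge1$, $m\ge1$ and every $A_x$ has at least one state. -/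

import Mathlib

universe uA uX uQ uI

/-! Linear integer arithmetic: terms, quantifier-free formulas, semantics, size. -/

/-- Linear terms over integer variables from `V`. -/
inductive LTerm (V : Type*) where
  | var (v : V)
  | const (k : ℤ)
  | add (t u : LTerm V)
  | sub (t u : LTerm V)

namespace LTerm

/-- The value of a term under an integer assignment. -/
def eval {V : Type*} (σ : V → ℤ) : LTerm V → ℤ
  | var v => σ v
  | const k => k
  | add t u => eval σ t + eval σ u
  | sub t u => eval σ t - eval σ u

/-- Renaming of variables. -/
def rename {V W : Type*} (f : V → W) : LTerm V → LTerm W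
  | var v => var (f v)
  | const k => const k
  | add t u => add (rename f t) (rename f u)
  | sub t u => sub (rename f t) (rename f u)

/-- Number of symbols; an integer constant is charged its binary length. -/
def size {V : Type*} : LTerm V → ℕ
  | var _ => 1
  | const k => 1 + Nat.size k.natAbs
  | add t u => 1 + size t + size u
  | sub t u => 1 + size t + size u

/-- The sum of a list of terms. -/
def listSum {V : Type*} (l : List (LTerm V)) : LTerm V :=
  l.foldr add (const 0)

/-- The term `∑ i ∈ s, f i`. -/
noncomputable def sum {V ι : Type*} (s : Finset ι) (f : ι → LTerm V) : LTerm V :=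
  listSum (s.toList.map f)

end LTerm

/-- Quantifier-free formulas of linear integer arithmetic over variables from `V`. -/
inductive LIA (V : Type*) where
  | tt
  | ff
  | le (t u : LTerm V)
  | eq (t u : LTerm V)
  | not (φ : LIA V)
  | and (φ ψ : LIA V)
  | or (φ ψ : LIA V)
  | imp (φ ψ : LIA V)

namespace LIA

/-- `σ` is a model of the formula. -/
def Holds {V : Type*} (σ : V → ℤ) : LIA V → Prop
  | tt => True
  | ff => False
  | le t u => t.eval σ ≤ u.eval σ
  | eq t u => t.eval σ = u.eval σ
  | not φ => ¬ Holds σ φ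
  | and φ ψ => Holds σ φ ∧ Holds σ ψ
  | or φ ψ => Holds σ φ ∨ Holds σ ψ
  | imp φ ψ => Holds σ φ → Holds σ ψ

/-- The formula has an integer model. -/
def Satisfiable {V : Type*} (φ : LIA V) : Prop :=
  ∃ σ : V → ℤ, φ.Holds σ

/-- Renaming of variables. -/
def rename {V W : Type*} (f : V → W) : LIA V → LIA W
  | tt => tt
  | ff => ff
  | le t u => le (t.rename f) (u.rename f)
  | eq t u => eq (t.rename f) (u.rename f)
  | not φ => not (rename f φ)
  | and φ ψ => and (rename f φ) (rename f ψ)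
  | or φ ψ => or (rename f φ) (rename f ψ)
  | imp φ ψ => imp (rename f φ) (rename f ψ)

/-- Number of symbols of the formula, written out as a tree. -/
def size {V : Type*} : LIA V → ℕ
  | tt => 1
  | ff => 1
  | le t u => 1 + t.size + u.size
  | eq t u => 1 + t.size + u.size
  | not φ => 1 + size φ
  | and φ ψ => 1 + size φ + size ψ
  | or φ ψ => 1 + size φ + size ψ
  | imp φ ψ => 1 + size φ + size ψ

/-- `t < u`. -/
def lt {V : Type*} (t u : LTerm V) : LIA V := not (le u t)

/-- `t ≠ u`. -/
def ne {V : Type*} (t u : LTerm V) : LIA V := not (eq t u)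

/-- `φ ↔ ψ`. -/
def iff {V : Type*} (φ ψ : LIA V) : LIA V := and (imp φ ψ) (imp ψ φ)

/-- Conjunction of a list of formulas. -/
def listConj {V : Type*} (l : List (LIA V)) : LIA V := l.foldr and tt

/-- Disjunction of a list of formulas. -/
def listDisj {V : Type*} (l : List (LIA V)) : LIA V := l.foldr or ff

/-- The formula `⋀ i ∈ s, f i`. -/
noncomputable def conj {V ι : Type*} (s : Finset ι) (f : ι → LIA V) : LIA V :=
  listConj (s.toList.map f)

/-- The formula `⋁ i ∈ s, f i`. -/
noncomputable def disj {V ι : Type*} (s : Finset ι) (f : ι → LIA V) : LIA V :=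
  listDisj (s.toList.map f)

end LIA

/-! String constraints: regular memberships, integer constraints, disequalities. -/

/-- A conjunction of one regular membership `x ∈ L(nfa x)` for every string variable `x : X`,
of finitely many inequalities `t ≤ u` between linear terms over the integer variables `I`, and
of `n` disequalities `lhs D ≠ rhs D` between concatenations of string variables. -/
structure DiseqConstraint (A : Type uA) (X : Type uX) (Q : X → Type uQ) (I : Type uI)
    (n : ℕ) where
  nfa : (x : X) → NFA A (Q x)
  ints : List (LTerm I × LTerm I)
  lhs : Fin n → List X
  rhs : Fin n → List X

namespace DiseqConstraint

/-- The word denoted by a concatenation of variables. -/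
def word {A : Type uA} {X : Type uX} (w : X → List A) (l : List X) : List A :=
  (l.map w).flatten

/-- Some assignment of words and integers satisfies all the conjuncts. -/
def Satisfiable {A : Type uA} {X : Type uX} {Q : X → Type uQ} {I : Type uI} {n : ℕ}
    (C : DiseqConstraint A X Q I n) : Prop :=
  ∃ (w : X → List A) (v : I → ℤ),
    (∀ x, w x ∈ (C.nfa x).accepts) ∧
    (∀ c ∈ C.ints, c.1.eval v ≤ c.2.eval v) ∧
    (∀ D, word w (C.lhs D) ≠ word w (C.rhs D))

/-- The integer part as a formula. -/
def intFormula {A : Type uA} {X : Type uX} {Q : X → Type uQ} {I : Type uI} {n : ℕ}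
    (C : DiseqConstraint A X Q I n) : LIA I :=
  LIA.listConj (C.ints.map fun c => LIA.le c.1 c.2)

/-- Maximal number of variable occurrences in a side of a disequality. -/
def maxSide {A : Type uA} {X : Type uX} {Q : X → Type uQ} {I : Type uI} {n : ℕ}
    (C : DiseqConstraint A X Q I n) : ℕ :=
  Finset.univ.sup fun D => max (C.lhs D).length (C.rhs D).length

/-- Size of the regular part: the total number of states of the automata. -/
def regSize {A : Type uA} {X : Type uX} {Q : X → Type uQ} {I : Type uI} {n : ℕ}
    [Fintype X] [∀ x, Fintype (Q x)] (_C : DiseqConstraint A X Q I n) : ℕ :=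
  ∑ x, Fintype.card (Q x)

end DiseqConstraint

/-! Tag automata and their Parikh formulas. -/

/-- A tag automaton: transitions carry finite sets of tags. -/
structure TagAut (T S : Type*) where
  states : Finset S
  trans : Finset (S × Finset T × S)
  start : Finset S
  accept : Finset S

/-- The variables of the Parikh tag formula of a tag automaton: for every state `q`, indicators
that `q` is the first resp. last state of the run and the depth of `q` in a spanning tree of the
run; for every transition and every tag, its number of occurrences. -/
inductive PVar (T S : Type*) where
  | init (q : S)
  | final (q : S)
  | span (q : S)
  | trans (t : S × Finset T × S)
  | tag (t : T)

namespace TagAut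

noncomputable section

open scoped Classical

variable {T S : Type*}

/-- The `ε`-concatenation of two tag automata (over disjoint sets of states). -/
def concatEps (M N : TagAut T S) : TagAut T S where
  states := M.states ∪ N.states
  trans := M.trans ∪ N.trans ∪ (M.accept ×ˢ N.start).image fun e => (e.1, ∅, e.2)
  start := M.start
  accept := N.accept

/-- The `ε`-concatenation of a nonempty list of tag automata. -/
def concatList : List (TagAut T S) → TagAut T S
  | [] => ⟨∅, ∅, ∅, ∅⟩
  | [M] => M
  | M :: N :: l => concatEps M (concatList (N :: l))

/-- Only initial states can be first, and exactly one state is first. -/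
def initFormula (M : TagAut T S) : LIA (PVar T S) :=
  .and (LIA.conj M.start fun q =>
      .and (.le (.const 0) (.var (.init q))) (.le (.var (.init q)) (.const 1)))
    (.and (LIA.conj (M.states \ M.start) fun q => .eq (.var (.init q)) (.const 0))
      (.eq (LTerm.sum M.start fun q => .var (.init q)) (.const 1)))

/-- Only final states can be last. -/
def finalFormula (M : TagAut T S) : LIA (PVar T S) :=
  .and (LIA.conj M.accept fun q =>
      .and (.le (.const 0) (.var (.final q))) (.le (.var (.final q)) (.const 1)))
    (LIA.conj (M.states \ M.accept) fun q => .eq (.var (.final q)) (.const 0))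

/-- Transitions entering `q`. -/
def incoming (M : TagAut T S) (q : S) : Finset (S × Finset T × S) :=
  M.trans.filter fun t => t.2.2 = q

/-- Transitions leaving `q`. -/
def outgoing (M : TagAut T S) (q : S) : Finset (S × Finset T × S) :=
  M.trans.filter fun t => t.1 = q

/-- `q` is entered as often as it is left, up to the first and the last state of the run. -/
def kirchhoffFormula (M : TagAut T S) (q : S) : LIA (PVar T S) :=
  .eq (.add (.var (.init q)) (LTerm.sum (M.incoming q) fun t => .var (.trans t)))
    (.add (.var (.final q)) (LTerm.sum (M.outgoing q) fun t => .var (.trans t)))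

/-- The transitions that are used are connected to the first state. -/
def spanFormula (M : TagAut T S) (q : S) : LIA (PVar T S) :=
  .and (LIA.iff (.eq (.var (.span q)) (.const 0)) (.eq (.var (.init q)) (.const 1)))
    (.and
      (.imp (.le (.var (.span q)) (.const (-1)))
        (.and (.eq (.var (.init q)) (.const 0))
          (LIA.conj (M.incoming q) fun t => .eq (.var (.trans t)) (.const 0))))
      (.imp (LIA.lt (.const 0) (.var (.span q)))
        (LIA.disj (M.incoming q) fun t =>
          .and (LIA.lt (.const 0) (.var (.trans t)))
            (.and (.le (.const 0) (.var (.span t.1)))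
              (.eq (.var (.span q)) (.add (.var (.span t.1)) (.const 1)))))))

/-- The Parikh formula: the values of the variables `trans t` are the numbers of occurrences of
the transitions in an accepting run. -/
def parikhFormula (M : TagAut T S) : LIA (PVar T S) :=
  .and (LIA.conj M.trans fun t => .le (.const 0) (.var (.trans t)))
    (.and M.initFormula
      (.and M.finalFormula
        (LIA.conj M.states fun q => .and (M.kirchhoffFormula q) (M.spanFormula q))))

/-- The Parikh tag formula for the tags in `tags`: moreover, the values of the variables `tag t`
are the numbers of occurrences of the tags. -/
def parikhTagFormula (M : TagAut T S) (tags : Finset T) : LIA (PVar T S) :=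
  .and M.parikhFormula
    (LIA.conj tags fun t =>
      .eq (.var (.tag t))
        (LTerm.sum (M.trans.filter fun d => t ∈ d.2.1) fun d => .var (.trans d)))

end

end TagAut

/-! The tag automaton of a system of disequalities. -/

/-- The left and the right side of a disequality. -/
inductive Side where
  | left
  | right
deriving DecidableEq

instance Side.instFintype : Fintype Side :=
  ⟨{Side.left, Side.right}, fun s => by cases s <;> simp⟩

/-- The tags for a system of `n` disequalities. -/
inductive Tag (A : Type uA) (X : Type uX) (n : ℕ) where
  /-- the symbol `a` is read -/
  | sym (a : A)
  /-- a symbol of the value of `x` is read -/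
  | len (x : X)
  /-- the `i`-th sampled symbol is an `a` in `x`, sampled for side `s` of disequality `D` -/
  | mis (i : ℕ) (x : X) (D : Fin n) (s : Side) (a : A)
  /-- as its `i`-th symbol, the run reuses for side `s` of `D` the symbol last sampled, in `x` -/
  | cop (i : ℕ) (x : X) (D : Fin n) (s : Side)
  /-- a symbol of the value of `x` is counted on level `i` -/
  | pos (i : ℕ) (x : X)

/-- The variables of the formula for a system of disequalities. -/
inductive MVar (A : Type uA) (X : Type uX) (S : Type*) (n : ℕ) where
  | parikh (v : PVar (Tag A X n) S)
  /-- the mismatch symbol for side `s` of `D` -/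
  | misSym (D : Fin n) (s : Side)
  /-- the `i`-th mismatch symbol -/
  | shared (i : ℕ)
  /-- the position, inside its variable, of the mismatch symbol for side `s` of `D` -/
  | misPos (D : Fin n) (s : Side)

namespace MultiDiseq

noncomputable section

open scoped Classical

variable {A : Type uA} {X : Type uX} {Q : X → Type uQ} {I : Type uI} {n : ℕ}

section Automaton

variable [Fintype A] [Fintype X] [∀ x, Fintype (Q x)]

/-- The automaton of the variable `x`, each transition on `a` being tagged by `sym a` and `len x`.
States of automata of different variables are kept apart by the dependent sum. -/
def lenTagAut (n : ℕ) (x : X) (M : NFA A (Q x)) : TagAut (Tag A X n) (Σ x, Q x) where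
  states := Finset.univ.image fun q : Q x => ⟨x, q⟩
  trans := (Finset.univ.filter fun t : Q x × A × Q x => t.2.2 ∈ M.step t.1 t.2.1).image
    fun t => (⟨x, t.1⟩, {Tag.sym t.2.1, Tag.len x}, ⟨x, t.2.2⟩)
  start := (Finset.univ.filter fun q => q ∈ M.start).image fun q : Q x => ⟨x, q⟩
  accept := (Finset.univ.filter fun q => q ∈ M.accept).image fun q : Q x => ⟨x, q⟩

/-- The `ε`-concatenation of the automata of all variables, in the order of the variables. -/
def conAut [LinearOrder X] (C : DiseqConstraint A X Q I n) :
    TagAut (Tag A X n) (Σ x, Q x) :=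
  TagAut.concatList
    (((Finset.univ : Finset X).sort (· ≤ ·)).map fun x => lenTagAut n x (C.nfa x))

/-- The set of all tags. -/
def allTags (A : Type uA) (X : Type uX) (n : ℕ) [Fintype A] [Fintype X] : Finset (Tag A X n) :=
  (Finset.univ.image fun a : A => Tag.sym a) ∪
  (Finset.univ.image fun x : X => Tag.len x) ∪
  ((Finset.Icc 1 (2 * n) ×ˢ (Finset.univ : Finset (X × Fin n × Side × A))).image
    fun e => Tag.mis e.1 e.2.1 e.2.2.1 e.2.2.2.1 e.2.2.2.2) ∪
  ((Finset.Icc 1 (2 * n) ×ˢ (Finset.univ : Finset (X × Fin n × Side))).image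
    fun e => Tag.cop e.1 e.2.1 e.2.2.1 e.2.2.2) ∪
  ((Finset.Icc 1 (2 * n + 1) ×ˢ (Finset.univ : Finset X)).image fun e => Tag.pos e.1 e.2)

/-- All `(q, a, z, r)` such that `M` has a transition from `q` to `r` reading `a` in `z`. -/
def readMoves (M : TagAut (Tag A X n) (Σ x, Q x)) :
    Finset ((Σ x, Q x) × A × X × (Σ x, Q x)) :=
  Finset.univ.filter fun e => (e.1, {Tag.sym e.2.1, Tag.len e.2.2.1}, e.2.2.2) ∈ M.trans

/-- All `(q, r)` such that `M` has an untagged transition from `q` to `r`. -/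
def epsMoves (M : TagAut (Tag A X n) (Σ x, Q x)) : Finset ((Σ x, Q x) × (Σ x, Q x)) :=
  Finset.univ.filter fun e => (e.1, ∅, e.2) ∈ M.trans

/-- The tag automaton of the system: copies `1, …, 2 n + 1` of the `ε`-concatenation, connected
by mismatch and copy transitions. -/
def multiAut [LinearOrder X] (C : DiseqConstraint A X Q I n) :
    TagAut (Tag A X n) ((Σ x, Q x) × ℕ) where
  states := (conAut C).states ×ˢ Finset.Icc 1 (2 * n + 1)
  start := (conAut C).start ×ˢ {1}
  accept := (conAut C).accept ×ˢ (Finset.Icc 1 (2 * n + 1)).filter fun i => Odd i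
  trans :=
    ((readMoves (conAut C) ×ˢ Finset.Icc 1 (2 * n + 1)).image fun e =>
      match e with
      | ((q, a, z, r), i) => ((q, i), {Tag.sym a, Tag.len z, Tag.pos i z}, (r, i))) ∪
    ((epsMoves (conAut C) ×ˢ Finset.Icc 1 (2 * n + 1)).image fun e =>
      match e with
      | ((q, r), i) => ((q, i), ∅, (r, i))) ∪
    ((readMoves (conAut C) ×ˢ Finset.Icc 1 (2 * n) ×ˢ
        (Finset.univ : Finset (Fin n × Side))).image fun e =>
      match e with
      | ((q, a, z, r), i, D, s) =>
        ((q, i), {Tag.sym a, Tag.mis i z D s a, Tag.len z, Tag.pos (i + 1) z}, (r, i + 1))) ∪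
    (((conAut C).states ×ˢ Finset.Icc 2 (2 * n) ×ˢ
        (Finset.univ : Finset (X × Fin n × Side))).image fun e =>
      match e with
      | (q, i, x, D, s) => ((q, i), {Tag.cop i x D s}, (q, i + 1)))

end Automaton

section Formula

variable {S : Type*}

/-- The variable counting a tag. -/
def cnt (t : Tag A X n) : LTerm (MVar A X S n) := .var (.parikh (.tag t))

/-- The variable for the mismatch symbol of side `s` of `D`. -/
def symVar (D : Fin n) (s : Side) : LTerm (MVar A X S n) := .var (.misSym D s)

/-- The variable for the `i`-th mismatch symbol. -/
def sharedVar (i : ℕ) : LTerm (MVar A X S n) := .var (.shared i)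

/-- The variable for the local mismatch position of side `s` of `D`. -/
def posVar (D : Fin n) (s : Side) : LTerm (MVar A X S n) := .var (.misPos D s)

/-- The integer encoding of a symbol. -/
def code [Fintype A] (a : A) : LTerm (MVar A X S n) := .const (Fintype.equivFin A a : ℕ)

/-- Number of `i`-th mismatches in `x` for side `s` of `D`, with any symbol. -/
def misCount [Fintype A] (i : ℕ) (x : X) (D : Fin n) (s : Side) : LTerm (MVar A X S n) :=
  LTerm.sum Finset.univ fun a : A => cnt (.mis i x D s a)

/-- Number of `i`-th mismatches in `x`, for any side of any disequality. -/
def misTotal [Fintype A] (i : ℕ) (x : X) : LTerm (MVar A X S n) :=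
  LTerm.sum (Finset.univ : Finset (Fin n × Side)) fun e => misCount i x e.1 e.2

/-- Number of `i`-th copies in `x`, for any side of any disequality. -/
def copTotal (i : ℕ) (x : X) : LTerm (MVar A X S n) :=
  LTerm.sum (Finset.univ : Finset (Fin n × Side)) fun e => cnt (.cop i x e.1 e.2)

/-- At most one mismatch or copy for each side of each disequality. -/
def fairFormula (A : Type uA) (X : Type uX) (S : Type*) (n : ℕ) [Fintype A] [Fintype X] :
    LIA (MVar A X S n) :=
  LIA.conj (Finset.univ : Finset (Fin n × Side)) fun e =>
    .le (LTerm.sum (Finset.Icc 1 (2 * n) ×ˢ (Finset.univ : Finset X)) fun d =>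
        .add (misCount d.1 d.2 e.1 e.2) (cnt (.cop d.1 d.2 e.1 e.2)))
      (.const 1)

/-- The symbol variables hold the sampled symbols. -/
def consistFormula (A : Type uA) (X : Type uX) (S : Type*) (n : ℕ) [Fintype A] [Fintype X] :
    LIA (MVar A X S n) :=
  LIA.conj ((Finset.univ : Finset (Fin n × Side × A)) ×ˢ Finset.Icc 1 (2 * n)) fun e =>
    match e with
    | ((D, s, a), i) =>
      .and
        (.imp (.eq (LTerm.sum (Finset.univ : Finset X) fun x => cnt (.mis i x D s a)) (.const 1))
          (.and (.eq (sharedVar i) (symVar D s)) (.eq (symVar D s) (code a))))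
        (.imp (.eq (LTerm.sum (Finset.univ : Finset X) fun x => cnt (.cop i x D s)) (.const 1))
          (.and (.eq (sharedVar i) (symVar D s)) (.eq (symVar D s) (sharedVar (i - 1)))))

/-- A copy for `x` follows immediately a mismatch or a copy for `x`. -/
def copiesFormula (A : Type uA) (X : Type uX) (S : Type*) (n : ℕ) [Fintype A] [Fintype X] :
    LIA (MVar A X S n) :=
  .and
    (LIA.conj (Finset.Ico 1 (2 * n) ×ˢ (Finset.univ : Finset X)) fun e =>
      .imp (.eq (.add (misTotal e.1 e.2) (copTotal e.1 e.2)) (.const 0))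
        (.eq (copTotal (e.1 + 1) e.2) (.const 0)))
    (LIA.conj (Finset.Icc 2 (2 * n) ×ˢ (Finset.univ : Finset X)) fun e =>
      .imp (.eq (copTotal e.1 e.2) (.const 1))
        (.eq (.sub (cnt (.pos e.1 e.2)) (misTotal (e.1 - 1) e.2)) (.const 0)))

/-- The length of the value of a concatenation of variables. -/
def lenTerm (l : List X) : LTerm (MVar A X S n) :=
  LTerm.listSum (l.map fun x => cnt (.len x))

/-- The two sides, `l` and `r`, have different lengths. -/
def lenFormula (l r : List X) : LIA (MVar A X S n) := LIA.ne (lenTerm l) (lenTerm r)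

/-- The number of symbols of `v` read on the levels `1, …, k`. -/
def posSum (k : ℕ) (v : X) : LTerm (MVar A X S n) :=
  LTerm.sum (Finset.Icc 1 k) fun j => cnt (.pos j v)

/-- The variable `posVar D s` holds the position in `v` of the symbol sampled for side `s` of `D`.
A mismatch transition leaving level `k` counts its own symbol on level `k + 1`, so a copy
transition leaving level `k`, which comes later, has to discount this symbol. -/
def posFormula [Fintype A] (D : Fin n) (s : Side) (v : X) : LIA (MVar A X S n) :=
  .and
    (LIA.conj (Finset.Icc 1 (2 * n)) fun k =>
      .imp (LIA.lt (.const 0) (misCount k v D s)) (.eq (posVar D s) (posSum k v)))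
    (LIA.conj (Finset.Icc 2 (2 * n)) fun k =>
      .imp (LIA.lt (.const 0) (cnt (.cop k v D s)))
        (.eq (posVar D s) (.sub (posSum k v) (.const 1))))

/-- For the prefixes `l` and `r` of the two sides of `D` that precede the mismatch variables, the
global positions of the mismatch symbols agree. -/
def alignFormula (D : Fin n) (l r : List X) : LIA (MVar A X S n) :=
  .eq (.add (lenTerm l) (posVar D .left)) (.add (lenTerm r) (posVar D .right))

/-- A symbol of `v` is sampled for side `s` of `D`. -/
def presentFormula [Fintype A] (D : Fin n) (s : Side) (v : X) : LIA (MVar A X S n) :=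
  LIA.lt (.const 0)
    (.add (misCount 1 v D s)
      (LTerm.sum (Finset.Icc 2 (2 * n)) fun k =>
        .add (misCount k v D s) (cnt (.cop k v D s))))

/-- Some occurrence of a variable in the left side `l` of `D` and some occurrence in the right
side `r` contain sampled symbols at equal global positions. -/
def misFormula [Fintype A] (D : Fin n) (l r : List X) : LIA (MVar A X S n) :=
  LIA.disj (Finset.univ : Finset (Fin l.length × Fin r.length)) fun e =>
    .and (posFormula D .left (l.get e.1))
      (.and (posFormula D .right (r.get e.2))
        (.and (alignFormula D (l.take e.1) (r.take e.2))
          (.and (presentFormula D .left (l.get e.1)) (presentFormula D .right (r.get e.2)))))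

/-- The mismatch symbols of the two sides of `D` differ. -/
def symFormula (D : Fin n) : LIA (MVar A X S n) := LIA.ne (symVar D .left) (symVar D .right)

end Formula

/-- The formula of the system of disequalities under the regular memberships. -/
def formula [Fintype A] [Fintype X] [LinearOrder X] [∀ x, Fintype (Q x)]
    (C : DiseqConstraint A X Q I n) : LIA (MVar A X ((Σ x, Q x) × ℕ) n) :=
  .and (((multiAut C).parikhTagFormula (allTags A X n)).rename MVar.parikh)
    (.and (fairFormula A X _ n)
      (.and (consistFormula A X _ n)
        (.and (copiesFormula A X _ n)
          (LIA.conj Finset.univ fun D =>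
            .or (lenFormula (C.lhs D) (C.rhs D))
              (.and (misFormula D (C.lhs D) (C.rhs D)) (symFormula D))))))

/-- The formula of the system in conjunction with the integer constraints, whose variables are
kept apart from those of the formula. -/
def fullFormula [Fintype A] [Fintype X] [LinearOrder X] [∀ x, Fintype (Q x)]
    (C : DiseqConstraint A X Q I n) : LIA (I ⊕ MVar A X ((Σ x, Q x) × ℕ) n) :=
  .and (C.intFormula.rename Sum.inl) ((formula C).rename Sum.inr)

end

end MultiDiseq

/-! A run of `multiAut C` reads one word for every variable and samples at most `2 * n` letters on
the way. Level `i` is left at most once, and only that crossing carries a tag `mis i ..` or `cop i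
..`. The tag counts therefore determine, level by level, what is sampled, and the partial sums of
the `pos` counters give the number of letters of each variable read before each sample. This is how
a quantifier-free condition on counts can speak about the order of events in a run; `Represents` and
its consequences translate every subformula accordingly.

From words to a model: if the two sides of a disequality have the same length, they differ at a
global position, which falls into a variable occurrence on each side (`getElem?_word`). Each side
thus gets a target, namely a variable and a position in it. The run samples each targeted letter by
one mismatch transition, and by copy transitions for the other sides aiming at the same letter
(`CRun.exists_mRun`). Either both sides of a disequality have a target or none has, so the number of
samples is even and the run ends on an odd level, as acceptance requires.

From a model to words: the Parikh formula describes a balanced connected multiset of transitions,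
which Euler's theorem turns into a run (`IsWalk.exists_eulerian`, `TagAut.exists_run_of_holds`).
Forgetting the levels, the run reads accepted words (`exists_cRun_conAut_iff`). A copy is forced to
refer to the letter of the sample just before it, so by induction along the samples each one stands
for an actual letter, at a known position and with its code in the symbol variables
(`Represents.exists_letter`). Alignment and distinct symbols then give different letters at one
global position.

For the size, states, transitions and tags are polynomially many, and the formula nests boundedly
many connectives and iterated sums, conjunctions or disjunctions. All bounds are powers of one base
`B` dominating every parameter (`size_formula_le`). -/

set_option linter.unusedSectionVars false

/-! Semantics of the derived connectives and of renaming. -/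

namespace LTerm

variable {V W ι : Type*}

theorem eval_listSum (σ : V → ℤ) (l : List (LTerm V)) :
    (listSum l).eval σ = (l.map (eval σ)).sum := by
  induction l with
  | nil => rfl
  | cons t l ih =>
    change eval σ t + eval σ (listSum l) = _
    rw [ih, List.map_cons, List.sum_cons]

theorem eval_sum (σ : V → ℤ) (s : Finset ι) (f : ι → LTerm V) :
    (sum s f).eval σ = ∑ i ∈ s, (f i).eval σ := by
  rw [sum, eval_listSum, List.map_map, ← Finset.sum_map_toList]
  rfl

theorem eval_rename (f : V → W) (σ : W → ℤ) (t : LTerm V) :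
    (t.rename f).eval σ = t.eval (σ ∘ f) := by
  induction t with
  | var v => rfl
  | const k => rfl
  | add t u iht ihu => simp only [rename, eval, iht, ihu]
  | sub t u iht ihu => simp only [rename, eval, iht, ihu]

end LTerm

namespace LIA

variable {V W ι : Type*}

theorem holds_listConj (σ : V → ℤ) (l : List (LIA V)) :
    (listConj l).Holds σ ↔ ∀ φ ∈ l, φ.Holds σ := by
  induction l with
  | nil => simp [listConj, Holds]
  | cons φ l ih =>
    change φ.Holds σ ∧ (listConj l).Holds σ ↔ _
    rw [ih, List.forall_mem_cons]

theorem holds_listDisj (σ : V → ℤ) (l : List (LIA V)) :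
    (listDisj l).Holds σ ↔ ∃ φ ∈ l, φ.Holds σ := by
  induction l with
  | nil => simp [listDisj, Holds]
  | cons φ l ih =>
    change φ.Holds σ ∨ (listDisj l).Holds σ ↔ _
    rw [ih, List.exists_mem_cons_iff]

theorem holds_conj (σ : V → ℤ) (s : Finset ι) (f : ι → LIA V) :
    (conj s f).Holds σ ↔ ∀ i ∈ s, (f i).Holds σ := by
  simp [conj, holds_listConj]

theorem holds_disj (σ : V → ℤ) (s : Finset ι) (f : ι → LIA V) :
    (disj s f).Holds σ ↔ ∃ i ∈ s, (f i).Holds σ := by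
  simp [disj, holds_listDisj]

theorem holds_rename (f : V → W) (σ : W → ℤ) (φ : LIA V) :
    (φ.rename f).Holds σ ↔ φ.Holds (σ ∘ f) := by
  induction φ with
  | tt => rfl
  | ff => rfl
  | le t u => simp only [rename, Holds, LTerm.eval_rename]
  | eq t u => simp only [rename, Holds, LTerm.eval_rename]
  | not φ ih => simp only [rename, Holds, ih]
  | and φ ψ ihφ ihψ => simp only [rename, Holds, ihφ, ihψ]
  | or φ ψ ihφ ihψ => simp only [rename, Holds, ihφ, ihψ]
  | imp φ ψ ihφ ihψ => simp only [rename, Holds, ihφ, ihψ]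

theorem holds_lt (σ : V → ℤ) (t u : LTerm V) :
    (lt t u).Holds σ ↔ t.eval σ < u.eval σ := by
  simp [lt, Holds]

theorem holds_ne (σ : V → ℤ) (t u : LTerm V) :
    (ne t u).Holds σ ↔ t.eval σ ≠ u.eval σ := by
  simp [ne, Holds]

end LIA

/-! Walks in labelled graphs, and Euler's theorem for them. -/

/-- The list of labelled edges is a walk between the given vertices. -/
def IsWalk {S T : Type*} : S → List (S × T × S) → S → Prop
  | p, [], q => p = q
  | p, t :: l, q => t.1 = p ∧ IsWalk t.2.2 l q

namespace IsWalk

open scoped Classical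

variable {S T : Type*}

theorem append {p q r : S} {l₁ l₂ : List (S × T × S)} (h₁ : IsWalk p l₁ q)
    (h₂ : IsWalk q l₂ r) : IsWalk p (l₁ ++ l₂) r := by
  induction l₁ generalizing p with
  | nil => cases h₁; exact h₂
  | cons t l ih => exact ⟨h₁.1, ih h₁.2⟩

theorem split {p r : S} {l₁ l₂ : List (S × T × S)} (h : IsWalk p (l₁ ++ l₂) r) :
    ∃ q, IsWalk p l₁ q ∧ IsWalk q l₂ r := by
  induction l₁ generalizing p with
  | nil => exact ⟨p, rfl, h⟩
  | cons t l ih =>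
    obtain ⟨q, h₁, h₂⟩ := ih h.2
    exact ⟨q, ⟨h.1, h₁⟩, h₂⟩

theorem balance {p q : S} {l : List (S × T × S)} (h : IsWalk p l q) (v : S) :
    (if v = p then 1 else 0) + l.countP (fun t => t.2.2 = v) =
      (if v = q then 1 else 0) + l.countP (fun t => t.1 = v) := by
  induction l generalizing p with
  | nil => cases h; rfl
  | cons t l ih =>
    obtain ⟨rfl, h⟩ := h
    have := ih h
    simp only [List.countP_cons, decide_eq_true_eq, eq_comm (a := v)] at this ⊢
    omega

/-- The edges of `m` enter and leave every vertex equally often, up to one extra start at `p`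
and one extra end at `q`. -/
def Balanced (m : Multiset (S × T × S)) (p q : S) : Prop :=
  ∀ v, (if v = p then 1 else 0) + m.countP (fun t => t.2.2 = v) =
    (if v = q then 1 else 0) + m.countP (fun t => t.1 = v)

/-- Walk greedily: removing an edge that leaves `p` keeps the rest balanced from the target of that
edge to `q`, and if no edge leaves `p`, the balance at `p` forces `p = q`. The last clause makes the
closed walks spliced in later nonempty. -/
theorem exists_walk_le (m : Multiset (S × T × S)) (p q : S) (h : Balanced m p q) :
    ∃ l : List (S × T × S), IsWalk p l q ∧ (l : Multiset (S × T × S)) ≤ m ∧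
      ((∃ t ∈ m, t.1 = p) → l ≠ []) := by
  induction m using Multiset.strongInductionOn generalizing p with
  | ih m ih =>
    by_cases he : ∃ t ∈ m, t.1 = p
    · obtain ⟨t, ht, rfl⟩ := he
      obtain ⟨m', rfl⟩ := Multiset.exists_cons_of_mem ht
      obtain ⟨l, hl, hle, -⟩ := ih m' (Multiset.lt_cons_self _ _) t.2.2 (by
        intro v
        have := h v
        simp only [Multiset.countP_cons, eq_comm (a := v)] at this ⊢
        omega)
      exact ⟨t :: l, ⟨rfl, hl⟩, Multiset.cons_le_cons t hle, by simp⟩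
    · refine ⟨[], ?_, by simp, fun h' => absurd h' he⟩
      have h0 : m.countP (fun t => t.1 = p) = 0 := by
        rw [Multiset.countP_eq_zero]
        exact fun t ht hp => he ⟨t, ht, hp⟩
      have := h p
      rw [h0] at this
      change p = q
      by_contra hne
      rw [if_pos rfl, if_neg hne] at this
      omega

/-- Follow `k` from a vertex of `l`. An edge outside `m - l` is an edge of `l`, so `k` stays on
vertices of `l` until it meets an edge of `m - l`, which then starts on `l`. That a vertex lies on
`l` is expressed by splitting `l` there, ready for splicing. -/
theorem exists_unused_of_walk {m : Multiset (S × T × S)} {l : List (S × T × S)} {p q : S}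
    (hl : IsWalk p l q) {k : List (S × T × S)} {u w : S} (hk : IsWalk u k w)
    (hkm : ∀ t ∈ k, t ∈ m) (hu : ∃ l₁ l₂, l = l₁ ++ l₂ ∧ IsWalk p l₁ u ∧ IsWalk u l₂ q) :
    (∃ t ∈ m - (l : Multiset (S × T × S)),
        ∃ l₁ l₂, l = l₁ ++ l₂ ∧ IsWalk p l₁ t.1 ∧ IsWalk t.1 l₂ q) ∨
      ∃ l₁ l₂, l = l₁ ++ l₂ ∧ IsWalk p l₁ w ∧ IsWalk w l₂ q := by
  induction k generalizing u with
  | nil => cases hk; exact Or.inr hu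
  | cons t k ih =>
    obtain ⟨rfl, hk⟩ := hk
    by_cases ht : t ∈ m - (l : Multiset (S × T × S))
    · exact Or.inl ⟨t, ht, hu⟩
    · have htl : t ∈ l := by
        by_contra hn
        apply ht
        rw [Multiset.mem_sub, Multiset.count_eq_zero_of_notMem (by simpa using hn)]
        exact Multiset.count_pos.2 (hkm t (by simp))
      refine ih hk (fun s hs => hkm s (by simp [hs])) ?_
      obtain ⟨l₁, l₂, rfl⟩ := List.append_of_mem htl
      obtain ⟨v, h₁, h₂⟩ := hl.split
      refine ⟨l₁ ++ [t], l₂, by simp, h₁.append ⟨h₂.1, rfl⟩, h₂.2⟩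

/-- Euler's theorem: a balanced multiset of edges that are reachable from the start is the
multiset of edges of a walk. -/
theorem exists_eulerian (m : Multiset (S × T × S)) (p q : S) (h : Balanced m p q)
    (hconn : ∀ t ∈ m, ∃ k, IsWalk p k t.1 ∧ ∀ s ∈ k, s ∈ m) :
    ∃ l : List (S × T × S), IsWalk p l q ∧ (l : Multiset (S × T × S)) = m := by
  -- Hierholzer's algorithm, by induction on a bound `N` for the number of edges not yet in the
  -- walk.
  have key : ∀ N : ℕ, ∀ l : List (S × T × S), IsWalk p l q →
      (l : Multiset (S × T × S)) ≤ m → m.card ≤ l.length + N →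
      ∃ l : List (S × T × S), IsWalk p l q ∧ (l : Multiset (S × T × S)) = m := by
    intro N
    induction N with
    | zero =>
      intro l hl hle hN
      exact ⟨l, hl, Multiset.eq_of_le_of_card_le hle (by simpa using hN)⟩
    | succ N ih =>
      intro l hl hle hN
      by_cases h0 : m - (l : Multiset (S × T × S)) = 0
      · exact ⟨l, hl, le_antisymm hle (tsub_eq_zero_iff_le.1 h0)⟩
      obtain ⟨e, he⟩ := Multiset.exists_mem_of_ne_zero h0
      obtain ⟨k, hk, hkm⟩ := hconn e (Multiset.mem_of_le tsub_le_self he)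
      have : ∃ t ∈ m - (l : Multiset (S × T × S)),
          ∃ l₁ l₂, l = l₁ ++ l₂ ∧ IsWalk p l₁ t.1 ∧ IsWalk t.1 l₂ q := by
        rcases exists_unused_of_walk hl hk hkm ⟨[], l, rfl, rfl, hl⟩ with h' | h'
        · exact h'
        · exact ⟨e, he, h'⟩
      obtain ⟨t, ht, l₁, l₂, rfl, h₁, h₂⟩ := this
      -- Subtracting the balance of the walk from that of `m` cancels the extra ends at `p` and `q`,
      -- so the unused edges are balanced from any vertex to itself. The greedy walk from `t.1` is
      -- then closed.
      obtain ⟨l₃, h₃, hle₃, hne⟩ := exists_walk_le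
        (m - ((l₁ ++ l₂ : List (S × T × S)) : Multiset (S × T × S))) t.1 t.1 (by
          intro v
          rw [Multiset.countP_sub hle, Multiset.countP_sub hle]
          have hb := hl.balance v
          have hm := h v
          have := Multiset.countP_le_of_le (fun t => t.1 = v) hle
          have := Multiset.countP_le_of_le (fun t => t.2.2 = v) hle
          simp only [Multiset.coe_countP] at *
          omega)
      have hpos : 0 < l₃.length := List.length_pos_iff.2 (hne ⟨t, ht, rfl⟩)
      refine ih (l₁ ++ (l₃ ++ l₂)) (h₁.append (h₃.append h₂)) ?_ ?_
      · have := (le_tsub_iff_left hle).1 hle₃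
        refine le_trans (le_of_eq ?_) this
        simp only [← Multiset.coe_add]
        abel
      · simp only [List.length_append] at hN ⊢
        omega
  obtain ⟨l, hl, hle, -⟩ := exists_walk_le m p q h
  exact key m.card l hl hle (by omega)

end IsWalk

/-! Correctness of the Parikh formula. -/

namespace TagAut

open scoped Classical

variable {T S : Type*}

theorem countP_edges (D : Finset (S × Finset T × S)) (f : S × Finset T × S → ℕ)
    (P : S × Finset T × S → Prop) :
    (∑ t ∈ D, Multiset.replicate (f t) t).countP P = ∑ t ∈ D.filter P, f t := by
  induction D using Finset.induction_on with
  | empty => simp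
  | insert t D ht ih =>
    rw [Finset.sum_insert ht, Multiset.countP_add, ih, Finset.filter_insert,
      ← Multiset.coe_replicate, Multiset.coe_countP, List.countP_replicate]
    simp only [decide_eq_true_eq]
    split_ifs with h
    · rw [Finset.sum_insert (by simp [ht])]
    · simp

theorem mem_edges {D : Finset (S × Finset T × S)} {f : S × Finset T × S → ℕ}
    {t : S × Finset T × S} :
    t ∈ (∑ t ∈ D, Multiset.replicate (f t) t) ↔ t ∈ D ∧ 0 < f t := by
  rw [Multiset.mem_sum]
  constructor
  · rintro ⟨s, hs, ht⟩
    rw [Multiset.mem_replicate] at ht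
    obtain ⟨h, rfl⟩ := ht
    exact ⟨hs, Nat.pos_of_ne_zero h⟩
  · rintro ⟨h, h'⟩
    exact ⟨t, h, Multiset.mem_replicate.2 ⟨h'.ne', rfl⟩⟩

theorem countP_eq_sum_count (D : Finset (S × Finset T × S)) (l : List (S × Finset T × S))
    (hl : ∀ t ∈ l, t ∈ D) (P : S × Finset T × S → Prop) :
    l.countP (fun t => P t) = ∑ t ∈ D.filter P, l.count t := by
  induction l with
  | nil => simp
  | cons t l ih =>
    simp only [List.countP_cons, List.count_cons, Finset.sum_add_distrib, beq_iff_eq,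
      Finset.sum_ite_eq, Finset.mem_filter, hl t (by simp), true_and, decide_eq_true_eq]
    rw [ih fun s hs => hl s (by simp [hs])]

/-- Transitions run between states, and first and last states are states. -/
structure WellFormed (M : TagAut T S) : Prop where
  src : ∀ t ∈ M.trans, t.1 ∈ M.states
  tgt : ∀ t ∈ M.trans, t.2.2 ∈ M.states
  start : M.start ⊆ M.states
  accept : M.accept ⊆ M.states

/-- An accepting run, as a list of transitions. -/
def IsRun (M : TagAut T S) (p : S) (l : List (S × Finset T × S)) (q : S) : Prop :=
  p ∈ M.start ∧ q ∈ M.accept ∧ IsWalk p l q ∧ ∀ t ∈ l, t ∈ M.trans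

/-- Number of occurrences of a tag. -/
noncomputable def tagCount (τ : T) (l : List (S × Finset T × S)) : ℕ :=
  l.countP fun t => τ ∈ t.2.1

/-- The transitions with their multiplicities form a multiset that is balanced by the Kirchhoff
equations and connected to the first state by the depths `span`; Euler's theorem arranges it into a
run. -/
theorem exists_run_of_holds {M : TagAut T S} (hM : M.WellFormed) {tags : Finset T}
    {σ : PVar T S → ℤ} (h : (M.parikhTagFormula tags).Holds σ) :
    ∃ p l q, M.IsRun p l q ∧ ∀ τ ∈ tags, σ (.tag τ) = tagCount τ l := by
  simp only [parikhTagFormula, parikhFormula, initFormula, finalFormula, kirchhoffFormula,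
    spanFormula, LIA.iff, LIA.Holds, LIA.holds_conj, LIA.holds_disj, LIA.holds_lt, LTerm.eval,
    LTerm.eval_sum, Finset.mem_sdiff, and_imp] at h
  obtain ⟨⟨hnn, ⟨hi, hi0, hi1⟩, ⟨hf, hf0⟩, hq⟩, htag⟩ := h
  obtain ⟨p, hp, hp1⟩ : ∃ p ∈ M.start, σ (.init p) = 1 := by
    by_contra! hne
    have : ∑ q ∈ M.start, σ (.init q) = 0 := Finset.sum_eq_zero fun q hq => by
      have := hi q hq
      have := hne q hq
      omega
    omega
  have huniq : ∀ q ∈ M.states, σ (.init q) = if q = p then 1 else 0 := by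
    intro q hqs
    split_ifs with hqp
    · rw [hqp, hp1]
    · by_cases hqst : q ∈ M.start
      · have h2 : ∑ r ∈ {p, q}, σ (.init r) ≤ ∑ r ∈ M.start, σ (.init r) :=
          Finset.sum_le_sum_of_subset_of_nonneg
            (by intro r hr; simp only [Finset.mem_insert, Finset.mem_singleton] at hr
                rcases hr with rfl | rfl <;> assumption)
            fun r hr _ => (hi r hr).1
        rw [Finset.sum_pair (Ne.symm hqp)] at h2
        have := hi q hqst
        omega
      · exact hi0 q hqs hqst
  set N : S × Finset T × S → ℕ := fun t => (σ (.trans t)).toNat with hN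
  have hNσ : ∀ t ∈ M.trans, (N t : ℤ) = σ (.trans t) := fun t ht =>
    Int.toNat_of_nonneg (hnn t ht)
  set m := ∑ t ∈ M.trans, Multiset.replicate (N t) t with hm
  have hin : ∀ v, ((m.countP (fun t => t.2.2 = v) : ℕ) : ℤ) =
      ∑ t ∈ M.incoming v, σ (.trans t) := by
    intro v
    rw [hm, countP_edges, Nat.cast_sum, incoming]
    exact Finset.sum_congr rfl fun t ht => hNσ t (Finset.mem_filter.1 ht).1
  have hout : ∀ v, ((m.countP (fun t => t.1 = v) : ℕ) : ℤ) =
      ∑ t ∈ M.outgoing v, σ (.trans t) := by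
    intro v
    rw [hm, countP_edges, Nat.cast_sum, outgoing]
    exact Finset.sum_congr rfl fun t ht => hNσ t (Finset.mem_filter.1 ht).1
  have hinout : ∑ v ∈ M.states, ∑ t ∈ M.incoming v, σ (.trans t) =
      ∑ v ∈ M.states, ∑ t ∈ M.outgoing v, σ (.trans t) := by
    simp only [incoming, outgoing]
    rw [Finset.sum_fiberwise_of_maps_to hM.tgt, Finset.sum_fiberwise_of_maps_to hM.src]
  -- Summed over all states, the transition counts cancel in the Kirchhoff equations. Hence there is
  -- exactly one last state, although no conjunct says so.
  have hsum : ∑ v ∈ M.states, σ (.init v) = ∑ v ∈ M.states, σ (.final v) := by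
    have := Finset.sum_congr rfl fun v hv => (hq v hv).1
    rw [Finset.sum_add_distrib, Finset.sum_add_distrib, hinout] at this
    linarith
  have hsum1 : ∑ v ∈ M.accept, σ (.final v) = 1 := by
    rw [Finset.sum_subset hM.accept fun v hv hv' => hf0 v hv hv', ← hsum,
      ← Finset.sum_subset hM.start fun v hv hv' => hi0 v hv hv', hi1]
  obtain ⟨q, hqa, hq1⟩ : ∃ q ∈ M.accept, σ (.final q) = 1 := by
    by_contra! hne
    have : ∑ q ∈ M.accept, σ (.final q) = 0 := Finset.sum_eq_zero fun q hq => by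
      have := hf q hq
      have := hne q hq
      omega
    omega
  have huniqf : ∀ v ∈ M.states, σ (.final v) = if v = q then 1 else 0 := by
    intro r hrs
    split_ifs with hrq
    · rw [hrq, hq1]
    · by_cases hra : r ∈ M.accept
      · have h2 : ∑ r ∈ {q, r}, σ (.final r) ≤ ∑ r ∈ M.accept, σ (.final r) :=
          Finset.sum_le_sum_of_subset_of_nonneg
            (by intro v hv; simp only [Finset.mem_insert, Finset.mem_singleton] at hv
                rcases hv with rfl | rfl <;> assumption)
            fun r hr _ => (hf r hr).1
        rw [Finset.sum_pair (Ne.symm hrq)] at h2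
        have := hf r hra
        omega
      · exact hf0 r hrs hra
  have hbal : IsWalk.Balanced m p q := by
    intro v
    by_cases hv : v ∈ M.states
    · have := (hq v hv).1
      rw [huniq v hv, huniqf v hv, ← hin, ← hout] at this
      exact_mod_cast this
    · have h1 : v ≠ p := fun h => hv (h ▸ hM.start hp)
      have h2 : v ≠ q := fun h => hv (h ▸ hM.accept hqa)
      have h3 : m.countP (fun t => t.2.2 = v) = 0 := Multiset.countP_eq_zero.2 fun t ht h =>
        hv (h ▸ hM.tgt t (mem_edges.1 ht).1)
      have h4 : m.countP (fun t => t.1 = v) = 0 := Multiset.countP_eq_zero.2 fun t ht h =>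
        hv (h ▸ hM.src t (mem_edges.1 ht).1)
      rw [h3, h4, if_neg h1, if_neg h2]
  -- A nonnegative depth unwinds, one used transition per unit, to a walk from the first state.
  have hreach : ∀ k : ℕ, ∀ v ∈ M.states, σ (.span v) = k →
      ∃ l, IsWalk p l v ∧ ∀ s ∈ l, s ∈ m := by
    intro k
    induction k with
    | zero =>
      intro v hv hk
      have := (hq v hv).2.1.1 (by simpa using hk)
      rw [huniq v hv] at this
      have hvp : v = p := by
        by_contra hne
        simp [hne] at this
      exact ⟨[], hvp.symm, by simp⟩
    | succ k ih =>
      intro v hv hk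
      obtain ⟨t, ht, h1, h2, h3⟩ := (hq v hv).2.2.2 (by omega)
      rw [incoming, Finset.mem_filter] at ht
      obtain ⟨l, hl, hlm⟩ := ih t.1 (hM.src t ht.1) (by push_cast at hk; omega)
      refine ⟨l ++ [t], hl.append ⟨rfl, ht.2⟩, fun s hs => ?_⟩
      rw [List.mem_append, List.mem_singleton] at hs
      rcases hs with hs | rfl
      · exact hlm s hs
      · exact mem_edges.2 ⟨ht.1, by have := hNσ s ht.1; omega⟩
  obtain ⟨l, hl, hlm⟩ := IsWalk.exists_eulerian m p q hbal (by
    intro t ht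
    obtain ⟨htM, htp⟩ := mem_edges.1 ht
    have hv := hM.src t htM
    -- At a negative depth the state is not initial and is never entered, so by the balance it is
    -- never left; but `t` leaves it.
    have hspan : 0 ≤ σ (.span t.1) := by
      by_contra hneg
      obtain ⟨h1, h2⟩ := (hq _ hv).2.2.1 (by omega)
      have h3 : m.countP (fun s => s.2.2 = t.1) = 0 := by
        have : ((m.countP (fun s => s.2.2 = t.1) : ℕ) : ℤ) = 0 := by
          rw [hin]
          exact Finset.sum_eq_zero h2
        exact_mod_cast this
      have h4 : 0 < m.countP (fun s => s.1 = t.1) := Multiset.countP_pos.2 ⟨t, ht, rfl⟩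
      have := hbal t.1
      rw [huniq _ hv] at h1
      split_ifs at h1 this <;> omega
    exact hreach (σ (.span t.1)).toNat t.1 hv (by omega))
  have hcount : ∀ P : S × Finset T × S → Prop,
      ((l.countP (fun t => P t) : ℕ) : ℤ) = ∑ t ∈ M.trans.filter P, σ (.trans t) := by
    intro P
    rw [← Multiset.coe_countP, hlm, countP_edges, Nat.cast_sum]
    exact Finset.sum_congr rfl fun t ht => hNσ t (Finset.mem_filter.1 ht).1
  refine ⟨p, l, q, ⟨hp, hqa, hl, fun t ht => ?_⟩, fun τ hτ => ?_⟩
  · rw [← Multiset.mem_coe, hlm] at ht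
    exact (mem_edges.1 ht).1
  · rw [htag τ hτ, tagCount]
    convert (hcount fun t => τ ∈ t.2.1).symm

/-- As depth of a state take its distance from `p` in the graph of the transitions used by the run,
and `-1` if it is not reached. The last transition of a shortest walk is the one that the depth
condition asks for. -/
theorem exists_holds_of_run {M : TagAut T S} {p q : S} {l : List (S × Finset T × S)}
    (h : M.IsRun p l q) (tags : Finset T) :
    ∃ σ : PVar T S → ℤ, (M.parikhTagFormula tags).Holds σ ∧
      ∀ τ, σ (.tag τ) = tagCount τ l := by
  obtain ⟨hp, hq, hl, hlM⟩ := h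
  let R : S → ℕ → Prop := fun v k => ∃ w, IsWalk p w v ∧ (∀ t ∈ w, t ∈ l) ∧ w.length = k
  let d : S → ℤ := fun v => if h : ∃ k, R v k then (Nat.find h : ℤ) else -1
  have hR0 : ∀ v, R v 0 ↔ p = v := by
    intro v
    constructor
    · rintro ⟨w, hw, -, h0⟩
      rw [List.length_eq_zero_iff] at h0
      subst h0
      exact hw
    · rintro rfl
      exact ⟨[], rfl, by simp, rfl⟩
  have hRs : ∀ t ∈ l, ∀ k, R t.1 k → R t.2.2 (k + 1) := by
    rintro t ht k ⟨w, hw, hwl, rfl⟩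
    refine ⟨w ++ [t], hw.append ⟨rfl, rfl⟩, fun s hs => ?_, by simp⟩
    rw [List.mem_append, List.mem_singleton] at hs
    rcases hs with hs | rfl
    · exact hwl s hs
    · exact ht
  have hRl : ∀ t ∈ l, ∃ k, R t.2.2 k := by
    intro t ht
    obtain ⟨l₁, l₂, rfl⟩ := List.append_of_mem ht
    obtain ⟨v, h1, h2⟩ := hl.split
    exact ⟨_, l₁ ++ [t], h1.append ⟨h2.1, rfl⟩, by intro s hs; simp at hs ⊢; tauto, rfl⟩
  have hRpred : ∀ v k, R v (k + 1) → ∃ t ∈ l, t.2.2 = v ∧ R t.1 k := by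
    rintro v k ⟨w, hw, hwl, hk⟩
    rcases List.eq_nil_or_concat' w with rfl | ⟨w, t, rfl⟩
    · simp at hk
    · obtain ⟨u, h1, h2⟩ := hw.split
      refine ⟨t, hwl t (by simp), h2.2, w, ?_, fun s hs => hwl s (by simp [hs]), by simpa using hk⟩
      rw [h2.1]
      exact h1
  let σ : PVar T S → ℤ := fun
    | .init v => if v = p then 1 else 0
    | .final v => if v = q then 1 else 0
    | .span v => d v
    | .trans t => l.count t
    | .tag τ => tagCount τ l
  refine ⟨σ, ?_, fun τ => rfl⟩
  have hd0 : ∀ v, d v = 0 ↔ v = p := by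
    intro v
    simp only [d]
    split_ifs with h
    · rw [Nat.cast_eq_zero, Nat.find_eq_zero, hR0, eq_comm]
    · constructor
      · exact fun h' => absurd h' (by norm_num)
      · rintro rfl
        exact absurd ⟨0, (hR0 v).2 rfl⟩ h
  simp only [parikhTagFormula, parikhFormula, initFormula, finalFormula, kirchhoffFormula,
    spanFormula, LIA.iff, LIA.Holds, LIA.holds_conj, LIA.holds_disj, LIA.holds_lt, LTerm.eval,
    LTerm.eval_sum, Finset.mem_sdiff, and_imp]
  have hcount : ∀ P : S × Finset T × S → Prop,
      ∑ t ∈ M.trans.filter P, ((l.count t : ℕ) : ℤ) = (l.countP (fun t => P t) : ℕ) := by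
    intro P
    rw [countP_eq_sum_count M.trans l hlM P, Nat.cast_sum]
  refine ⟨⟨fun t _ => by simp [σ], ⟨fun v _ => ?_, fun v _ hv => ?_, ?_⟩, ⟨fun v _ => ?_,
    fun v _ hv => ?_⟩, fun v _ => ⟨?_, ⟨?_, ?_⟩, ?_, ?_⟩⟩, fun τ _ => ?_⟩
  · simp only [σ]; split_ifs <;> omega
  · simp only [σ]
    rw [if_neg]
    rintro rfl
    exact hv hp
  · simp [σ, hp]
  · simp only [σ]; split_ifs <;> omega
  · simp only [σ]
    rw [if_neg]
    rintro rfl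
    exact hv hq
  · simp only [σ, incoming, outgoing]
    rw [hcount, hcount]
    exact_mod_cast hl.balance v
  · intro hv
    simp only [σ] at hv ⊢
    rw [if_pos ((hd0 v).1 hv)]
  · intro hv
    simp only [σ] at hv ⊢
    refine (hd0 v).2 ?_
    by_contra hne
    simp [hne] at hv
  · intro hv
    have hnR : ¬ ∃ k, R v k := by
      intro hk
      simp only [σ, d, dif_pos hk] at hv
      omega
    constructor
    · simp only [σ]
      rw [if_neg]
      rintro rfl
      exact hnR ⟨0, (hR0 v).2 rfl⟩
    · intro t ht
      simp only [σ, Nat.cast_eq_zero, List.count_eq_zero]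
      intro htl
      rw [incoming, Finset.mem_filter] at ht
      exact hnR (ht.2 ▸ hRl t htl)
  · intro hv
    have hk : ∃ k, R v k := by
      by_contra hn
      simp only [σ, d, dif_neg hn] at hv
      omega
    have hdv : d v = (Nat.find hk : ℤ) := dif_pos hk
    obtain ⟨k, hkf⟩ : ∃ k, Nat.find hk = k + 1 :=
      Nat.exists_eq_succ_of_ne_zero fun h0 => by
        simp only [σ, hdv, h0] at hv
        omega
    obtain ⟨t, htl, rfl, htk⟩ := hRpred v k (hkf ▸ Nat.find_spec hk)
    have hdt : d t.1 = (Nat.find ⟨k, htk⟩ : ℤ) := dif_pos ⟨k, htk⟩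
    -- The source is at distance exactly `k`: a shorter walk to it would extend to a walk to the
    -- target shorter than `k + 1`.
    have hle := Nat.find_min' ⟨k, htk⟩ htk
    have hge := Nat.find_min' hk (hRs t htl _ (Nat.find_spec ⟨k, htk⟩))
    refine ⟨t, Finset.mem_filter.2 ⟨hlM t htl, rfl⟩, ?_, ?_, ?_⟩
    · simp only [σ]
      exact_mod_cast List.count_pos_iff.2 htl
    · simp only [σ]
      omega
    · simp only [σ]
      omega
  · simp only [σ]
    rw [tagCount]
    convert (hcount fun t => τ ∈ t.2.1).symm

end TagAut

/-! ### The concatenated automata and the words they read -/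

theorem TagAut.mem_concatEps_trans {T S : Type*} {M N : TagAut T S} {t : S × Finset T × S} :
    t ∈ (M.concatEps N).trans ↔
      t ∈ M.trans ∨ t ∈ N.trans ∨ ∃ s ∈ M.accept, ∃ r ∈ N.start, t = (s, ∅, r) := by
  simp only [concatEps, Finset.mem_union, Finset.mem_image, Finset.mem_product, Prod.exists,
    or_assoc]
  refine or_congr_right (or_congr_right ⟨?_, ?_⟩)
  · rintro ⟨s, r, ⟨hs, hr⟩, rfl⟩
    exact ⟨s, hs, r, hr, rfl⟩
  · rintro ⟨s, hs, r, hr, rfl⟩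
    exact ⟨s, r, ⟨hs, hr⟩, rfl⟩

/-- The occurrence of `x` is unique. Each variable occurs once in the sorted list, so different
splittings of the list at the same variable can be identified. -/
theorem List.Nodup.append_cons_inj {α : Type*} {x : α} {l₁ l₂ k₁ k₂ : List α}
    (h : (l₁ ++ x :: l₂).Nodup) (he : l₁ ++ x :: l₂ = k₁ ++ x :: k₂) : l₁ = k₁ ∧ l₂ = k₂ := by
  induction l₁ generalizing k₁ with
  | nil =>
    cases k₁ with
    | nil => simpa using he
    | cons y k₁ =>
      simp only [List.nil_append, List.cons_append, List.cons.injEq] at he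
      rw [List.nil_append, he.2] at h
      simp at h
  | cons y l₁ ih =>
    cases k₁ with
    | nil =>
      simp only [List.nil_append, List.cons_append, List.cons.injEq] at he
      rw [he.1] at h
      simp at h
    | cons z k₁ =>
      simp only [List.cons_append, List.cons.injEq] at he
      obtain ⟨rfl, he⟩ := he
      obtain ⟨rfl, rfl⟩ := ih (List.nodup_cons.1 h).2 he
      exact ⟨rfl, rfl⟩

namespace MultiDiseq

open scoped Classical

variable {A : Type uA} {X : Type uX} {Q : X → Type uQ} {I : Type uI} {n : ℕ}

/-- The words `u` with the letter `a` prepended to the word of `z`. -/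
noncomputable def consAt (u : X → List A) (z : X) (a : A) : X → List A :=
  fun x => if x = z then a :: u x else u x

theorem consAt_self (u : X → List A) (z : X) (a : A) : consAt u z a z = a :: u z :=
  if_pos rfl

theorem consAt_of_ne (u : X → List A) {x z : X} (a : A) (h : x ≠ z) : consAt u z a x = u x :=
  if_neg h

theorem consAt_tail (u : X → List A) {x : X} {a : A} {w : List A} (h : u x = a :: w) :
    consAt (fun y => if y = x then w else u y) x a = u := by
  funext y
  by_cases hy : y = x
  · subst hy
    simp [consAt, h]
  · simp [consAt, hy]

/-- `CRun M q u r`: some run of `M` from `q` to `r` reads the word `u x` in every variable `x`. -/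
inductive CRun {S : Type*} (M : TagAut (Tag A X n) S) : S → (X → List A) → S → Prop
  | nil (q : S) : CRun M q (fun _ => []) q
  | read {q q' r : S} {u : X → List A} (a : A) (z : X)
      (ht : (q, {Tag.sym a, Tag.len z}, q') ∈ M.trans) (h : CRun M q' u r) :
      CRun M q (consAt u z a) r
  | eps {q q' r : S} {u : X → List A} (ht : (q, ∅, q') ∈ M.trans) (h : CRun M q' u r) :
      CRun M q u r

theorem symLen_inj {a b : A} {y z : X}
    (h : ({Tag.sym a, Tag.len y} : Finset (Tag A X n)) = {Tag.sym b, Tag.len z}) :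
    a = b ∧ y = z := by
  have h1 : Tag.sym a ∈ ({Tag.sym b, Tag.len z} : Finset (Tag A X n)) := by simp [← h]
  have h2 : Tag.len y ∈ ({Tag.sym b, Tag.len z} : Finset (Tag A X n)) := by simp [← h]
  simpa using And.intro h1 h2

section

variable [Fintype A] [Fintype X] [∀ x, Fintype (Q x)]

theorem mem_lenTagAut_trans {x : X} {M : NFA A (Q x)}
    {t : (Σ x, Q x) × Finset (Tag A X n) × (Σ x, Q x)} :
    t ∈ (lenTagAut n x M).trans ↔
      ∃ p a q, q ∈ M.step p a ∧ t = (⟨x, p⟩, {Tag.sym a, Tag.len x}, ⟨x, q⟩) := by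
  simp only [lenTagAut, Finset.mem_image, Finset.mem_filter, Finset.mem_univ, true_and,
    Prod.exists]
  constructor
  · rintro ⟨p, a, q, h, rfl⟩
    exact ⟨p, a, q, h, rfl⟩
  · rintro ⟨p, a, q, h, rfl⟩
    exact ⟨p, a, q, h, rfl⟩

/-- The `ε`-concatenation of the automata of the variables in the list. -/
noncomputable def concatVars (C : DiseqConstraint A X Q I n) (vs : List X) :
    TagAut (Tag A X n) (Σ x, Q x) :=
  TagAut.concatList (vs.map fun x => lenTagAut n x (C.nfa x))

variable (C : DiseqConstraint A X Q I n)

theorem mem_concatVars_start {x : X} {l : List X} {s : Σ x, Q x} :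
    s ∈ (concatVars C (x :: l)).start ↔ ∃ p ∈ (C.nfa x).start, s = ⟨x, p⟩ := by
  have : (concatVars C (x :: l)).start = (lenTagAut n x (C.nfa x)).start := by
    cases l <;> rfl
  rw [this]
  simp only [lenTagAut, Finset.mem_image, Finset.mem_filter, Finset.mem_univ, true_and,
    eq_comm (a := s)]

theorem mem_concatVars_accept {vs : List X} {s : Σ x, Q x} :
    s ∈ (concatVars C vs).accept ↔ s.2 ∈ (C.nfa s.1).accept ∧ ∃ l, vs = l ++ [s.1] := by
  induction vs with
  | nil => simp [concatVars, TagAut.concatList]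
  | cons x l ih =>
    cases l with
    | nil =>
      simp only [concatVars, TagAut.concatList, List.map_cons, List.map_nil, lenTagAut,
        Finset.mem_image, Finset.mem_filter, Finset.mem_univ, true_and]
      constructor
      · rintro ⟨p, hp, rfl⟩
        exact ⟨hp, [], rfl⟩
      · rintro ⟨hp, l, hl⟩
        obtain ⟨y, p⟩ := s
        cases l with
        | nil =>
          simp only [List.nil_append, List.cons.injEq, and_true] at hl
          subst hl
          exact ⟨p, hp, rfl⟩
        | cons z l => simp at hl
    | cons y l =>
      have : (concatVars C (x :: y :: l)).accept = (concatVars C (y :: l)).accept := rfl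
      rw [this, ih]
      refine and_congr_right fun _ => ⟨?_, ?_⟩
      · rintro ⟨k, hk⟩
        exact ⟨x :: k, by rw [hk]; rfl⟩
      · rintro ⟨k, hk⟩
        cases k with
        | nil => simp at hk
        | cons z k =>
          simp only [List.cons_append, List.cons.injEq] at hk
          exact ⟨k, hk.2⟩

theorem mem_concatVars_trans {vs : List X}
    {t : (Σ x, Q x) × Finset (Tag A X n) × (Σ x, Q x)} :
    t ∈ (concatVars C vs).trans ↔ (∃ x ∈ vs, t ∈ (lenTagAut n x (C.nfa x)).trans) ∨
      ∃ l₁ l₂ s r, vs = l₁ ++ s.1 :: r.1 :: l₂ ∧ s.2 ∈ (C.nfa s.1).accept ∧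
        r.2 ∈ (C.nfa r.1).start ∧ t = (s, ∅, r) := by
  induction vs with
  | nil => simp [concatVars, TagAut.concatList]
  | cons x l ih =>
    cases l with
    | nil =>
      simp only [concatVars, TagAut.concatList, List.map_cons, List.map_nil, List.mem_singleton,
        exists_eq_left]
      refine ⟨Or.inl, ?_⟩
      rintro (h | ⟨l₁, l₂, s, r, h, -⟩)
      · exact h
      · have := congrArg List.length h
        simp only [List.length_append, List.length_cons, List.length_nil] at this
        omega
    | cons y l =>
      have : concatVars C (x :: y :: l) =
          (lenTagAut n x (C.nfa x)).concatEps (concatVars C (y :: l)) := rfl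
      rw [this, TagAut.mem_concatEps_trans, ih]
      constructor
      · rintro (h | (⟨z, hz, h⟩ | ⟨l₁, l₂, s, r, h, h'⟩) | ⟨s, h1, r, h2, rfl⟩)
        · exact Or.inl ⟨x, by simp, h⟩
        · exact Or.inl ⟨z, by simp [hz], h⟩
        · exact Or.inr ⟨x :: l₁, l₂, s, r, by rw [h]; rfl, h'⟩
        · obtain ⟨p, hp, rfl⟩ := (mem_concatVars_start C).1 h2
          simp only [lenTagAut, Finset.mem_image, Finset.mem_filter, Finset.mem_univ,
            true_and] at h1
          obtain ⟨q, hq, rfl⟩ := h1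
          exact Or.inr ⟨[], l, ⟨x, q⟩, ⟨y, p⟩, rfl, hq, hp, rfl⟩
      · rintro (⟨z, hz, h⟩ | ⟨l₁, l₂, s, r, h, hs, hr, rfl⟩)
        · rcases List.mem_cons.1 hz with rfl | hz
          · exact Or.inl h
          · exact Or.inr (Or.inl (Or.inl ⟨z, hz, h⟩))
        · cases l₁ with
          | nil =>
            obtain ⟨z, p⟩ := s
            obtain ⟨w, q⟩ := r
            simp only [List.nil_append, List.cons.injEq] at h
            obtain ⟨rfl, rfl, rfl⟩ := h
            refine Or.inr (Or.inr ⟨⟨x, p⟩, ?_, ⟨y, q⟩,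
              (mem_concatVars_start C).2 ⟨q, hr, rfl⟩, rfl⟩)
            simp only [lenTagAut, Finset.mem_image, Finset.mem_filter, Finset.mem_univ, true_and]
            exact ⟨p, hs, rfl⟩
          | cons z l₁ =>
            simp only [List.cons_append, List.cons.injEq] at h
            exact Or.inr (Or.inl (Or.inr ⟨l₁, l₂, s, r, h.2, hs, hr, rfl⟩))

theorem read_mem_concatVars {vs : List X} {s r : Σ x, Q x} {a : A} {z : X}
    (h : (s, {Tag.sym a, Tag.len z}, r) ∈ (concatVars C vs).trans) :
    z ∈ vs ∧ ∃ p q, s = ⟨z, p⟩ ∧ r = ⟨z, q⟩ ∧ q ∈ (C.nfa z).step p a := by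
  rw [mem_concatVars_trans] at h
  rcases h with ⟨x, hx, h⟩ | ⟨l₁, l₂, s', r', -, -, -, h⟩
  · rw [mem_lenTagAut_trans] at h
    obtain ⟨p, b, q, hq, h⟩ := h
    simp only [Prod.mk.injEq] at h
    obtain ⟨rfl, h, rfl⟩ := h
    obtain ⟨rfl, rfl⟩ := symLen_inj h
    exact ⟨hx, p, q, rfl, rfl, hq⟩
  · simp only [Prod.mk.injEq] at h
    exact absurd h.2.1 (Finset.insert_ne_empty _ _)

theorem eps_mem_concatVars {vs : List X} {s r : Σ x, Q x} :
    (s, ∅, r) ∈ (concatVars C vs).trans ↔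
      s.2 ∈ (C.nfa s.1).accept ∧ r.2 ∈ (C.nfa r.1).start ∧
        ∃ l₁ l₂, vs = l₁ ++ s.1 :: r.1 :: l₂ := by
  rw [mem_concatVars_trans]
  constructor
  · rintro (⟨x, hx, h⟩ | ⟨l₁, l₂, s', r', h1, h2, h3, h⟩)
    · rw [mem_lenTagAut_trans] at h
      obtain ⟨p, b, q, hq, h⟩ := h
      simp only [Prod.mk.injEq] at h
      exact absurd h.2.1.symm (Finset.insert_ne_empty _ _)
    · simp only [Prod.mk.injEq, true_and] at h
      obtain ⟨rfl, rfl⟩ := h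
      exact ⟨h2, h3, l₁, l₂, h1⟩
  · rintro ⟨h2, h3, l₁, l₂, h1⟩
    exact Or.inr ⟨l₁, l₂, s, r, h1, h2, h3, rfl⟩

/-- Induction on the run, hence stated for an arbitrary current state: the rest of the word of `s.1`
and the whole words of `l₂` are still to be read, while the earlier variables are finished and
receive no letter. -/
theorem words_of_cRun {vs : List X} (hvs : vs.Nodup) {s r : Σ x, Q x} {u : X → List A}
    (h : CRun (concatVars C vs) s u r) (hr : r ∈ (concatVars C vs).accept) {l₁ l₂ : List X}
    (hs : vs = l₁ ++ s.1 :: l₂) :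
    u s.1 ∈ (C.nfa s.1).acceptsFrom {s.2} ∧ (∀ y ∈ l₂, u y ∈ (C.nfa y).accepts) ∧
      ∀ y, y ≠ s.1 → y ∉ l₂ → u y = [] := by
  induction h generalizing l₁ l₂ with
  | nil s =>
    rw [mem_concatVars_accept] at hr
    obtain ⟨hr, k, hk⟩ := hr
    -- Accepting states belong to the last variable, so no variable remains after it.
    obtain ⟨-, rfl⟩ := (hs ▸ hvs).append_cons_inj (hs ▸ hk)
    simp [hr]
  | read a z ht h ih =>
    obtain ⟨-, p, q, rfl, rfl, hq⟩ := read_mem_concatVars C ht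
    obtain ⟨h1, h2, h3⟩ := ih hr hs
    simp only at h1 h2 h3 hs ⊢
    have hz : z ∉ l₂ := fun hz => by
      rw [hs] at hvs
      exact (List.nodup_cons.1 (List.nodup_append.1 hvs).2.1).1 hz
    refine ⟨?_, fun y hy => ?_, fun y hy hy' => ?_⟩
    · rw [consAt_self, NFA.cons_mem_acceptsFrom, NFA.stepSet_singleton]
      rw [NFA.mem_acceptsFrom] at h1 ⊢
      obtain ⟨f, hf, hf'⟩ := h1
      refine ⟨f, hf, ?_⟩
      rw [NFA.mem_evalFrom_iff_exists]
      exact ⟨q, hq, hf'⟩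
    · rw [consAt_of_ne]
      · exact h2 y hy
      · rintro rfl
        exact hz hy
    · rw [consAt_of_ne _ _ hy]
      exact h3 y hy hy'
  | @eps s s' r u ht h ih =>
    obtain ⟨hacc, hst, k₁, k₂, hk⟩ := (eps_mem_concatVars C).1 ht
    obtain ⟨rfl, rfl⟩ := (hs ▸ hvs).append_cons_inj (hs ▸ hk)
    obtain ⟨h1, h2, h3⟩ := ih hr (l₁ := l₁ ++ [s.1]) (l₂ := k₂) (by simp [hk])
    have hnd := (List.nodup_append.1 (hs ▸ hvs)).2.1
    rw [List.nodup_cons, List.mem_cons, not_or] at hnd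
    refine ⟨?_, ?_, fun y hy hy' => ?_⟩
    · rw [h3 s.1 hnd.1.1 hnd.1.2]
      simpa using hacc
    · intro y hy
      rcases List.mem_cons.1 hy with rfl | hy
      · rw [NFA.accepts_eq_acceptsFrom_start]
        rw [NFA.mem_acceptsFrom] at h1 ⊢
        obtain ⟨f, hf, hf'⟩ := h1
        refine ⟨f, hf, ?_⟩
        rw [NFA.mem_evalFrom_iff_exists]
        exact ⟨s'.2, hst, hf'⟩
      · exact h2 y hy
    · rw [List.mem_cons, not_or] at hy'
      exact h3 y hy'.1 hy'.2

/-- Outer induction on the variables still to come, inner induction on the unread part of the word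
of `x`. At the end of that word an `ε`-transition leads to an initial state of the next automaton.
-/
theorem exists_cRun_of_words {vs : List X} (hvs : vs.Nodup) {x : X} {l₁ l₂ : List X}
    (hx : vs = l₁ ++ x :: l₂) {p : Q x} {u : X → List A}
    (h1 : u x ∈ (C.nfa x).acceptsFrom {p}) (h2 : ∀ y ∈ l₂, u y ∈ (C.nfa y).accepts)
    (h3 : ∀ y, y ≠ x → y ∉ l₂ → u y = []) :
    ∃ r ∈ (concatVars C vs).accept, CRun (concatVars C vs) ⟨x, p⟩ u r := by
  induction l₂ generalizing l₁ x u with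
  | nil =>
    generalize hw : u x = w at h1
    induction w generalizing p u with
    | nil =>
      refine ⟨⟨x, p⟩, (mem_concatVars_accept C).2 ⟨by simpa using h1, l₁, hx⟩, ?_⟩
      have : u = fun _ => [] := by
        funext y
        by_cases hy : y = x
        · rw [hy, hw]
        · exact h3 y hy (by simp)
      rw [this]
      exact .nil _
    | cons a w ih =>
      rw [NFA.cons_mem_acceptsFrom, NFA.stepSet_singleton, NFA.mem_acceptsFrom] at h1
      obtain ⟨f, hf, hf'⟩ := h1
      obtain ⟨q, hq, hf'⟩ := NFA.mem_evalFrom_iff_exists.1 hf'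
      obtain ⟨r, hr, hrun⟩ := ih (p := q) (u := fun y => if y = x then w else u y)
        (by simp) (fun y hy hy' => by simp [hy, h3 y hy hy']) (by simp)
        (NFA.mem_acceptsFrom.2 ⟨f, hf, hf'⟩)
      refine ⟨r, hr, ?_⟩
      rw [← consAt_tail u hw]
      exact .read a x ((mem_concatVars_trans C).2 (Or.inl ⟨x, by simp [hx],
        mem_lenTagAut_trans.2 ⟨p, a, q, hq, rfl⟩⟩)) hrun
  | cons y l₂ ihl =>
    have hnd := (List.nodup_append.1 (hx ▸ hvs)).2.1
    rw [List.nodup_cons] at hnd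
    generalize hw : u x = w at h1
    induction w generalizing p u with
    | nil =>
      obtain ⟨f, hf, hf'⟩ := NFA.mem_accepts.1 (h2 y (by simp))
      obtain ⟨q, hq, hf'⟩ := NFA.mem_evalFrom_iff_exists.1 hf'
      obtain ⟨r, hr, hrun⟩ := ihl (x := y) (l₁ := l₁ ++ [x]) (p := q) (u := u) (by simp [hx])
        (NFA.mem_acceptsFrom.2 ⟨f, hf, hf'⟩) (fun z hz => h2 z (by simp [hz]))
        (fun z hz hz' => by
          by_cases hzx : z = x
          · rw [hzx, hw]
          · exact h3 z hzx (by simp [hz, hz']))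
      exact ⟨r, hr, .eps ((eps_mem_concatVars C).2 ⟨by simpa using h1, hq, l₁, l₂, hx⟩) hrun⟩
    | cons a w ih =>
      rw [NFA.cons_mem_acceptsFrom, NFA.stepSet_singleton, NFA.mem_acceptsFrom] at h1
      obtain ⟨f, hf, hf'⟩ := h1
      obtain ⟨q, hq, hf'⟩ := NFA.mem_evalFrom_iff_exists.1 hf'
      obtain ⟨r, hr, hrun⟩ := ih (p := q) (u := fun z => if z = x then w else u z)
        (fun z hz => by
          have : z ≠ x := by
            rintro rfl
            exact hnd.1 hz
          simpa [this] using h2 z hz)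
        (fun z hz hz' => by simp [hz, h3 z hz hz']) (by simp)
        (NFA.mem_acceptsFrom.2 ⟨f, hf, hf'⟩)
      refine ⟨r, hr, ?_⟩
      rw [← consAt_tail u hw]
      exact .read a x ((mem_concatVars_trans C).2 (Or.inl ⟨x, by simp [hx],
        mem_lenTagAut_trans.2 ⟨p, a, q, hq, rfl⟩⟩)) hrun

/-- The runs of the concatenation of all automata read exactly the assignments of accepted
words. -/
theorem exists_cRun_conAut_iff [LinearOrder X] [Nonempty X] (u : X → List A) :
    (∃ s ∈ (conAut C).start, ∃ r ∈ (conAut C).accept, CRun (conAut C) s u r) ↔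
      ∀ x, u x ∈ (C.nfa x).accepts := by
  have hcon : conAut C = concatVars C ((Finset.univ : Finset X).sort (· ≤ ·)) := rfl
  have hnd : ((Finset.univ : Finset X).sort (· ≤ ·)).Nodup := Finset.sort_nodup _ _
  have hmem : ∀ x, x ∈ (Finset.univ : Finset X).sort (· ≤ ·) := fun x => by simp
  rw [hcon]
  generalize (Finset.univ : Finset X).sort (· ≤ ·) = vs at hnd hmem
  cases vs with
  | nil =>
    -- Without variables the concatenation has no states and hence no run, although the empty
    -- assignment would be admissible.
    obtain ⟨x⟩ := ‹Nonempty X›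
    exact absurd (hmem x) (by simp)
  | cons x l =>
    constructor
    · rintro ⟨s, hs, r, hr, h⟩
      obtain ⟨p, hp, rfl⟩ := (mem_concatVars_start C).1 hs
      obtain ⟨h1, h2, -⟩ := words_of_cRun C hnd h hr (l₁ := []) rfl
      intro y
      rcases List.mem_cons.1 (hmem y) with rfl | hy
      · obtain ⟨f, hf, hf'⟩ := NFA.mem_acceptsFrom.1 h1
        exact NFA.mem_accepts.2 ⟨f, hf, NFA.mem_evalFrom_iff_exists.2 ⟨p, hp, hf'⟩⟩
      · exact h2 y hy
    · intro h
      obtain ⟨f, hf, hf'⟩ := NFA.mem_accepts.1 (h x)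
      obtain ⟨p, hp, hf'⟩ := NFA.mem_evalFrom_iff_exists.1 hf'
      obtain ⟨r, hr, hrun⟩ := exists_cRun_of_words C hnd (l₁ := []) rfl
        (NFA.mem_acceptsFrom.2 ⟨f, hf, hf'⟩) (fun y _ => h y) (fun y hy hy' =>
          absurd (hmem y) (by simp [hy, hy']))
      exact ⟨⟨x, p⟩, (mem_concatVars_start C).2 ⟨p, hp, rfl⟩, r, hr, hrun⟩

end

end MultiDiseq

/-! ### Runs through the levels and their samples -/

namespace TagAut

open scoped Classical

variable {T S : Type*}

theorem mem_concatEps_states {M N : TagAut T S} {s : S} :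
    s ∈ (M.concatEps N).states ↔ s ∈ M.states ∨ s ∈ N.states :=
  Finset.mem_union

theorem tagCount_nil (τ : T) : tagCount τ ([] : List (S × Finset T × S)) = 0 := rfl

theorem tagCount_cons (τ : T) (t : S × Finset T × S) (l : List (S × Finset T × S)) :
    tagCount τ (t :: l) = tagCount τ l + if τ ∈ t.2.1 then 1 else 0 := by
  simp [tagCount, List.countP_cons]

end TagAut

namespace MultiDiseq

open scoped Classical
open TagAut (tagCount tagCount_nil tagCount_cons)

variable {A : Type uA} {X : Type uX} {Q : X → Type uQ} {I : Type uI} {n : ℕ}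

/-- A mismatch (with its letter) or copy (without letter) transition of a run, together with the
number of letters of every variable that are read before it. -/
structure Sample (A : Type uA) (X : Type uX) (n : ℕ) where
  var : X
  diseq : Fin n
  side : Side
  letter : Option A
  pos : X → ℕ

/-- The tag of a sample on level `k`. -/
def Sample.tag (e : Sample A X n) (k : ℕ) : Tag A X n :=
  match e.letter with
  | some a => .mis k e.var e.diseq e.side a
  | none => .cop k e.var e.diseq e.side

/-- The level mentioned by a tag. -/
def tagLevel : Tag A X n → Option ℕ
  | .sym _ => none
  | .len _ => none
  | .mis i _ _ _ _ => some i
  | .cop i _ _ _ => some i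
  | .pos i _ => some i

/-- The counters `pos` after reading a letter of `z`. -/
noncomputable def incAt (pos : X → ℕ) (z : X) : X → ℕ :=
  fun x => if x = z then pos x + 1 else pos x

/-- `MRun M i pos q L E u r`: the transitions `L` lead from level `i` of the state `q` to the state
`r`, sample `E` and read the words `u`; the letters read are counted from `pos` on. -/
inductive MRun {S : Type*} (M : TagAut (Tag A X n) S) : ℕ → (X → ℕ) → S →
    List ((S × ℕ) × Finset (Tag A X n) × (S × ℕ)) → List (Sample A X n) → (X → List A) → S → Prop
  | nil (i : ℕ) (pos : X → ℕ) (q : S) : MRun M i pos q [] [] (fun _ => []) q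
  | read {i : ℕ} {pos : X → ℕ} {q q' r : S} {L E} {u : X → List A} (a : A) (z : X)
      (hi : 1 ≤ i) (ht : (q, {Tag.sym a, Tag.len z}, q') ∈ M.trans)
      (h : MRun M i (incAt pos z) q' L E u r) :
      MRun M i pos q (((q, i), {Tag.sym a, Tag.len z, Tag.pos i z}, (q', i)) :: L) E
        (consAt u z a) r
  | eps {i : ℕ} {pos : X → ℕ} {q q' r : S} {L E} {u : X → List A}
      (hi : 1 ≤ i) (ht : (q, ∅, q') ∈ M.trans) (h : MRun M i pos q' L E u r) :
      MRun M i pos q (((q, i), ∅, (q', i)) :: L) E u r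
  | mis {i : ℕ} {pos : X → ℕ} {q q' r : S} {L E} {u : X → List A} (a : A) (z : X) (D : Fin n)
      (s : Side) (hi : 1 ≤ i) (ht : (q, {Tag.sym a, Tag.len z}, q') ∈ M.trans)
      (h : MRun M (i + 1) (incAt pos z) q' L E u r) :
      MRun M i pos q
        (((q, i), {Tag.sym a, Tag.mis i z D s a, Tag.len z, Tag.pos (i + 1) z}, (q', i + 1)) :: L)
        (⟨z, D, s, some a, pos⟩ :: E) (consAt u z a) r
  | cop {i : ℕ} {pos : X → ℕ} {q r : S} {L E} {u : X → List A} (z : X) (D : Fin n)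
      (s : Side) (hi : 2 ≤ i) (ht : q ∈ M.states)
      (h : MRun M (i + 1) pos q L E u r) :
      MRun M i pos q (((q, i), {Tag.cop i z D s}, (q, i + 1)) :: L)
        (⟨z, D, s, none, pos⟩ :: E) u r

namespace MRun

variable {S : Type*} {M : TagAut (Tag A X n) S} {i : ℕ} {pos : X → ℕ} {q r : S}
  {L : List ((S × ℕ) × Finset (Tag A X n) × (S × ℕ))} {E : List (Sample A X n)} {u : X → List A}

theorem cRun (h : MRun M i pos q L E u r) : CRun M q u r := by
  induction h with
  | nil i pos q => exact .nil q
  | read a z hi ht h ih => exact .read a z ht ih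
  | eps hi ht h ih => exact .eps ht ih
  | mis a z D s hi ht h ih => exact .read a z ht ih
  | cop z D s hi ht h ih => exact ih

theorem tagCount_len (h : MRun M i pos q L E u r) (x : X) :
    tagCount (.len x) L = (u x).length := by
  induction h with
  | nil i pos q => rfl
  | read a z hi ht h ih =>
    rw [tagCount_cons, ih]
    by_cases hx : x = z <;> simp [consAt, hx]
  | eps hi ht h ih => simp [tagCount_cons, ih]
  | mis a z D s hi ht h ih =>
    rw [tagCount_cons, ih]
    by_cases hx : x = z <;> simp [consAt, hx]
  | cop z D s hi ht h ih => simp [tagCount_cons, ih]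

/-- Levels never decrease along a run, and a transition leaving level `i` carries only tags of level
`i` or `i + 1`, besides those without level. -/
theorem tagCount_eq_zero (h : MRun M i pos q L E u r) {τ : Tag A X n} {k : ℕ}
    (hτ : tagLevel τ = some k) (hk : k < i) : tagCount τ L = 0 := by
  induction h with
  | nil i pos q => rfl
  | read a z hi ht h ih =>
    rw [tagCount_cons, ih hk]
    cases τ <;> simp_all [tagLevel]
    omega
  | eps hi ht h ih => simp [tagCount_cons, ih hk]
  | mis a z D s hi ht h ih =>
    rw [tagCount_cons, ih (by omega)]
    cases τ <;> simp_all [tagLevel] <;> omega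
  | cop z D s hi ht h ih =>
    rw [tagCount_cons, ih (by omega)]
    cases τ <;> simp_all [tagLevel]
    omega

/-- Only the crossing from level `i + k` to the next can carry a mismatch or copy tag of that level,
and it belongs to the sample with index `k`. `Sample.tag` handles both kinds at once and forgets the
field `pos`. -/
theorem tagCount_sample (h : MRun M i pos q L E u r) (k : ℕ) (e : Sample A X n) :
    tagCount (e.tag (i + k)) L =
      if ∃ e' ∈ E[k]?, e'.tag (i + k) = e.tag (i + k) then 1 else 0 := by
  have hlvl : ∀ j, tagLevel (e.tag j) = some j := by
    intro j
    unfold Sample.tag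
    cases e.letter <;> rfl
  have hne : ∀ j, (∀ a, e.tag j ≠ .sym a) ∧ (∀ x, e.tag j ≠ .len x) ∧
      ∀ i x, e.tag j ≠ .pos i x := by
    intro j
    unfold Sample.tag
    cases e.letter <;> simp
  induction h generalizing k with
  | nil i pos q => simp [tagCount_nil]
  | read a z hi ht h ih =>
    rw [tagCount_cons, ih]
    simp [hne]
  | eps hi ht h ih =>
    rw [tagCount_cons, ih]
    simp
  | @mis i pos q q' r L E u a z D s hi ht h ih =>
    rw [tagCount_cons]
    have hm : (e.tag (i + k) ∈
        ({Tag.sym a, Tag.mis i z D s a, Tag.len z, Tag.pos (i + 1) z} : Finset (Tag A X n))) ↔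
          Tag.mis i z D s a = e.tag (i + k) := by
      simp [hne, eq_comm]
    simp only [hm]
    cases k with
    | zero =>
      -- The rest of the run lives on higher levels and contributes no further occurrence.
      rw [h.tagCount_eq_zero (hlvl _) (by omega)]
      simp [Sample.tag]
    | succ k =>
      have := ih k
      rw [show i + 1 + k = i + (k + 1) by omega] at this
      rw [this, if_neg (c := Tag.mis i z D s a = _), List.getElem?_cons_succ, add_zero]
      intro h'
      have := hlvl (i + (k + 1))
      rw [← h'] at this
      simp [tagLevel] at this
  | @cop i pos q r L E u z D s hi ht h ih =>
    rw [tagCount_cons]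
    have hm : (e.tag (i + k) ∈ ({Tag.cop i z D s} : Finset (Tag A X n))) ↔
          Tag.cop i z D s = e.tag (i + k) := by
      simp [eq_comm]
    simp only [hm]
    cases k with
    | zero =>
      rw [h.tagCount_eq_zero (hlvl _) (by omega)]
      simp [Sample.tag]
    | succ k =>
      have := ih k
      rw [show i + 1 + k = i + (k + 1) by omega] at this
      rw [this, if_neg (c := Tag.cop i z D s = _), List.getElem?_cons_succ, add_zero]
      intro h'
      have := hlvl (i + (k + 1))
      rw [← h'] at this
      simp [tagLevel] at this

/-- The letters counted on levels up to `i + k` are those read before the sample with index `k`,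
because a mismatch transition counts its own letter on the level that it enters. -/
theorem sum_tagCount_pos (h : MRun M i pos q L E u r) (hi : 1 ≤ i) (v : X) {k : ℕ}
    {e : Sample A X n} (he : E[k]? = some e) :
    pos v + ∑ j ∈ Finset.Icc 1 (i + k), tagCount (.pos j v) L = e.pos v := by
  induction h generalizing k with
  | nil i pos q => simp at he
  | @read i pos q q' r L E u a z _ ht h ih =>
    rw [← ih hi he]
    simp only [tagCount_cons, Finset.sum_add_distrib, incAt]
    have : ∑ j ∈ Finset.Icc 1 (i + k), (if (Tag.pos j v : Tag A X n) ∈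
        ({Tag.sym a, Tag.len z, Tag.pos i z} : Finset (Tag A X n)) then 1 else 0) =
          if v = z then 1 else 0 := by
      by_cases hv : v = z
      · simp [hv, hi]
      · simp [hv]
    rw [this]
    split_ifs <;> omega
  | eps _ ht h ih =>
    rw [← ih hi he]
    simp [tagCount_cons]
  | @mis i pos q q' r L E u a z D s _ ht h ih =>
    cases k with
    | zero =>
      simp only [List.getElem?_cons_zero, Option.some.injEq] at he
      subst he
      simp only [add_zero, Nat.add_eq_left]
      refine Finset.sum_eq_zero fun j hj => ?_
      rw [Finset.mem_Icc] at hj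
      rw [tagCount_cons, h.tagCount_eq_zero (k := j) rfl (by omega)]
      -- The sampled letter itself is counted on level `i + 1`, outside the range of the sum.
      have : j ≠ i + 1 := by omega
      simp [this]
    | succ k =>
      rw [List.getElem?_cons_succ] at he
      rw [← ih (by omega) he]
      simp only [tagCount_cons, Finset.sum_add_distrib, incAt]
      have : ∑ j ∈ Finset.Icc 1 (i + (k + 1)), (if (Tag.pos j v : Tag A X n) ∈
          ({Tag.sym a, Tag.mis i z D s a, Tag.len z, Tag.pos (i + 1) z} : Finset (Tag A X n))
          then 1 else 0) = if v = z then 1 else 0 := by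
        by_cases hv : v = z
        · simp [hv]
        · simp [hv]
      rw [this, show i + 1 + k = i + (k + 1) by omega]
      split_ifs <;> omega
  | @cop i pos q r L E u z D s _ ht h ih =>
    cases k with
    | zero =>
      simp only [List.getElem?_cons_zero, Option.some.injEq] at he
      subst he
      simp only [add_zero, Nat.add_eq_left]
      refine Finset.sum_eq_zero fun j hj => ?_
      rw [Finset.mem_Icc] at hj
      rw [tagCount_cons, h.tagCount_eq_zero (k := j) rfl (by omega)]
      simp
    | succ k =>
      rw [List.getElem?_cons_succ] at he
      rw [← ih (by omega) he, show i + 1 + k = i + (k + 1) by omega]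
      simp [tagCount_cons]

/-- Preserves the invariant behind `getElem?_of_mem`: the words still to be read are what remains of
`w` beyond the counters. -/
theorem drop_incAt {w : X → List A} {u : X → List A} {a : A} {z : X}
    (hw : ∀ x, (w x).drop (pos x) = consAt u z a x) (x : X) :
    (w x).drop (incAt pos z x) = u x := by
  have := hw x
  unfold consAt at this
  unfold incAt
  split_ifs at this ⊢
  · rw [← List.drop_drop, this, List.drop_one, List.tail_cons]
  · exact this

theorem getElem?_of_drop {w : X → List A} {u : X → List A} {a : A} {z : X}
    (hw : ∀ x, (w x).drop (pos x) = consAt u z a x) : (w z)[pos z]? = some a := by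
  have := congrArg (fun l : List A => l[0]?) (hw z)
  simpa [consAt_self] using this

/-- A mismatch samples a letter of the word read. -/
theorem getElem?_of_mem (h : MRun M i pos q L E u r) {w : X → List A}
    (hw : ∀ x, (w x).drop (pos x) = u x) {e : Sample A X n} (he : e ∈ E) {a : A}
    (ha : e.letter = some a) : (w e.var)[e.pos e.var]? = some a := by
  induction h with
  | nil i pos q => simp at he
  | read b z _ ht h ih => exact ih (drop_incAt hw) he
  | eps _ ht h ih => exact ih hw he
  | mis b z D s _ ht h ih =>
    rcases List.mem_cons.1 he with rfl | he
    · simp only [Option.some.injEq] at ha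
      subst ha
      exact getElem?_of_drop hw
    · exact ih (drop_incAt hw) he
  | cop z D s _ ht h ih =>
    rcases List.mem_cons.1 he with rfl | he
    · simp at ha
    · exact ih hw he

/-- Copy transitions start on level `2` at the earliest, so level `1` can be left only by a
mismatch. -/
theorem letter_ne_none (h : MRun M 1 pos q L E u r) {e : Sample A X n} (he : E[0]? = some e) :
    e.letter ≠ none := by
  generalize hi : 1 = i at h
  induction h with
  | nil i pos q => simp at he
  | read b z _ ht h ih => exact ih he hi
  | eps _ ht h ih => exact ih he hi
  | mis b z D s _ ht h ih =>
    simp only [List.getElem?_cons_zero, Option.some.injEq] at he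
    simp [← he]
  | cop z D s hi' ht h ih => omega

end MRun

theorem mem_concatVars_states [Fintype A] [Fintype X] [∀ x, Fintype (Q x)]
    (C : DiseqConstraint A X Q I n) {s : Σ x, Q x} {vs : List X} (h : s.1 ∈ vs) :
    s ∈ (concatVars C vs).states := by
  induction vs with
  | nil => simp at h
  | cons x l ih =>
    have hx : s.1 = x → s ∈ (lenTagAut n x (C.nfa x)).states := by
      rintro rfl
      exact Finset.mem_image.2 ⟨s.2, Finset.mem_univ _, rfl⟩
    cases l with
    | nil => exact hx (by simpa using h)
    | cons y l =>
      change s ∈ ((lenTagAut n x (C.nfa x)).concatEps (concatVars C (y :: l))).states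
      exact TagAut.mem_concatEps_states.2 ((List.mem_cons.1 h).imp hx ih)

section

variable [Fintype A] [Fintype X] [∀ x, Fintype (Q x)] [LinearOrder X]
  (C : DiseqConstraint A X Q I n)

theorem mem_multiAut_trans {t : ((Σ x, Q x) × ℕ) × Finset (Tag A X n) × ((Σ x, Q x) × ℕ)} :
    t ∈ (multiAut C).trans ↔
      (∃ q a z r i, (q, {Tag.sym a, Tag.len z}, r) ∈ (conAut C).trans ∧ (1 ≤ i ∧ i ≤ 2 * n + 1) ∧
        t = ((q, i), {Tag.sym a, Tag.len z, Tag.pos i z}, (r, i))) ∨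
      (∃ q r i, (q, ∅, r) ∈ (conAut C).trans ∧ (1 ≤ i ∧ i ≤ 2 * n + 1) ∧
        t = ((q, i), ∅, (r, i))) ∨
      (∃ q a z r i D s, (q, {Tag.sym a, Tag.len z}, r) ∈ (conAut C).trans ∧ (1 ≤ i ∧ i ≤ 2 * n) ∧
        t = ((q, i), {Tag.sym a, Tag.mis i z D s a, Tag.len z, Tag.pos (i + 1) z}, (r, i + 1))) ∨
      (∃ q i x D s, q ∈ (conAut C).states ∧ (2 ≤ i ∧ i ≤ 2 * n) ∧
        t = ((q, i), {Tag.cop i x D s}, (q, i + 1))) := by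
  simp only [multiAut, Finset.mem_union, Finset.mem_image, Finset.mem_product, readMoves, epsMoves,
    Finset.mem_filter, Finset.mem_univ, true_and, and_true, Finset.mem_Icc, or_assoc]
  refine or_congr ?_ (or_congr ?_ (or_congr ?_ ?_))
  · constructor
    · rintro ⟨⟨⟨q, a, z, r⟩, i⟩, ⟨h1, h2⟩, rfl⟩
      exact ⟨q, a, z, r, i, h1, h2, rfl⟩
    · rintro ⟨q, a, z, r, i, h1, h2, rfl⟩
      exact ⟨⟨⟨q, a, z, r⟩, i⟩, ⟨h1, h2⟩, rfl⟩
  · constructor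
    · rintro ⟨⟨⟨q, r⟩, i⟩, ⟨h1, h2⟩, rfl⟩
      exact ⟨q, r, i, h1, h2, rfl⟩
    · rintro ⟨q, r, i, h1, h2, rfl⟩
      exact ⟨⟨⟨q, r⟩, i⟩, ⟨h1, h2⟩, rfl⟩
  · constructor
    · rintro ⟨⟨⟨q, a, z, r⟩, i, D, s⟩, ⟨h1, h2⟩, rfl⟩
      exact ⟨q, a, z, r, i, D, s, h1, h2, rfl⟩
    · rintro ⟨q, a, z, r, i, D, s, h1, h2, rfl⟩
      exact ⟨⟨⟨q, a, z, r⟩, i, D, s⟩, ⟨h1, h2⟩, rfl⟩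
  · constructor
    · rintro ⟨⟨q, i, x, D, s⟩, ⟨h1, h2⟩, rfl⟩
      exact ⟨q, i, x, D, s, h1, h2, rfl⟩
    · rintro ⟨q, i, x, D, s, h1, h2, rfl⟩
      exact ⟨⟨q, i, x, D, s⟩, ⟨h1, h2⟩, rfl⟩

/-- `MRun` has no upper bound on levels. Since every sample raises the level by one, the number `2 *
n + 1` of levels of the automaton becomes a bound on the number of samples; `MRun.isWalk` goes back.
-/
theorem exists_mRun_of_walk {L : List (((Σ x, Q x) × ℕ) × Finset (Tag A X n) × ((Σ x, Q x) × ℕ))}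
    {p r : (Σ x, Q x) × ℕ} (hL : IsWalk p L r) (hm : ∀ t ∈ L, t ∈ (multiAut C).trans)
    (hp : p.2 ≤ 2 * n + 1) (pos : X → ℕ) :
    ∃ E u, MRun (conAut C) p.2 pos p.1 L E u r.1 ∧ p.2 + E.length ≤ 2 * n + 1 := by
  induction L generalizing p pos with
  | nil =>
    cases hL
    exact ⟨[], _, .nil _ _ _, hp⟩
  | cons t L ih =>
    obtain ⟨rfl, hL⟩ := hL
    have hm' := fun s hs => hm s (List.mem_cons_of_mem t hs)
    rcases (mem_multiAut_trans C).1 (hm t (by simp)) with ⟨q, a, z, q', i, h, hi, rfl⟩ |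
      ⟨q, q', i, h, hi, rfl⟩ | ⟨q, a, z, q', i, D, s, h, hi, rfl⟩ | ⟨q, i, z, D, s, h, hi, rfl⟩
    · obtain ⟨E, u, hE, hle⟩ := ih hL hm' hp (incAt pos z)
      exact ⟨E, _, .read a z hi.1 h hE, hle⟩
    · obtain ⟨E, u, hE, hle⟩ := ih hL hm' hp pos
      exact ⟨E, u, .eps hi.1 h hE, hle⟩
    · obtain ⟨E, u, hE, hle⟩ := ih hL hm' (by simpa using hi.2) (incAt pos z)
      exact ⟨_, _, .mis a z D s hi.1 h hE, by
        simp only [List.length_cons] at hle ⊢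
        omega⟩
    · obtain ⟨E, u, hE, hle⟩ := ih hL hm' (by simpa using hi.2) pos
      exact ⟨_, u, .cop z D s hi.1 h hE, by
        simp only [List.length_cons] at hle ⊢
        omega⟩

theorem MRun.isWalk {L : List (((Σ x, Q x) × ℕ) × Finset (Tag A X n) × ((Σ x, Q x) × ℕ))}
    {i : ℕ} {pos : X → ℕ} {q r : Σ x, Q x} {E : List (Sample A X n)} {u : X → List A}
    (h : MRun (conAut C) i pos q L E u r) (hle : i + E.length ≤ 2 * n + 1) :
    IsWalk (q, i) L (r, i + E.length) ∧ ∀ t ∈ L, t ∈ (multiAut C).trans := by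
  induction h with
  | nil i pos q => exact ⟨rfl, by simp⟩
  | read a z hi ht h ih =>
    exact ⟨⟨rfl, (ih hle).1⟩, List.forall_mem_cons.2
      ⟨(mem_multiAut_trans C).2 (Or.inl ⟨_, a, z, _, _, ht, ⟨hi, by omega⟩, rfl⟩), (ih hle).2⟩⟩
  | eps hi ht h ih =>
    exact ⟨⟨rfl, (ih hle).1⟩, List.forall_mem_cons.2
      ⟨(mem_multiAut_trans C).2 (Or.inr (Or.inl ⟨_, _, _, ht, ⟨hi, by omega⟩, rfl⟩)),
        (ih hle).2⟩⟩
  | @mis i pos q q' r L E u a z D s hi ht h ih =>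
    rw [List.length_cons] at hle
    obtain ⟨h1, h2⟩ := ih (by omega)
    refine ⟨⟨rfl, ?_⟩, List.forall_mem_cons.2 ⟨(mem_multiAut_trans C).2
      (Or.inr (Or.inr (Or.inl ⟨_, a, z, _, _, D, s, ht, ⟨hi, by omega⟩, rfl⟩))), h2⟩⟩
    rwa [add_assoc, add_comm 1] at h1
  | @cop i pos q r L E u z D s hi ht h ih =>
    rw [List.length_cons] at hle
    obtain ⟨h1, h2⟩ := ih (by omega)
    refine ⟨⟨rfl, ?_⟩, List.forall_mem_cons.2 ⟨(mem_multiAut_trans C).2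
      (Or.inr (Or.inr (Or.inr ⟨_, _, z, D, s, ht, ⟨hi, by omega⟩, rfl⟩))), h2⟩⟩
    rwa [add_assoc, add_comm 1] at h1

theorem mem_conAut_states (s : Σ x, Q x) : s ∈ (conAut C).states :=
  mem_concatVars_states C (vs := (Finset.univ : Finset X).sort (· ≤ ·)) (by simp)

theorem wellFormed_multiAut : (multiAut C).WellFormed := by
  have hs : ∀ (q : Σ x, Q x) (i : ℕ), 1 ≤ i → i ≤ 2 * n + 1 → (q, i) ∈ (multiAut C).states :=
    fun q i h1 h2 => Finset.mem_product.2 ⟨mem_conAut_states C q, Finset.mem_Icc.2 ⟨h1, h2⟩⟩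
  refine ⟨fun t ht => ?_, fun t ht => ?_, fun q hq => ?_, fun q hq => ?_⟩
  · rcases (mem_multiAut_trans C).1 ht with ⟨q, a, z, q', i, h, hi, rfl⟩ |
      ⟨q, q', i, h, hi, rfl⟩ | ⟨q, a, z, q', i, D, s, h, hi, rfl⟩ | ⟨q, i, z, D, s, h, hi, rfl⟩ <;>
      exact hs _ _ (by omega) (by omega)
  · rcases (mem_multiAut_trans C).1 ht with ⟨q, a, z, q', i, h, hi, rfl⟩ |
      ⟨q, q', i, h, hi, rfl⟩ | ⟨q, a, z, q', i, D, s, h, hi, rfl⟩ | ⟨q, i, z, D, s, h, hi, rfl⟩ <;>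
      exact hs _ _ (by omega) (by omega)
  · simp only [multiAut, Finset.mem_product, Finset.mem_singleton] at hq
    exact hs q.1 q.2 (by omega) (by omega)
  · simp only [multiAut, Finset.mem_product, Finset.mem_filter, Finset.mem_Icc] at hq
    exact hs q.1 q.2 (by omega) (by omega)

end

end MultiDiseq

/-! ### Meaning of the subformulas in terms of the samples -/

namespace MultiDiseq

open scoped Classical
open TagAut (tagCount tagCount_nil tagCount_cons)

/-- At most one summand is nonzero, since `o` contains at most one element. With `o = E[k]?` this
evaluates sums of counters on one level. -/
theorem sum_ite_exists {α ι : Type*} [Fintype ι] (o : Option α) (P : α → Prop) (g : α → ι)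
    {_ : ∀ i, Decidable (∃ e, o = some e ∧ P e ∧ g e = i)}
    {_ : Decidable (∃ e, o = some e ∧ P e)} :
    ∑ i, (if ∃ e, o = some e ∧ P e ∧ g e = i then (1 : ℤ) else 0) =
      if ∃ e, o = some e ∧ P e then 1 else 0 := by
  cases o with
  | none => simp
  | some e => by_cases h : P e <;> simp [h]

theorem sum_ite_exists_some {α ι : Type*} [Fintype ι] (o : Option α) (P : α → Prop)
    (g : α → Option ι) {_ : ∀ i, Decidable (∃ e, o = some e ∧ P e ∧ g e = some i)}
    {_ : Decidable (∃ e, o = some e ∧ P e ∧ g e ≠ none)} :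
    ∑ i, (if ∃ e, o = some e ∧ P e ∧ g e = some i then (1 : ℤ) else 0) =
      if ∃ e, o = some e ∧ P e ∧ g e ≠ none then 1 else 0 := by
  cases o with
  | none => simp
  | some e => by_cases h : P e <;> cases hg : g e <;> simp [h, hg]

theorem ite_pos_iff {P : Prop} {_ : Decidable P} : (0 : ℤ) < (if P then 1 else 0) ↔ P := by
  split_ifs with h <;> simp [h]

theorem ite_one_iff {P : Prop} {_ : Decidable P} : (if P then 1 else 0) = (1 : ℤ) ↔ P := by
  split_ifs with h <;> simp [h]

theorem ite_zero_iff {P : Prop} {_ : Decidable P} : (if P then 1 else 0) = (0 : ℤ) ↔ ¬ P := by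
  split_ifs with h <;> simp [h]

variable {A : Type uA} {X : Type uX} {Q : X → Type uQ} {I : Type uI} {n : ℕ} {S : Type*}

/-- The tag variables have the values determined by a run that samples `E` and reads `u`. -/
structure Represents (σ : MVar A X S n → ℤ) (E : List (Sample A X n)) (u : X → List A) :
    Prop where
  len : ∀ x, σ (.parikh (.tag (.len x))) = (u x).length
  mis : ∀ k < 2 * n, ∀ x D s a, σ (.parikh (.tag (.mis (k + 1) x D s a))) =
    if ∃ e : Sample A X n, E[k]? = some e ∧ e.var = x ∧ e.diseq = D ∧ e.side = s ∧ e.letter = some a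
      then 1 else 0
  cop : ∀ k < 2 * n, ∀ x D s, σ (.parikh (.tag (.cop (k + 1) x D s))) =
    if ∃ e : Sample A X n, E[k]? = some e ∧ e.var = x ∧ e.diseq = D ∧ e.side = s ∧ e.letter = none
      then 1 else 0
  pos : ∀ (k : ℕ) (e : Sample A X n), E[k]? = some e → ∀ v,
    ∑ j ∈ Finset.Icc 1 (k + 1), σ (.parikh (.tag (.pos j v))) = e.pos v
  first : ∀ e, E[0]? = some e → e.letter ≠ none
  letter : ∀ e ∈ E, ∀ a, e.letter = some a → (u e.var)[e.pos e.var]? = some a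
  length_le : E.length ≤ 2 * n

section

variable [Fintype A] [Fintype X]

theorem represents_of_mRun {M : TagAut (Tag A X n) S} {q r : S}
    {L : List ((S × ℕ) × Finset (Tag A X n) × (S × ℕ))} {E : List (Sample A X n)}
    {u : X → List A} {σ : MVar A X (S × ℕ) n → ℤ} (h : MRun M 1 (fun _ => 0) q L E u r)
    (hE : E.length ≤ 2 * n)
    (hσ : ∀ τ ∈ allTags A X n, σ (.parikh (.tag τ)) = tagCount τ L) : Represents σ E u where
  len x := by
    rw [hσ _ (by simp [allTags]), h.tagCount_len]
  mis k hk x D s a := by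
    rw [hσ _ (by simp [allTags]; omega)]
    have := h.tagCount_sample k ⟨x, D, s, some a, fun _ => 0⟩
    rw [add_comm] at this
    change tagCount (.mis (k + 1) x D s a) L = _ at this
    rw [this, Nat.cast_ite, Nat.cast_one, Nat.cast_zero]
    refine if_congr (exists_congr fun e => and_congr Iff.rfl ?_) rfl rfl
    unfold Sample.tag
    cases e.letter <;> simp
  cop k hk x D s := by
    rw [hσ _ (by simp [allTags]; omega)]
    have := h.tagCount_sample k ⟨x, D, s, none, fun _ => 0⟩
    rw [add_comm] at this
    change tagCount (.cop (k + 1) x D s) L = _ at this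
    rw [this, Nat.cast_ite, Nat.cast_one, Nat.cast_zero]
    refine if_congr (exists_congr fun e => and_congr Iff.rfl ?_) rfl rfl
    unfold Sample.tag
    cases e.letter <;> simp
  pos k e he v := by
    have hk := (List.getElem?_eq_some_iff.1 he).1
    rw [← h.sum_tagCount_pos le_rfl v he, zero_add, Nat.cast_sum, add_comm 1 k]
    refine Finset.sum_congr rfl fun j hj => ?_
    rw [Finset.mem_Icc] at hj
    exact hσ _ (by simp [allTags]; omega)
  first e he := h.letter_ne_none he
  letter e he a ha := h.getElem?_of_mem (fun x => by simp) he ha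
  length_le := hE

end

/-- A copy comes immediately after a sample of the same letter. -/
def CopiesFollow (E : List (Sample A X n)) : Prop :=
  ∀ k e', E[k + 1]? = some e' → e'.letter = none → ∃ e : Sample A X n, E[k]? = some e ∧ e.var = e'.var ∧
    e'.pos e'.var = e.pos e'.var + if e.letter ≠ none then 1 else 0

namespace Represents

variable [Fintype A] {σ : MVar A X S n → ℤ} {E : List (Sample A X n)} {u : X → List A}
  (h : Represents σ E u)

include h

theorem lt_of_getElem? {k : ℕ} {e : Sample A X n} (he : E[k]? = some e) : k < 2 * n :=
  lt_of_lt_of_le (List.getElem?_eq_some_iff.1 he).1 h.length_le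

theorem eval_cnt_cop {k : ℕ} (hk : k < 2 * n) (x : X) (D : Fin n) (s : Side) :
    (cnt (S := S) (.cop (A := A) (k + 1) x D s)).eval σ =
      if ∃ e : Sample A X n, E[k]? = some e ∧ e.var = x ∧ e.diseq = D ∧ e.side = s ∧ e.letter = none
        then 1 else 0 :=
  h.cop k hk x D s

theorem eval_cnt_mis {k : ℕ} (hk : k < 2 * n) (x : X) (D : Fin n) (s : Side) (a : A) :
    (cnt (S := S) (.mis (k + 1) x D s a)).eval σ =
      if ∃ e : Sample A X n, E[k]? = some e ∧ e.var = x ∧ e.diseq = D ∧ e.side = s ∧ e.letter = some a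
        then 1 else 0 :=
  h.mis k hk x D s a

theorem eval_misCount {k : ℕ} (hk : k < 2 * n) (x : X) (D : Fin n) (s : Side) :
    (misCount (A := A) (S := S) (k + 1) x D s).eval σ =
      if ∃ e : Sample A X n, E[k]? = some e ∧ e.var = x ∧ e.diseq = D ∧ e.side = s ∧ e.letter ≠ none
        then 1 else 0 := by
  rw [misCount, LTerm.eval_sum, Finset.sum_congr rfl fun a _ => h.eval_cnt_mis hk x D s a]
  have key := @sum_ite_exists_some _ _ _ E[k]? (fun e => e.var = x ∧ e.diseq = D ∧ e.side = s)
    Sample.letter (fun _ => Classical.propDecidable _) (Classical.propDecidable _)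
  convert key using 4 <;> simp only [and_assoc]

theorem eval_misTotal {k : ℕ} (hk : k < 2 * n) (x : X) :
    (misTotal (A := A) (S := S) (n := n) (k + 1) x).eval σ =
      if ∃ e : Sample A X n, E[k]? = some e ∧ e.var = x ∧ e.letter ≠ none then 1 else 0 := by
  rw [misTotal, LTerm.eval_sum, Finset.sum_congr rfl fun d _ => h.eval_misCount hk x d.1 d.2,
    ← sum_ite_exists E[k]? (fun e => e.var = x ∧ e.letter ≠ none) fun e => (e.diseq, e.side)]
  refine Finset.sum_congr rfl fun d _ => if_congr (exists_congr fun e => ?_) rfl rfl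
  simp only [Prod.ext_iff]
  tauto

theorem eval_copTotal {k : ℕ} (hk : k < 2 * n) (x : X) :
    (copTotal (A := A) (S := S) (n := n) (k + 1) x).eval σ =
      if ∃ e : Sample A X n, E[k]? = some e ∧ e.var = x ∧ e.letter = none then 1 else 0 := by
  rw [copTotal, LTerm.eval_sum, Finset.sum_congr rfl fun d _ => h.eval_cnt_cop hk x d.1 d.2,
    ← sum_ite_exists E[k]? (fun e => e.var = x ∧ e.letter = none) fun e => (e.diseq, e.side)]
  refine Finset.sum_congr rfl fun d _ => if_congr (exists_congr fun e => ?_) rfl rfl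
  simp only [Prod.ext_iff]
  tauto

theorem eval_sum_mis [Fintype X] {k : ℕ} (hk : k < 2 * n) (D : Fin n) (s : Side) (a : A) :
    (LTerm.sum (Finset.univ : Finset X) fun x => cnt (S := S) (.mis (k + 1) x D s a)).eval σ =
      if ∃ e : Sample A X n, E[k]? = some e ∧ e.diseq = D ∧ e.side = s ∧ e.letter = some a then 1 else 0 := by
  rw [LTerm.eval_sum, Finset.sum_congr rfl fun x _ => h.eval_cnt_mis hk x D s a,
    ← sum_ite_exists E[k]? (fun e => e.diseq = D ∧ e.side = s ∧ e.letter = some a) Sample.var]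
  refine Finset.sum_congr rfl fun d _ => if_congr (exists_congr fun e => ?_) rfl rfl
  tauto

theorem eval_sum_cop [Fintype X] {k : ℕ} (hk : k < 2 * n) (D : Fin n) (s : Side) :
    (LTerm.sum (Finset.univ : Finset X) fun x =>
      cnt (S := S) (.cop (A := A) (k + 1) x D s)).eval σ =
      if ∃ e : Sample A X n, E[k]? = some e ∧ e.diseq = D ∧ e.side = s ∧ e.letter = none then 1 else 0 := by
  rw [LTerm.eval_sum, Finset.sum_congr rfl fun x _ => h.eval_cnt_cop hk x D s,
    ← sum_ite_exists E[k]? (fun e => e.diseq = D ∧ e.side = s ∧ e.letter = none) Sample.var]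
  refine Finset.sum_congr rfl fun d _ => if_congr (exists_congr fun e => ?_) rfl rfl
  tauto

omit [Fintype A] in
theorem eval_posSum {k : ℕ} {e : Sample A X n} (he : E[k]? = some e) (v : X) :
    (posSum (A := A) (S := S) (n := n) (k + 1) v).eval σ = e.pos v := by
  rw [posSum, LTerm.eval_sum, ← h.pos k e he v]
  rfl

omit [Fintype A] in
theorem eval_lenTerm (l : List X) :
    (lenTerm (A := A) (S := S) (n := n) l).eval σ = (DiseqConstraint.word u l).length := by
  rw [lenTerm, LTerm.eval_listSum, List.map_map, DiseqConstraint.word, List.length_flatten,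
    List.map_map]
  induction l with
  | nil => rfl
  | cons x l ih =>
    rw [List.map_cons, List.sum_cons, ih, List.map_cons, List.sum_cons, Nat.cast_add]
    congr 1
    exact h.len x

omit [Fintype A] in
-- A difference of successive partial sums: level `k + 2` lies between the samples with indices `k`
-- and `k + 1`, because indices start at `0` and levels at `1`.
theorem eval_cnt_pos {k : ℕ} {e e' : Sample A X n} (he : E[k]? = some e)
    (he' : E[k + 1]? = some e') (v : X) :
    (cnt (S := S) (.pos (A := A) (n := n) (k + 2) v)).eval σ = e'.pos v - e.pos v := by
  have h1 := h.pos _ _ he v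
  have h2 := h.pos _ _ he' v
  rw [Finset.sum_Icc_succ_top (by omega), h1] at h2
  rw [← h2, add_sub_cancel_left]
  rfl

/-- The first conjunct puts a sample in the same variable right before every copy. The second says
that the only letter of this variable counted in between is that of the preceding sample, if it is a
mismatch. -/
theorem holds_copies_iff [Fintype X] :
    (copiesFormula A X S n).Holds σ ↔ CopiesFollow E := by
  simp only [copiesFormula, LIA.Holds, LIA.holds_conj, Finset.mem_product, Finset.mem_univ,
    and_true, Finset.mem_Ico, Finset.mem_Icc, Prod.forall, LTerm.eval]
  constructor
  · rintro ⟨h1, h2⟩ k e' he' hl'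
    have hk := h.lt_of_getElem? he'
    have hc : ∃ e, E[k + 1]? = some e ∧ e.var = e'.var ∧ e.letter = none := ⟨e', he', rfl, hl'⟩
    have h1' := h1 (k + 1) e'.var (by omega)
    rw [h.eval_misTotal (by omega), h.eval_copTotal (by omega), h.eval_copTotal hk,
      if_pos hc] at h1'
    have : ∃ e : Sample A X n, E[k]? = some e ∧ e.var = e'.var := by
      by_contra hne
      push Not at hne
      rw [if_neg (by rintro ⟨e, he, hv, -⟩; exact hne e he hv),
        if_neg (by rintro ⟨e, he, hv, -⟩; exact hne e he hv)] at h1'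
      exact absurd (h1' rfl) one_ne_zero
    obtain ⟨e, he, hv⟩ := this
    refine ⟨e, he, hv, ?_⟩
    have h2' := h2 (k + 2) e'.var (by omega)
    rw [h.eval_copTotal hk, if_pos hc, h.eval_cnt_pos he he',
      show k + 2 - 1 = k + 1 by omega, h.eval_misTotal (by omega)] at h2'
    have h3 := h2' rfl
    simp only [he, Option.some.injEq, exists_eq_left', hv, true_and] at h3
    split_ifs at h3 ⊢ <;> omega
  · intro hE
    constructor
    · rintro i x hi h0
      obtain ⟨k, rfl⟩ : ∃ k, i = k + 1 := ⟨i - 1, by omega⟩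
      rw [h.eval_misTotal (by omega), h.eval_copTotal (by omega)] at h0
      rw [h.eval_copTotal (by omega), ite_zero_iff]
      rintro ⟨e', he', rfl, hl'⟩
      obtain ⟨e, he, hv, -⟩ := hE k e' he' hl'
      simp only [he, Option.some.injEq, exists_eq_left', hv, true_and] at h0
      by_cases hl : e.letter = none <;> simp [hl] at h0
    · rintro i x hi h1
      obtain ⟨k, rfl⟩ : ∃ k, i = k + 2 := ⟨i - 2, by omega⟩
      rw [h.eval_copTotal (by omega), ite_one_iff] at h1
      obtain ⟨e', he', rfl, hl'⟩ := h1
      obtain ⟨e, he, hv, hp⟩ := hE k e' he' hl'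
      rw [h.eval_cnt_pos he he', show k + 2 - 1 = k + 1 by omega, h.eval_misTotal (by omega), hp]
      simp only [he, Option.some.injEq, exists_eq_left', hv, true_and]
      split_ifs <;> simp

theorem holds_consist_iff [Fintype X] :
    (consistFormula A X S n).Holds σ ↔ ∀ (k : ℕ) (e : Sample A X n), E[k]? = some e →
      σ (.shared (k + 1)) = σ (.misSym e.diseq e.side) ∧
      (∀ a, e.letter = some a → σ (.misSym e.diseq e.side) = (Fintype.equivFin A a : ℕ)) ∧
      (e.letter = none → σ (.misSym e.diseq e.side) = σ (.shared k)) := by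
  simp only [consistFormula, LIA.Holds, LIA.holds_conj, Finset.mem_product, Finset.mem_univ,
    true_and, Finset.mem_Icc, Prod.forall, LTerm.eval]
  constructor
  · intro hc k e he
    have hk := h.lt_of_getElem? he
    have key : ∀ a, _ := fun a => hc e.diseq e.side a (k + 1) (by omega)
    simp only [h.eval_sum_mis hk, h.eval_sum_cop hk, he, Option.some.injEq, exists_eq_left',
      true_and, ite_one_iff] at key
    cases hl : e.letter with
    | some a =>
      obtain ⟨h1, h2⟩ := (key a).1 hl
      exact ⟨h1, by rintro b ⟨⟩; exact h2, by simp⟩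
    | none =>
      -- The clauses for copies are also indexed by letters and would be absent over an empty
      -- alphabet. The first sample is a mismatch and provides a letter.
      have : Nonempty A := by
        have h0 : 0 < E.length := by
          have := (List.getElem?_eq_some_iff.1 he).1
          omega
        have := h.first E[0] (List.getElem?_eq_getElem h0)
        cases hl0 : E[0].letter with
        | none => exact absurd hl0 this
        | some a => exact ⟨a⟩
      obtain ⟨a⟩ := this
      obtain ⟨h1, h2⟩ := (key a).2 hl
      exact ⟨h1, by simp, fun _ => h2⟩
  · intro hc D s a i hi
    obtain ⟨k, rfl⟩ : ∃ k, i = k + 1 := ⟨i - 1, by omega⟩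
    rw [h.eval_sum_mis (by omega), h.eval_sum_cop (by omega), ite_one_iff, ite_one_iff]
    constructor
    · rintro ⟨e, he, rfl, rfl, hl⟩
      obtain ⟨h1, h2, -⟩ := hc k e he
      exact ⟨h1, h2 a hl⟩
    · rintro ⟨e, he, rfl, rfl, hl⟩
      obtain ⟨h1, -, h2⟩ := hc k e he
      exact ⟨h1, h2 hl⟩

theorem holds_pos_iff (D : Fin n) (s : Side) (v : X) :
    (posFormula (A := A) (S := S) D s v).Holds σ ↔ ∀ (k : ℕ) (e : Sample A X n), E[k]? = some e → e.var = v →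
      e.diseq = D → e.side = s →
        σ (.misPos D s) = e.pos v - if e.letter = none then 1 else 0 := by
  simp only [posFormula, LIA.Holds, LIA.holds_conj, LIA.holds_lt, Finset.mem_Icc, LTerm.eval]
  constructor
  · rintro ⟨h1, h2⟩ k e he hv hD hs
    have hk := h.lt_of_getElem? he
    by_cases hl : e.letter = none
    · have hk0 : k ≠ 0 := by
        rintro rfl
        exact h.first e he hl
      have := h2 (k + 1) (by omega)
      rw [h.eval_cnt_cop hk, ite_pos_iff, h.eval_posSum he] at this
      rw [if_pos hl]
      exact this ⟨e, he, hv, hD, hs, hl⟩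
    · have := h1 (k + 1) (by omega)
      rw [h.eval_misCount hk, ite_pos_iff, h.eval_posSum he] at this
      rw [if_neg hl, sub_zero]
      exact this ⟨e, he, hv, hD, hs, hl⟩
  · intro hE
    constructor
    · intro i hi
      obtain ⟨k, rfl⟩ : ∃ k, i = k + 1 := ⟨i - 1, by omega⟩
      rw [h.eval_misCount (by omega), ite_pos_iff]
      rintro ⟨e, he, hv, hD, hs, hl⟩
      rw [h.eval_posSum he]
      have := hE k e he hv hD hs
      rw [if_neg hl, sub_zero] at this
      exact this
    · intro i hi
      obtain ⟨k, rfl⟩ : ∃ k, i = k + 1 := ⟨i - 1, by omega⟩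
      rw [h.eval_cnt_cop (by omega), ite_pos_iff]
      rintro ⟨e, he, hv, hD, hs, hl⟩
      rw [h.eval_posSum he]
      have := hE k e he hv hD hs
      rw [if_pos hl] at this
      exact this

theorem holds_present_iff (D : Fin n) (s : Side) (v : X) :
    (presentFormula (A := A) (S := S) D s v).Holds σ ↔
      ∃ (k : ℕ) (e : Sample A X n), E[k]? = some e ∧ e.var = v ∧ e.diseq = D ∧ e.side = s := by
  have hn : 0 < n := D.pos
  simp only [presentFormula, LIA.holds_lt, LTerm.eval, LTerm.eval_sum]
  rw [show (1 : ℕ) = 0 + 1 from rfl, h.eval_misCount (by omega)]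
  constructor
  · intro hpos
    by_contra hne
    push Not at hne
    rw [if_neg (by rintro ⟨e, he, hv, hD, hs, -⟩; exact hne 0 e he hv hD hs),
      Finset.sum_eq_zero] at hpos
    · exact absurd hpos (by simp)
    · intro i hi
      rw [Finset.mem_Icc] at hi
      obtain ⟨k, rfl⟩ : ∃ k, i = k + 1 := ⟨i - 1, by omega⟩
      rw [h.eval_misCount (by omega), h.eval_cnt_cop (by omega),
        if_neg (by rintro ⟨e, he, hv, hD, hs, -⟩; exact hne k e he hv hD hs),
        if_neg (by rintro ⟨e, he, hv, hD, hs, -⟩; exact hne k e he hv hD hs), add_zero]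
  · rintro ⟨k, e, he, hv, hD, hs⟩
    have hk := h.lt_of_getElem? he
    have hnn : ∀ i ∈ Finset.Icc 2 (2 * n), (0 : ℤ) ≤
        (misCount (A := A) (S := S) i v D s).eval σ +
          (cnt (S := S) (.cop (A := A) i v D s)).eval σ := by
      intro i hi
      rw [Finset.mem_Icc] at hi
      obtain ⟨k, rfl⟩ : ∃ k, i = k + 1 := ⟨i - 1, by omega⟩
      rw [h.eval_misCount (by omega), h.eval_cnt_cop (by omega)]
      split_ifs <;> simp
    -- All summands are nonnegative, so one equal to `1` is enough; on level `1` it must be the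
    -- mismatch count.
    rcases Nat.eq_zero_or_pos k with rfl | hk0
    · rw [if_pos ⟨e, he, hv, hD, hs, h.first e he⟩]
      have := Finset.sum_nonneg hnn
      omega
    · have hmem : k + 1 ∈ Finset.Icc 2 (2 * n) := Finset.mem_Icc.2 (by omega)
      have h1 := Finset.single_le_sum hnn hmem
      rw [h.eval_misCount hk, h.eval_cnt_cop hk] at h1
      have h2 : (0 : ℤ) < 1 := one_pos
      by_cases hl : e.letter = none
      · have hc : ∃ e : Sample A X n, E[k]? = some e ∧ e.var = v ∧ e.diseq = D ∧ e.side = s ∧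
            e.letter = none := ⟨e, he, hv, hD, hs, hl⟩
        rw [if_pos hc] at h1
        split_ifs at h1 ⊢ <;> omega
      · have hc : ∃ e : Sample A X n, E[k]? = some e ∧ e.var = v ∧ e.diseq = D ∧ e.side = s ∧
            e.letter ≠ none := ⟨e, he, hv, hD, hs, hl⟩
        rw [if_pos hc] at h1
        split_ifs at h1 ⊢ <;> omega

/-- Summed over the variables, each level contributes the indicator that its sample is taken for
side `s` of `D`. By `hE` at most one level does so. -/
theorem holds_fair [Fintype X]
    (hE : ∀ (k k' : ℕ) (e e' : Sample A X n), E[k]? = some e → E[k']? = some e' → e.diseq = e'.diseq →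
      e.side = e'.side → k = k') : (fairFormula A X S n).Holds σ := by
  simp only [fairFormula, LIA.Holds, LIA.holds_conj, Finset.mem_univ, true_imp_iff, Prod.forall,
    LTerm.eval, LTerm.eval_sum, Finset.sum_product]
  intro D s
  have key : ∀ i ∈ Finset.Icc 1 (2 * n), ∑ x,
      ((misCount (A := A) (S := S) i x D s).eval σ +
        (cnt (S := S) (.cop (A := A) i x D s)).eval σ) =
      if ∃ e, E[i - 1]? = some e ∧ e.diseq = D ∧ e.side = s then 1 else 0 := by
    intro i hi
    rw [Finset.mem_Icc] at hi
    obtain ⟨k, rfl⟩ : ∃ k, i = k + 1 := ⟨i - 1, by omega⟩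
    rw [Nat.add_sub_cancel,
      ← @sum_ite_exists _ _ _ E[k]? (fun e => e.diseq = D ∧ e.side = s) Sample.var
        (fun _ => Classical.propDecidable _)]
    refine Finset.sum_congr rfl fun x _ => ?_
    rw [h.eval_misCount (by omega), h.eval_cnt_cop (by omega)]
    obtain ho | ⟨e, ho⟩ : E[k]? = none ∨ ∃ e, E[k]? = some e := by
      cases E[k]? <;> simp
    · simp [ho]
    · by_cases hl : e.letter = none <;> simp [ho, hl] <;>
        exact if_congr (by tauto) rfl rfl
  rw [Finset.sum_congr rfl key, Finset.sum_boole]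
  have : (Finset.filter (fun i => ∃ e, E[i - 1]? = some e ∧ e.diseq = D ∧ e.side = s)
      (Finset.Icc 1 (2 * n))).card ≤ 1 := by
    rw [Finset.card_le_one]
    intro i hi j hj
    rw [Finset.mem_filter, Finset.mem_Icc] at hi hj
    obtain ⟨hi, e, he, hD, hs⟩ := hi
    obtain ⟨hj, e', he', hD', hs'⟩ := hj
    have := hE _ _ e e' he he' (hD.trans hD'.symm) (hs.trans hs'.symm)
    omega
  exact_mod_cast this

/-- In a model, every sample has a position in its word, where its letter stands. -/
theorem exists_letter [Fintype X] (hcop : CopiesFollow E)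
    (hcon : (consistFormula A X S n).Holds σ) (k : ℕ) (e : Sample A X n) (he : E[k]? = some e) :
    ∃ (a : A) (p : ℕ), (u e.var)[p]? = some a ∧ σ (.shared (k + 1)) = (Fintype.equivFin A a : ℕ) ∧
      σ (.misSym e.diseq e.side) = (Fintype.equivFin A a : ℕ) ∧
      e.pos e.var = p + if e.letter = none then 1 else 0 := by
  rw [h.holds_consist_iff] at hcon
  induction k generalizing e with
  | zero =>
    obtain ⟨h1, h2, -⟩ := hcon 0 e he
    cases hl : e.letter with
    | none => exact absurd hl (h.first e he)
    | some a =>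
      refine ⟨a, e.pos e.var, h.letter e (List.mem_of_getElem? he) a hl, ?_, h2 a hl, by simp⟩
      rw [h1, h2 a hl]
  | succ k ih =>
    obtain ⟨h1, h2, h3⟩ := hcon (k + 1) e he
    cases hl : e.letter with
    | some a =>
      refine ⟨a, e.pos e.var, h.letter e (List.mem_of_getElem? he) a hl, ?_, h2 a hl, by simp⟩
      rw [h1, h2 a hl]
    | none =>
      -- A copy inherits the letter of its predecessor: the code is passed on by the shared
      -- variable, and the position `p` stays the same since the counter of a copy is one past its
      -- letter, whether a mismatch or another copy precedes it.
      obtain ⟨e₀, he₀, hv, hp⟩ := hcop k e he hl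
      obtain ⟨a, p, h4, h5, h6, h7⟩ := ih e₀ he₀
      rw [hv] at h4 h7
      refine ⟨a, p, h4, by rw [h1, h3 hl, h5], by rw [h3 hl, h5], ?_⟩
      rw [hp, h7]
      by_cases hl₀ : e₀.letter = none <;> simp [hl₀]

end Represents

/-- The letters of a concatenation. -/
theorem getElem?_word (u : X → List A) (l : List X) (g : ℕ) (a : A) :
    (DiseqConstraint.word u l)[g]? = some a ↔ ∃ (i : Fin l.length) (p : ℕ),
      (u (l.get i))[p]? = some a ∧ g = (DiseqConstraint.word u (l.take i)).length + p := by
  induction l generalizing g with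
  | nil => simp [DiseqConstraint.word]
  | cons x l ih =>
    have hw : ∀ l, DiseqConstraint.word u (x :: l) = u x ++ DiseqConstraint.word u l := fun _ => by
      simp [DiseqConstraint.word]
    have h0 : DiseqConstraint.word u [] = [] := rfl
    rw [hw, List.getElem?_append]
    constructor
    · split_ifs with hg
      · intro ha
        exact ⟨⟨0, by simp⟩, g, ha, by simp [h0]⟩
      · intro ha
        obtain ⟨i, p, hp, hi⟩ := (ih _).1 ha
        refine ⟨i.succ, p, hp, ?_⟩
        rw [Fin.val_succ, List.take_succ_cons, hw, List.length_append]
        omega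
    · rintro ⟨i, p, hp, rfl⟩
      cases i using Fin.cases with
      | zero =>
        have : p < (u x).length := (List.getElem?_eq_some_iff.1 hp).1
        simpa [h0, this] using hp
      | succ i =>
        rw [Fin.val_succ, List.take_succ_cons, hw, List.length_append, if_neg (by omega)]
        exact (ih _).2 ⟨i, p, hp, by omega⟩

end MultiDiseq

/-! ### Choice of the samples, and equisatisfiability -/

namespace MultiDiseq

open scoped Classical
open TagAut (tagCount)

variable {A : Type uA} {X : Type uX} {Q : X → Type uQ} {I : Type uI} {n : ℕ}

/-- The side of the disequality that a sample is taken for. -/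
def Sample.key (e : Sample A X n) : Fin n × Side := (e.diseq, e.side)

/-- `e'` may come immediately after `e` in a run sampling the targets `T`. -/
def Follows (T : Fin n × Side → Option (X × ℕ)) (e e' : Sample A X n) : Prop :=
  e'.letter = none → e'.var = e.var ∧ T e'.key = T e.key ∧
    e'.pos e'.var = e.pos e'.var + if e.letter ≠ none then 1 else 0

/-- The sample `e` sits at its target. -/
def AtTarget (T : Fin n × Side → Option (X × ℕ)) (e : Sample A X n) (j : ℕ) : Prop :=
  T e.key = some (e.var, j) ∧ e.pos e.var = j + if e.letter = none then 1 else 0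

section

variable {S : Type*} {M : TagAut (Tag A X n) S}

/-- Copy transitions read nothing and stay in their state, so a block of them can precede any run,
at the price of one level each. -/
theorem MRun.exists_copies {pos : X → ℕ} {q r : S} {E : List (Sample A X n)} {u : X → List A}
    (hq : q ∈ M.states) (z : X) (ks : List (Fin n × Side)) {i : ℕ} (hi : 2 ≤ i)
    {L : List ((S × ℕ) × Finset (Tag A X n) × (S × ℕ))}
    (h : MRun M (i + ks.length) pos q L E u r) :
    ∃ L', MRun M i pos q L' ((ks.map fun k => ⟨z, k.1, k.2, none, pos⟩) ++ E) u r := by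
  induction ks generalizing i with
  | nil => exact ⟨L, h⟩
  | cons k ks ih =>
    obtain ⟨L', hL'⟩ := ih (i := i + 1) (by omega) (by
      rw [List.length_cons] at h
      rwa [add_assoc, add_comm 1])
    exact ⟨_, .cop z k.1 k.2 hi hq hL'⟩

/-- The copies share the target of `e` and no letter is read between them. If `E` is nonempty, it
starts with a mismatch, on which `Follows` imposes nothing. -/
theorem isChain_copies {T : Fin n × Side → Option (X × ℕ)} {E : List (Sample A X n)}
    (hE : E.IsChain (Follows T)) (h0 : ∀ e, E[0]? = some e → e.letter ≠ none) {z : X} {j : ℕ}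
    {pos : X → ℕ} (ks : List (Fin n × Side)) (hks : ∀ k ∈ ks, T k = some (z, j))
    (e : Sample A X n) (hz : e.var = z) (hT : T e.key = some (z, j))
    (hpos : pos z = e.pos z + if e.letter ≠ none then 1 else 0) :
    (e :: ((ks.map fun k => (⟨z, k.1, k.2, none, pos⟩ : Sample A X n)) ++ E)).IsChain
      (Follows T) := by
  induction ks generalizing e with
  | nil =>
    cases E with
    | nil => exact List.isChain_singleton e
    | cons e' E => exact List.isChain_cons_cons.2 ⟨fun hn => absurd hn (h0 e' rfl), hE⟩
  | cons k ks ih =>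
    refine List.isChain_cons_cons.2 ⟨fun _ => ⟨hz.symm, ?_, hpos⟩, ?_⟩
    · rw [hT]
      exact hks k (by simp)
    · exact ih (fun k' hk' => hks k' (by simp [hk'])) _ rfl (hks k (by simp)) (by simp)

/-- A run can be made to sample prescribed positions. -/
theorem CRun.exists_mRun (hM : ∀ s, s ∈ M.states) (T : Fin n × Side → Option (X × ℕ))
    {q r : S} {u : X → List A} (h : CRun M q u r) (i : ℕ) (hi : 1 ≤ i) (pos : X → ℕ) :
    ∃ L E, MRun M i pos q L E u r ∧
      (∀ e ∈ E, ∃ j, AtTarget T e j ∧ pos e.var ≤ j) ∧ (E.map Sample.key).Nodup ∧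
      (∀ k x j, T k = some (x, j) → pos x ≤ j → j < pos x + (u x).length →
        k ∈ E.map Sample.key) ∧
      E.IsChain (Follows T) ∧ ∀ e, E[0]? = some e → e.letter ≠ none := by
  induction h generalizing i pos with
  | nil q =>
    refine ⟨[], [], .nil i pos q, by simp, by simp, fun k x j _ h1 h2 => ?_, by simp, by simp⟩
    simp only [List.length_nil] at h2
    omega
  | eps ht h ih =>
    obtain ⟨L, E, hL, hE⟩ := ih i hi pos
    exact ⟨_, E, .eps hi ht hL, hE⟩
  | @read q q' r u a z ht h ih =>
    have hle : ∀ x, pos x ≤ incAt pos z x := fun x => by unfold incAt; split_ifs <;> omega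
    have hz : incAt pos z z = pos z + 1 := if_pos rfl
    -- A target in the unread part is either the letter about to be read or lies in what remains
    -- afterwards.
    have hcov : ∀ {E : List (Sample A X n)} {k x j}, (∀ k x j, T k = some (x, j) →
        incAt pos z x ≤ j → j < incAt pos z x + (u x).length → k ∈ E.map Sample.key) →
        T k = some (x, j) → pos x ≤ j → j < pos x + (consAt u z a x).length →
        T k = some (z, pos z) ∨ k ∈ E.map Sample.key := by
      intro E k x j hE hk h1 h2
      by_cases hx : x = z
      · subst hx
        rw [consAt_self, List.length_cons] at h2
        by_cases hj : j = pos x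
        · exact Or.inl (hj ▸ hk)
        · exact Or.inr (hE k x j hk (by omega) (by omega))
      · rw [consAt_of_ne _ _ hx] at h2
        have hpx : incAt pos z x = pos x := if_neg hx
        exact Or.inr (hE k x j hk (by omega) (by omega))
    -- All sides aiming at the current letter. If there are any, the first one is served by the
    -- mismatch transition and the others by copies right after it.
    set ks := (Finset.univ.filter fun k => T k = some (z, pos z)).toList with hks
    have hmem : ∀ k, k ∈ ks ↔ T k = some (z, pos z) := fun k => by simp [hks]
    have hnd : ks.Nodup := Finset.nodup_toList _
    clear_value ks
    cases ks with
    | nil =>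
      obtain ⟨L, E, hL, h1, h2, h3, h4, h5⟩ := ih i hi (incAt pos z)
      refine ⟨_, E, .read a z hi ht hL, fun e he => ?_, h2, fun k x j hk hj hj' => ?_, h4, h5⟩
      · obtain ⟨j, hj, hj'⟩ := h1 e he
        exact ⟨j, hj, (hle _).trans hj'⟩
      · rcases hcov h3 hk hj hj' with hk' | hk'
        · simpa using (hmem k).2 hk'
        · exact hk'
    | cons k₀ ks =>
      -- One level is used by the mismatch and one by each copy.
      obtain ⟨L, E, hL, h1, h2, h3, h4, h5⟩ := ih (i + 1 + ks.length) (by omega) (incAt pos z)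
      obtain ⟨L', hL'⟩ := hL.exists_copies (hM q') z ks (by omega)
      have hT₀ : T k₀ = some (z, pos z) := (hmem k₀).1 (by simp)
      have hTs : ∀ k ∈ ks, T k = some (z, pos z) := fun k hk => (hmem k).1 (by simp [hk])
      have hkey : ((⟨z, k₀.1, k₀.2, some a, pos⟩ : Sample A X n) ::
          ((ks.map fun k => ⟨z, k.1, k.2, none, incAt pos z⟩) ++ E)).map Sample.key =
            (k₀ :: ks) ++ E.map Sample.key := by
        simp only [List.map_cons, List.map_append, List.map_map, List.cons_append]
        congr 2
        exact List.map_id ks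
      refine ⟨_, _, .mis a z k₀.1 k₀.2 hi ht hL', ?_, ?_, ?_, ?_, ?_⟩
      · intro e he
        rw [List.mem_cons, List.mem_append, List.mem_map] at he
        rcases he with rfl | ⟨k, hk, rfl⟩ | he
        · exact ⟨pos z, ⟨hT₀, by simp⟩, le_rfl⟩
        · exact ⟨pos z, ⟨hTs k hk, by simp [hz]⟩, le_rfl⟩
        · obtain ⟨j, hj, hj'⟩ := h1 e he
          exact ⟨j, hj, (hle _).trans hj'⟩
      · rw [hkey, List.nodup_append]
        refine ⟨hnd, h2, ?_⟩
        -- No side is sampled twice: samples taken later have their targets at or beyond the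
        -- increased counter, past the current letter.
        rintro k hk k' hk' rfl
        obtain ⟨e, he, rfl⟩ := List.mem_map.1 hk'
        obtain ⟨j, ⟨hj, -⟩, hj'⟩ := h1 e he
        rw [(hmem _).1 hk, Option.some.injEq, Prod.mk.injEq] at hj
        rw [← hj.1, hz] at hj'
        omega
      · intro k x j hk hj hj'
        rw [hkey, List.mem_append, hmem]
        exact hcov h3 hk hj hj'
      · exact isChain_copies h4 h5 ks hTs _ rfl hT₀ (by simp [hz])
      · simp

end

/-- The value of a satisfying assignment at a target. -/
noncomputable def targetCode [Fintype A] (w : X → List A) : Option (X × ℕ) → ℤ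
  | none => 0
  | some (x, j) => match (w x)[j]? with
    | none => 0
    | some a => (Fintype.equivFin A a : ℕ)

/-- The targets `T` witness that `w` satisfies the disequality `D`. -/
def Witness (C : DiseqConstraint A X Q I n) (w : X → List A) (T : Side → Option (X × ℕ))
    (D : Fin n) : Prop :=
  ((DiseqConstraint.word w (C.lhs D)).length ≠ (DiseqConstraint.word w (C.rhs D)).length ∧
    ∀ s, T s = none) ∨
  ∃ (i : Fin (C.lhs D).length) (j : Fin (C.rhs D).length) (p p' : ℕ) (a b : A),
    T .left = some ((C.lhs D).get i, p) ∧ T .right = some ((C.rhs D).get j, p') ∧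
    (w ((C.lhs D).get i))[p]? = some a ∧ (w ((C.rhs D).get j))[p']? = some b ∧ a ≠ b ∧
    (DiseqConstraint.word w ((C.lhs D).take i)).length + p =
      (DiseqConstraint.word w ((C.rhs D).take j)).length + p'

/-- Distinct words of equal length differ at a position inside both, and `getElem?_word` locates it
in a variable occurrence on either side. -/
theorem exists_witness (C : DiseqConstraint A X Q I n) (w : X → List A) (D : Fin n)
    (h : DiseqConstraint.word w (C.lhs D) ≠ DiseqConstraint.word w (C.rhs D)) :
    ∃ T, Witness C w T D := by
  by_cases hlen :
      (DiseqConstraint.word w (C.lhs D)).length = (DiseqConstraint.word w (C.rhs D)).length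
  · obtain ⟨g, hg⟩ : ∃ g : ℕ, (DiseqConstraint.word w (C.lhs D))[g]? ≠
        (DiseqConstraint.word w (C.rhs D))[g]? := by
      by_contra! hne
      exact h (List.ext_getElem? hne)
    have hgl : g < (DiseqConstraint.word w (C.lhs D)).length := by
      by_contra hge
      rw [List.getElem?_eq_none (by omega), List.getElem?_eq_none (by omega)] at hg
      exact hg rfl
    have hgr := hlen ▸ hgl
    obtain ⟨i, p, hp, hgp⟩ := (getElem?_word w _ g _).1 (List.getElem?_eq_getElem hgl)
    obtain ⟨j, p', hp', hgp'⟩ := (getElem?_word w _ g _).1 (List.getElem?_eq_getElem hgr)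
    refine ⟨fun s => match s with
      | .left => some ((C.lhs D).get i, p)
      | .right => some ((C.rhs D).get j, p'), Or.inr ⟨i, j, p, p', _, _, rfl, rfl, hp, hp', ?_,
        hgp.symm.trans hgp'⟩⟩
    rw [List.getElem?_eq_getElem hgl, List.getElem?_eq_getElem hgr] at hg
    exact fun h => hg (congrArg some h)
  · exact ⟨fun _ => none, Or.inl ⟨hlen, fun _ => rfl⟩⟩

theorem lt_length_of_witness {C : DiseqConstraint A X Q I n} {w : X → List A}
    {T : Side → Option (X × ℕ)} {D : Fin n} (h : Witness C w T D) {s : Side} {x : X} {j : ℕ}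
    (hs : T s = some (x, j)) : j < (w x).length := by
  rcases h with ⟨-, h⟩ | ⟨i, j, p, p', a, b, h1, h2, h3, h4, -⟩
  · rw [h] at hs
    cases hs
  · cases s with
    | left =>
      rw [h1] at hs
      cases hs
      exact (List.getElem?_eq_some_iff.1 h3).1
    | right =>
      rw [h2] at hs
      cases hs
      exact (List.getElem?_eq_some_iff.1 h4).1

theorem witness_eq_none_iff {C : DiseqConstraint A X Q I n} {w : X → List A}
    {T : Side → Option (X × ℕ)} {D : Fin n} (h : Witness C w T D) (s s' : Side) :
    T s = none ↔ T s' = none := by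
  rcases h with ⟨-, h⟩ | ⟨i, j, p, p', a, b, h1, h2, -⟩
  · simp [h]
  · cases s <;> cases s' <;> simp [h1, h2]

/-- Targets come in pairs, one for each side of a disequality. This parity brings the run from level
`1` to an odd level. -/
theorem even_length_of_witness {C : DiseqConstraint A X Q I n} {w : X → List A}
    {T : Fin n × Side → Option (X × ℕ)} (hT : ∀ D, Witness C w (fun s => T (D, s)) D)
    {ks : List (Fin n × Side)} (hnd : ks.Nodup) (hks : ∀ k, k ∈ ks ↔ T k ≠ none) :
    Even ks.length := by
  have : ks.toFinset =
      (Finset.univ.filter fun D => T (D, .left) ≠ none) ×ˢ (Finset.univ : Finset Side) := by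
    ext ⟨D, s⟩
    simp only [List.mem_toFinset, hks, Finset.mem_product, Finset.mem_filter, Finset.mem_univ,
      true_and, and_true]
    exact not_congr (witness_eq_none_iff (hT D) s .left)
  rw [← List.toFinset_card_of_nodup hnd, this, Finset.card_product]
  exact ⟨_, mul_two _⟩

section

variable [Fintype A] [Fintype X] [LinearOrder X] [∀ x, Fintype (Q x)] [Nonempty X]
  (C : DiseqConstraint A X Q I n)

theorem holds_formula_iff (σ : MVar A X ((Σ x, Q x) × ℕ) n → ℤ) :
    (formula C).Holds σ ↔
      ((multiAut C).parikhTagFormula (allTags A X n)).Holds (σ ∘ MVar.parikh) ∧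
      (fairFormula A X ((Σ x, Q x) × ℕ) n).Holds σ ∧
      (consistFormula A X ((Σ x, Q x) × ℕ) n).Holds σ ∧
      (copiesFormula A X ((Σ x, Q x) × ℕ) n).Holds σ ∧
      ∀ D, (lenFormula (A := A) (S := (Σ x, Q x) × ℕ) (n := n) (C.lhs D) (C.rhs D)).Holds σ ∨
        (misFormula (A := A) (S := (Σ x, Q x) × ℕ) D (C.lhs D) (C.rhs D)).Holds σ ∧
        (symFormula (A := A) (X := X) (S := (Σ x, Q x) × ℕ) D).Holds σ := by
  rw [formula]
  simp only [LIA.Holds, LIA.holds_rename, LIA.holds_conj, Finset.mem_univ, true_imp_iff]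

theorem exists_words_of_holds {σ : MVar A X ((Σ x, Q x) × ℕ) n → ℤ} (h : (formula C).Holds σ) :
    ∃ w : X → List A, (∀ x, w x ∈ (C.nfa x).accepts) ∧
      ∀ D, DiseqConstraint.word w (C.lhs D) ≠ DiseqConstraint.word w (C.rhs D) := by
  rw [holds_formula_iff] at h
  obtain ⟨hP, -, hcon, hcop, hD⟩ := h
  obtain ⟨p, L, r, ⟨hp, hr, hL, hLt⟩, htag⟩ :=
    TagAut.exists_run_of_holds (wellFormed_multiAut C) hP
  simp only [multiAut, Finset.mem_product, Finset.mem_singleton] at hp hr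
  obtain ⟨E, w, hrun, hE⟩ := exists_mRun_of_walk C hL hLt (by omega) (fun _ => 0)
  rw [hp.2] at hrun hE
  have hrep : Represents σ E w := represents_of_mRun hrun (by omega) htag
  have hfol := hrep.holds_copies_iff.1 hcop
  refine ⟨w, (exists_cRun_conAut_iff C w).1 ⟨_, hp.1, _, hr.1, hrun.cRun⟩, fun D heq => ?_⟩
  rcases hD D with hlen | ⟨hmis, hsym⟩
  · rw [lenFormula, LIA.holds_ne, hrep.eval_lenTerm, hrep.eval_lenTerm, heq] at hlen
    exact hlen rfl
  · simp only [misFormula, LIA.holds_disj, Finset.mem_univ, true_and, LIA.Holds] at hmis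
    obtain ⟨⟨i, j⟩, hpl, hpr, hal, hexl, hexr⟩ := hmis
    rw [symFormula, LIA.holds_ne] at hsym
    rw [hrep.holds_pos_iff] at hpl hpr
    rw [hrep.holds_present_iff] at hexl hexr
    rw [alignFormula] at hal
    simp only [LIA.Holds, LTerm.eval, hrep.eval_lenTerm] at hal
    obtain ⟨k, e, he, hv, hd, hs⟩ := hexl
    obtain ⟨k', e', he', hv', hd', hs'⟩ := hexr
    obtain ⟨a, q, hq, -, ha, hpq⟩ := hrep.exists_letter hfol hcon k e he
    obtain ⟨b, q', hq', -, hb, hpq'⟩ := hrep.exists_letter hfol hcon k' e' he'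
    have h1 := hpl k e he hv hd hs
    have h2 := hpr k' e' he' hv' hd' hs'
    rw [hv] at hq hpq
    rw [hv'] at hq' hpq'
    rw [hd, hs] at ha
    rw [hd', hs'] at hb
    -- The `- 1` in the position clause for copies cancels the excess of their counters, so
    -- mismatches and copies both yield the true position.
    have h1' : σ (.misPos D .left) = q := by
      rw [h1, hpq]; split_ifs <;> simp
    have h2' : σ (.misPos D .right) = q' := by
      rw [h2, hpq']; split_ifs <;> simp
    have hg : (DiseqConstraint.word w ((C.lhs D).take i)).length + q =
        (DiseqConstraint.word w ((C.rhs D).take j)).length + q' := by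
      change _ + σ (.misPos D .left) = _ + σ (.misPos D .right) at hal
      rw [h1', h2'] at hal
      exact_mod_cast hal
    have hla := (getElem?_word w (C.lhs D) _ a).2 ⟨i, q, hq, rfl⟩
    have hrb := (getElem?_word w (C.rhs D) _ b).2 ⟨j, q', hq', rfl⟩
    rw [hg, heq, hrb, Option.some.injEq] at hla
    exact hsym (ha.trans (hla ▸ hb.symm))

theorem exists_holds_of_words {w : X → List A} (hw : ∀ x, w x ∈ (C.nfa x).accepts)
    (hne : ∀ D, DiseqConstraint.word w (C.lhs D) ≠ DiseqConstraint.word w (C.rhs D)) :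
    ∃ σ, (formula C).Holds σ := by
  obtain ⟨q, hq, r, hr, hcrun⟩ := (exists_cRun_conAut_iff C w).2 hw
  choose T' hT' using fun D => exists_witness C w D (hne D)
  let T : Fin n × Side → Option (X × ℕ) := fun k => T' k.1 k.2
  have hT : ∀ D, Witness C w (fun s => T (D, s)) D := hT'
  obtain ⟨L, E, hrun, hat, hnd, hcov, hchain, hfirst⟩ :=
    hcrun.exists_mRun (mem_conAut_states C) T 1 le_rfl (fun _ => 0)
  have hkeys : ∀ k, k ∈ E.map Sample.key ↔ T k ≠ none := by
    intro k
    constructor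
    · intro hk
      obtain ⟨e, he, rfl⟩ := List.mem_map.1 hk
      obtain ⟨j, ⟨hj, -⟩, -⟩ := hat e he
      rw [hj]
      exact Option.some_ne_none _
    · intro hk
      obtain ⟨⟨x, j⟩, hxj⟩ := Option.ne_none_iff_exists'.1 hk
      refine hcov k x j hxj (Nat.zero_le _) ?_
      rw [zero_add]
      exact lt_length_of_witness (hT k.1) (s := k.2) hxj
  -- The sampled sides are exactly those with a target, each sampled once; this gives both the
  -- parity and the bound on the number of samples.
  have heven := even_length_of_witness hT hnd hkeys
  have hlen : E.length ≤ 2 * n := by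
    have := hnd.length_le_card
    rw [List.length_map, Fintype.card_prod, Fintype.card_fin,
      show Fintype.card Side = 2 from rfl] at this
    omega
  rw [List.length_map] at heven
  obtain ⟨hwalk, hLt⟩ := hrun.isWalk C (by omega)
  obtain ⟨σ₀, hσ₀, htag⟩ := TagAut.exists_holds_of_run (M := multiAut C) (p := (q, 1)) (l := L)
    (q := (r, 1 + E.length)) ⟨by simp [multiAut, hq], by
      simp only [multiAut, Finset.mem_product, Finset.mem_filter, Finset.mem_Icc]
      exact ⟨hr, ⟨by omega, by omega⟩, heven.one_add⟩, hwalk, hLt⟩ (allTags A X n)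
  -- The defaults `0` are harmless: a side without target is never sampled, and its disequality is
  -- satisfied through the lengths.
  let σ : MVar A X ((Σ x, Q x) × ℕ) n → ℤ := fun
    | .parikh v => σ₀ v
    | .misSym D s => targetCode w (T (D, s))
    -- At `i = 0` the truncated subtraction returns the value of the first sample. Only a copy on
    -- level `1` would involve `shared 0`, and there is none.
    | .shared i => match E[i - 1]? with
      | none => 0
      | some e => targetCode w (T e.key)
    | .misPos D s => match T (D, s) with
      | none => 0
      | some (_, j) => j
  have hshared : ∀ (k : ℕ) (e : Sample A X n), E[k]? = some e →
      σ (.shared (k + 1)) = targetCode w (T e.key) := by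
    intro k e he
    simp only [σ, Nat.add_sub_cancel, he]
  have hrep : Represents σ E w := represents_of_mRun hrun hlen fun τ _ => htag τ
  have hstep : ∀ (k : ℕ) (e e' : Sample A X n), E[k]? = some e → E[k + 1]? = some e' →
      Follows T e e' := by
    intro k e e' he he'
    obtain ⟨hk, rfl⟩ := List.getElem?_eq_some_iff.1 he
    obtain ⟨hk', rfl⟩ := List.getElem?_eq_some_iff.1 he'
    exact List.isChain_iff_getElem.1 hchain k hk'
  have hprev : ∀ (k : ℕ) (e' : Sample A X n), E[k + 1]? = some e' → ∃ e, E[k]? = some e := by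
    intro k e' he'
    exact ⟨E[k]'(by have := (List.getElem?_eq_some_iff.1 he').1; omega),
      List.getElem?_eq_getElem _⟩
  refine ⟨σ, (holds_formula_iff C σ).2 ⟨hσ₀, hrep.holds_fair ?_, hrep.holds_consist_iff.2 ?_,
    hrep.holds_copies_iff.2 ?_, fun D => ?_⟩⟩
  · intro k k' e e' he he' hd hs
    obtain ⟨hk, rfl⟩ := List.getElem?_eq_some_iff.1 he
    obtain ⟨hk', rfl⟩ := List.getElem?_eq_some_iff.1 he'
    refine (hnd.getElem_inj_iff (hi := by simpa using hk) (hj := by simpa using hk')).1 ?_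
    simp only [List.getElem_map]
    exact Prod.ext hd hs
  · intro k e he
    refine ⟨hshared k e he, fun a ha => ?_, fun hn => ?_⟩
    · obtain ⟨j, ⟨hj, hj'⟩, -⟩ := hat e (List.mem_of_getElem? he)
      have := hrep.letter e (List.mem_of_getElem? he) a ha
      rw [if_neg (by simp [ha]), add_zero] at hj'
      rw [hj'] at this
      change targetCode w (T e.key) = _
      rw [hj]
      simp only [targetCode, this]
    · cases k with
      | zero => exact absurd hn (hfirst e he)
      | succ k =>
        obtain ⟨e₀, he₀⟩ := hprev k e he
        rw [hshared k e₀ he₀, ← (hstep k e₀ e he₀ he hn).2.1]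
        rfl
  · intro k e' he' hn
    obtain ⟨e, he⟩ := hprev k e' he'
    obtain ⟨h1, -, h2⟩ := hstep k e e' he he' hn
    exact ⟨e, he, h1.symm, h2⟩
  · rcases hT D with ⟨hlen, -⟩ | ⟨i, j, p, p', a, b, h1, h2, h3, h4, hab, hg⟩
    · left
      rw [lenFormula, LIA.holds_ne, hrep.eval_lenTerm, hrep.eval_lenTerm]
      exact_mod_cast hlen
    · right
      have hpos : ∀ s x m, T (D, s) = some (x, m) → σ (.misPos D s) = m ∧
          (posFormula (A := A) (S := (Σ x, Q x) × ℕ) D s x).Holds σ ∧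
          (presentFormula (A := A) (S := (Σ x, Q x) × ℕ) D s x).Holds σ := by
        intro s x m hm
        have hp : σ (.misPos D s) = m := by simp only [σ, hm]
        refine ⟨hp, (hrep.holds_pos_iff D s x).2 ?_, (hrep.holds_present_iff D s x).2 ?_⟩
        · rintro k e he rfl rfl rfl
          obtain ⟨j, ⟨hj, hj'⟩, -⟩ := hat e (List.mem_of_getElem? he)
          have : some (e.var, m) = some (e.var, j) := hm.symm.trans hj
          rw [Option.some.injEq, Prod.mk.injEq] at this
          rw [hp, hj', this.2]
          split_ifs <;> simp
        · obtain ⟨e, he, hkey⟩ := List.mem_map.1 ((hkeys (D, s)).2 (by simp [hm]))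
          obtain ⟨k, hk⟩ := List.mem_iff_getElem?.1 he
          obtain ⟨j, ⟨hj, -⟩, -⟩ := hat e he
          rw [hkey, hm, Option.some.injEq, Prod.mk.injEq] at hj
          exact ⟨k, e, hk, hj.1.symm, congrArg Prod.fst hkey, congrArg Prod.snd hkey⟩
      obtain ⟨hp1, hp2, hp3⟩ := hpos _ _ _ h1
      obtain ⟨hq1, hq2, hq3⟩ := hpos _ _ _ h2
      constructor
      · simp only [misFormula, LIA.holds_disj, Finset.mem_univ, true_and, LIA.Holds]
        refine ⟨(i, j), hp2, hq2, ?_, hp3, hq3⟩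
        rw [alignFormula]
        simp only [LIA.Holds, LTerm.eval, hrep.eval_lenTerm]
        change _ + σ (.misPos D .left) = _ + σ (.misPos D .right)
        rw [hp1, hq1]
        exact_mod_cast hg
      · rw [symFormula, LIA.holds_ne]
        change targetCode w (T (D, .left)) ≠ targetCode w (T (D, .right))
        rw [show T (D, .left) = _ from h1, show T (D, .right) = _ from h2]
        simp only [targetCode, h3, h4]
        intro hc
        exact hab ((Fintype.equivFin A).injective (Fin.ext (by exact_mod_cast hc)))

theorem satisfiable_iff : C.Satisfiable ↔ (fullFormula C).Satisfiable := by
  have hint : ∀ v : I → ℤ,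
      C.intFormula.Holds v ↔ ∀ c ∈ C.ints, c.1.eval v ≤ c.2.eval v := by
    intro v
    rw [DiseqConstraint.intFormula, LIA.holds_listConj, List.forall_mem_map]
    rfl
  constructor
  · rintro ⟨w, v, hw, hv, hne⟩
    obtain ⟨σ, hσ⟩ := exists_holds_of_words C hw hne
    refine ⟨Sum.elim v σ, ?_, ?_⟩
    · rw [LIA.holds_rename, Sum.elim_comp_inl, hint]
      exact hv
    · rw [LIA.holds_rename, Sum.elim_comp_inr]
      exact hσ
  · rintro ⟨σ, h1, h2⟩
    rw [LIA.holds_rename, hint] at h1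
    rw [LIA.holds_rename] at h2
    obtain ⟨w, hw, hne⟩ := exists_words_of_holds C h2
    exact ⟨w, _, hw, h1, hne⟩

end

end MultiDiseq

/-! Size bounds by powers of a common base. -/

theorem LTerm.size_rename {V W : Type*} (f : V → W) (t : LTerm V) :
    (t.rename f).size = t.size := by
  induction t with
  | var v => rfl
  | const k => rfl
  | add t u iht ihu => simp only [rename, size, iht, ihu]
  | sub t u iht ihu => simp only [rename, size, iht, ihu]

theorem LIA.size_rename {V W : Type*} (f : V → W) (φ : LIA V) :
    (φ.rename f).size = φ.size := by
  induction φ with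
  | tt => rfl
  | ff => rfl
  | le t u => simp only [rename, size, LTerm.size_rename]
  | eq t u => simp only [rename, size, LTerm.size_rename]
  | not φ ih => simp only [rename, size, ih]
  | and φ ψ ihφ ihψ => simp only [rename, size, ihφ, ihψ]
  | or φ ψ ihφ ihψ => simp only [rename, size, ihφ, ihψ]
  | imp φ ψ ihφ ihψ => simp only [rename, size, ihφ, ihψ]

namespace SizeBound

variable {B i j k : ℕ} (hB : 3 ≤ B)

include hB

theorem mono {a : ℕ} (h : a ≤ B ^ i) (hi : i ≤ k) : a ≤ B ^ k :=
  h.trans (Nat.pow_le_pow_right (by omega) hi)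

/-- One connective costs one power of `B`: the three summands are each at most `B ^ (k - 1)`, and `3
≤ B`. -/
theorem binary {a b : ℕ} (h₁ : a ≤ B ^ i) (h₂ : b ≤ B ^ j) (hi : i < k) (hj : j < k) :
    1 + a + b ≤ B ^ k := by
  obtain ⟨k, rfl⟩ : ∃ l, k = l + 1 := ⟨k - 1, by omega⟩
  have h₁' := mono hB h₁ (Nat.lt_succ_iff.1 hi)
  have h₂' := mono hB h₂ (Nat.lt_succ_iff.1 hj)
  have h₃ : 1 ≤ B ^ k := Nat.one_le_pow _ _ (by omega)
  calc 1 + a + b ≤ 3 * B ^ k := by omega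
    _ ≤ B * B ^ k := Nat.mul_le_mul_right _ hB
    _ = B ^ (k + 1) := by rw [pow_succ, mul_comm]

theorem unary {a : ℕ} (h : a ≤ B ^ i) (hi : i < k) : 1 + a ≤ B ^ k :=
  (Nat.le_add_right _ 1).trans (binary (j := i) hB h (Nat.one_le_pow _ _ (by omega)) hi hi)

/-- The size of a fold over `c` entries of size `b`: each entry brings a connective, and the neutral
element ends the fold. The extra power of `B` absorbs the factor `3`. -/
theorem list {c b : ℕ} (hc : c ≤ B ^ i) (hb : b ≤ B ^ j) (hk : i + j + 1 ≤ k) :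
    1 + c * (1 + b) ≤ B ^ k := by
  have hj : 1 ≤ B ^ j := Nat.one_le_pow _ _ (by omega)
  have hi : 1 ≤ B ^ i := Nat.one_le_pow _ _ (by omega)
  have h1 : c * (1 + b) ≤ B ^ i * (2 * B ^ j) := Nat.mul_le_mul hc (by omega)
  have h2 : 1 ≤ B ^ i * B ^ j := Nat.mul_le_mul hi hj
  refine le_trans ?_ (Nat.pow_le_pow_right (by omega) hk)
  calc 1 + c * (1 + b) ≤ 3 * (B ^ i * B ^ j) := by
        rw [Nat.mul_left_comm] at h1
        omega
    _ ≤ B * (B ^ i * B ^ j) := Nat.mul_le_mul_right _ hB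
    _ = B ^ (i + j + 1) := by ring

theorem listSum {V : Type*} {l : List (LTerm V)} (hc : l.length ≤ B ^ i)
    (hb : ∀ t ∈ l, t.size ≤ B ^ j) (hk : i + j + 1 ≤ k) : (LTerm.listSum l).size ≤ B ^ k := by
  refine le_trans ?_ (list hB hc le_rfl hk)
  clear hc
  induction l with
  | nil => simp [LTerm.listSum, LTerm.size]
  | cons t l ih =>
    have h1 := ih fun t ht => hb t (List.mem_cons_of_mem _ ht)
    have h2 := hb t (by simp)
    change 1 + t.size + (LTerm.listSum l).size ≤ _
    rw [List.length_cons, Nat.add_mul]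
    omega

theorem listConj {V : Type*} {l : List (LIA V)} (hc : l.length ≤ B ^ i)
    (hb : ∀ φ ∈ l, φ.size ≤ B ^ j) (hk : i + j + 1 ≤ k) : (LIA.listConj l).size ≤ B ^ k := by
  refine le_trans ?_ (list hB hc le_rfl hk)
  clear hc
  induction l with
  | nil => simp [LIA.listConj, LIA.size]
  | cons t l ih =>
    have h1 := ih fun t ht => hb t (List.mem_cons_of_mem _ ht)
    have h2 := hb t (by simp)
    change 1 + t.size + (LIA.listConj l).size ≤ _
    rw [List.length_cons, Nat.add_mul]
    omega

theorem listDisj {V : Type*} {l : List (LIA V)} (hc : l.length ≤ B ^ i)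
    (hb : ∀ φ ∈ l, φ.size ≤ B ^ j) (hk : i + j + 1 ≤ k) : (LIA.listDisj l).size ≤ B ^ k := by
  refine le_trans ?_ (list hB hc le_rfl hk)
  clear hc
  induction l with
  | nil => simp [LIA.listDisj, LIA.size]
  | cons t l ih =>
    have h1 := ih fun t ht => hb t (List.mem_cons_of_mem _ ht)
    have h2 := hb t (by simp)
    change 1 + t.size + (LIA.listDisj l).size ≤ _
    rw [List.length_cons, Nat.add_mul]
    omega

theorem sum {V ι : Type*} {s : Finset ι} {f : ι → LTerm V} (hc : s.card ≤ B ^ i)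
    (hb : ∀ x ∈ s, (f x).size ≤ B ^ j) (hk : i + j + 1 ≤ k) : (LTerm.sum s f).size ≤ B ^ k :=
  listSum hB (by simpa using hc) (by simpa using hb) hk

theorem conj {V ι : Type*} {s : Finset ι} {f : ι → LIA V} (hc : s.card ≤ B ^ i)
    (hb : ∀ x ∈ s, (f x).size ≤ B ^ j) (hk : i + j + 1 ≤ k) : (LIA.conj s f).size ≤ B ^ k :=
  listConj hB (by simpa using hc) (by simpa using hb) hk

theorem disj {V ι : Type*} {s : Finset ι} {f : ι → LIA V} (hc : s.card ≤ B ^ i)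
    (hb : ∀ x ∈ s, (f x).size ≤ B ^ j) (hk : i + j + 1 ≤ k) : (LIA.disj s f).size ≤ B ^ k :=
  listDisj hB (by simpa using hc) (by simpa using hb) hk

omit hB in
theorem var {V : Type*} (v : V) : (LTerm.var v).size ≤ B ^ 0 := le_rfl

omit hB in
theorem zero {V : Type*} : (LTerm.const 0 : LTerm V).size ≤ B ^ 0 := by simp [LTerm.size]

theorem one {V : Type*} : (LTerm.const 1 : LTerm V).size ≤ B ^ 1 := by
  simp only [LTerm.size, Int.natAbs_one, Nat.size_one, pow_one]
  omega

theorem neg_one {V : Type*} : (LTerm.const (-1) : LTerm V).size ≤ B ^ 1 := by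
  simp only [LTerm.size, Int.natAbs_neg, Int.natAbs_one, Nat.size_one, pow_one]
  omega

end SizeBound

/-! ### Size of the Parikh tag formula -/

namespace TagAut

open SizeBound
open scoped Classical

variable {T S : Type*} {M : TagAut T S} {B : ℕ}

/-- The exponents only record the nesting: a connective raises the larger exponent by one, and an
iterated connective or sum adds the exponents of index set and entries, plus one. -/
theorem size_parikhTagFormula_le (hB : 3 ≤ B) (hM : M.WellFormed) (hs : M.states.card ≤ B ^ 2)
    (ht : M.trans.card ≤ B ^ 8) {tags : Finset T} (htags : tags.card ≤ B ^ 6) :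
    (M.parikhTagFormula tags).size ≤ B ^ 25 := by
  have hst : M.start.card ≤ B ^ 2 := (Finset.card_le_card hM.start).trans hs
  have hac : M.accept.card ≤ B ^ 2 := (Finset.card_le_card hM.accept).trans hs
  have hst' : (M.states \ M.start).card ≤ B ^ 2 :=
    (Finset.card_le_card Finset.sdiff_subset).trans hs
  have hac' : (M.states \ M.accept).card ≤ B ^ 2 :=
    (Finset.card_le_card Finset.sdiff_subset).trans hs
  have hin : ∀ q, (M.incoming q).card ≤ B ^ 8 := fun q => (Finset.card_filter_le _ _).trans ht
  have hout : ∀ q, (M.outgoing q).card ≤ B ^ 8 := fun q => (Finset.card_filter_le _ _).trans ht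
  have hinit : M.initFormula.size ≤ B ^ 7 :=
    binary hB
      (conj (k := 6) hB hst (fun q _ => binary (k := 3) hB
        (binary (k := 1) hB zero (var _) (by omega) (by omega))
        (binary (k := 2) hB (var _) (one hB) (by omega) (by omega)) (by omega) (by omega))
        (by omega))
      (binary (k := 5) hB
        (conj (k := 4) hB hst' (fun q _ => binary (k := 1) hB (var _) zero (by omega) (by omega))
          (by omega))
        (binary (k := 4) hB (sum (k := 3) hB hst (fun q _ => var _) (by omega)) (one hB)
          (by omega) (by omega))
        (by omega) (by omega))
      (by omega) (by omega)
  have hfinal : M.finalFormula.size ≤ B ^ 7 :=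
    binary hB
      (conj (k := 6) hB hac (fun q _ => binary (k := 3) hB
        (binary (k := 1) hB zero (var _) (by omega) (by omega))
        (binary (k := 2) hB (var _) (one hB) (by omega) (by omega)) (by omega) (by omega))
        (by omega))
      (conj (k := 4) hB hac' (fun q _ => binary (k := 1) hB (var _) zero (by omega) (by omega))
        (by omega))
      (by omega) (by omega)
  have hkirch : ∀ q, (M.kirchhoffFormula q).size ≤ B ^ 11 := fun q =>
    binary hB
      (binary (k := 10) hB (var _) (sum (k := 9) hB (hin q) (fun t _ => var _) (by omega))
        (by omega) (by omega))
      (binary (k := 10) hB (var _) (sum (k := 9) hB (hout q) (fun t _ => var _) (by omega))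
        (by omega) (by omega))
      (by omega) (by omega)
  have hspan : ∀ q, (M.spanFormula q).size ≤ B ^ 17 := by
    intro q
    have h0 : (LIA.eq (LTerm.var (PVar.span (T := T) q)) (.const 0)).size ≤ B ^ 1 :=
      binary hB (var _) zero (by omega) (by omega)
    have h1 : (LIA.eq (LTerm.var (PVar.init (T := T) q)) (.const 1)).size ≤ B ^ 2 :=
      binary hB (var _) (one hB) (by omega) (by omega)
    refine binary hB (binary (k := 4) hB (binary (k := 3) hB h0 h1 (by omega) (by omega))
      (binary (k := 3) hB h1 h0 (by omega) (by omega)) (by omega) (by omega))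
      (binary (k := 16) hB (i := 12) (j := 15) ?_ ?_ (by omega) (by omega)) (by omega) (by omega)
    · exact binary hB (binary (k := 2) hB (var _) (neg_one hB) (by omega) (by omega))
        (binary (k := 11) hB (binary (k := 1) hB (var _) zero (by omega) (by omega))
          (conj (k := 10) hB (hin q)
            (fun t _ => binary (k := 1) hB (var _) zero (by omega) (by omega)) (by omega))
          (by omega) (by omega)) (by omega) (by omega)
    · exact binary hB
        (unary (k := 2) hB (binary (k := 1) hB (var _) zero (by omega) (by omega)) (by omega))
        (disj (k := 14) hB (hin q) (fun t _ => binary (k := 5) hB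
          (unary (k := 2) hB (binary (k := 1) hB (var _) zero (by omega) (by omega)) (by omega))
          (binary (k := 4) hB (binary (k := 1) hB zero (var _) (by omega) (by omega))
            (binary (k := 3) hB (var _)
              (binary (k := 2) hB (var _) (one hB) (by omega) (by omega)) (by omega) (by omega))
            (by omega) (by omega)) (by omega) (by omega)) (by omega))
        (by omega) (by omega)
  have hparikh : M.parikhFormula.size ≤ B ^ 24 :=
    binary hB
      (conj (k := 10) hB ht (fun t _ => binary (k := 1) hB zero (var _) (by omega) (by omega))
        (by omega))
      (binary (k := 23) hB hinit
        (binary (k := 22) hB hfinal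
          (conj (k := 21) hB hs (fun q _ => binary (k := 18) hB (hkirch q) (hspan q) (by omega)
            (by omega)) (by omega)) (by omega) (by omega)) (by omega) (by omega))
      (by omega) (by omega)
  exact binary hB hparikh
    (conj (k := 17) hB htags (fun t _ => binary (k := 10) hB (var _)
      (sum (k := 9) hB ((Finset.card_filter_le _ _).trans ht) (fun d _ => var _) (by omega))
      (by omega) (by omega)) (by omega))
    (by omega) (by omega)

end TagAut

/-! ### Size of the formula of the system -/

namespace MultiDiseq

open SizeBound
open scoped Classical

variable {A : Type uA} {X : Type uX} {Q : X → Type uQ} {I : Type uI} {n : ℕ}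

section

variable {S : Type*} [Fintype A] [Fintype X] {B : ℕ} (hB : 3 ≤ B) (hA : Fintype.card A ≤ B)
  (hX : Fintype.card X ≤ B) (hn : 2 * n + 1 ≤ B)

theorem card_sides : Fintype.card (Fin n × Side) = 2 * n := by
  rw [Fintype.card_prod, Fintype.card_fin, show Fintype.card Side = 2 from rfl, mul_comm]

include hB hA

/-- The binary length of a number is at most the number, and codes are less than the size of the
alphabet. -/
theorem size_code_le (a : A) : (code (X := X) (S := S) (n := n) a).size ≤ B ^ 1 := by
  have h1 := (Fintype.equivFin A a).isLt
  have h2 : Nat.size (Fintype.equivFin A a : ℕ) ≤ (Fintype.equivFin A a : ℕ) :=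
    Nat.size_le.2 Nat.lt_two_pow_self
  simp only [code, LTerm.size, Int.natAbs_natCast, pow_one]
  omega

theorem size_misCount_le (i : ℕ) (x : X) (D : Fin n) (s : Side) :
    (misCount (A := A) (S := S) i x D s).size ≤ B ^ 2 :=
  sum (i := 1) (j := 0) hB (by simpa using hA) (fun a _ => var _) (by omega)

include hn

theorem size_misTotal_le (i : ℕ) (x : X) :
    (misTotal (A := A) (S := S) (n := n) i x).size ≤ B ^ 4 :=
  sum (i := 1) hB (by rw [Finset.card_univ, card_sides, pow_one]; omega)
    (fun d _ => size_misCount_le hB hA i x d.1 d.2) (by omega)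

omit hA in
theorem size_copTotal_le (i : ℕ) (x : X) :
    (copTotal (A := A) (S := S) (n := n) i x).size ≤ B ^ 2 :=
  sum (i := 1) (j := 0) hB (by rw [Finset.card_univ, card_sides, pow_one]; omega) (fun d _ => var _)
    (by omega)

include hX

theorem size_fairFormula_le : (fairFormula A X S n).size ≤ B ^ 9 := by
  refine conj (i := 1) (j := 7) hB (by rw [Finset.card_univ, card_sides, pow_one]; omega) (fun e _ =>
    binary hB (sum (k := 6) (i := 2) (j := 3) hB ?_ (fun d _ =>
      binary hB (size_misCount_le hB hA _ _ _ _) (var _) (by omega) (by omega)) (by omega))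
      (one hB) (by omega) (by omega)) (by omega)
  rw [Finset.card_product, Nat.card_Icc, Finset.card_univ, pow_two]
  exact Nat.mul_le_mul (by omega) hX

theorem size_consistFormula_le : (consistFormula A X S n).size ≤ B ^ 9 := by
  refine conj (i := 3) (j := 5) hB ?_ (fun e _ => ?_) (by omega)
  · have : Fintype.card (Fin n × Side × A) * (2 * n + 1 - 1) =
        Fintype.card (Fin n × Side) * Fintype.card A * (2 * n) := by
      simp only [Fintype.card_prod]
      rw [Nat.add_sub_cancel]
      ring
    rw [Finset.card_product, Finset.card_univ, Nat.card_Icc, this, card_sides, pow_succ, pow_two]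
    exact Nat.mul_le_mul (Nat.mul_le_mul (by omega) hA) (by omega)
  · obtain ⟨⟨D, s, a⟩, i⟩ := e
    have hX' : (Finset.univ : Finset X).card ≤ B ^ 1 := by simpa using hX
    exact binary hB
      (binary (k := 4) hB
        (binary (k := 3) hB (sum (k := 2) (j := 0) hB hX' (fun x _ => var _) (by omega)) (one hB)
          (by omega) (by omega))
        (binary (k := 3) hB (binary (k := 1) hB (var _) (var _) (by omega) (by omega))
          (binary (k := 2) hB (var _) (size_code_le hB hA a) (by omega) (by omega))
          (by omega) (by omega)) (by omega) (by omega))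
      (binary (k := 4) hB
        (binary (k := 3) hB (sum (k := 2) (j := 0) hB hX' (fun x _ => var _) (by omega)) (one hB)
          (by omega) (by omega))
        (binary (k := 3) hB (binary (k := 1) hB (var _) (var _) (by omega) (by omega))
          (binary (k := 2) hB (var _) (var _) (by omega) (by omega))
          (by omega) (by omega)) (by omega) (by omega))
      (by omega) (by omega)

theorem size_copiesFormula_le : (copiesFormula A X S n).size ≤ B ^ 11 := by
  refine binary (i := 10) (j := 10) hB (conj (i := 2) (j := 7) hB ?_ (fun e _ => ?_) (by omega))
    (conj (i := 2) (j := 7) hB ?_ (fun e _ => ?_) (by omega)) (by omega) (by omega)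
  · rw [Finset.card_product, Nat.card_Ico, Finset.card_univ, pow_two]
    exact Nat.mul_le_mul (by omega) hX
  · exact binary hB
      (binary (k := 6) hB (binary (k := 5) hB (size_misTotal_le hB hA hn _ _)
        (size_copTotal_le hB hn _ _) (by omega) (by omega)) zero (by omega) (by omega))
      (binary (k := 3) hB (size_copTotal_le hB hn _ _) zero (by omega) (by omega))
      (by omega) (by omega)
  · rw [Finset.card_product, Nat.card_Icc, Finset.card_univ, pow_two]
    exact Nat.mul_le_mul (by omega) hX
  · exact binary hB
      (binary (k := 3) hB (size_copTotal_le hB hn _ _) (one hB) (by omega) (by omega))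
      (binary (k := 6) hB (binary (k := 5) hB (var _)
        (size_misTotal_le hB hA hn _ _) (by omega) (by omega)) zero (by omega) (by omega))
      (by omega) (by omega)

omit hX hA hn [Fintype A] [Fintype X] in
theorem size_lenTerm_le {l : List X} (hl : l.length ≤ B) :
    (lenTerm (A := A) (S := S) (n := n) l).size ≤ B ^ 2 :=
  listSum (i := 1) (j := 0) hB (by simpa using hl) (by
    intro t ht
    obtain ⟨x, -, rfl⟩ := List.mem_map.1 ht
    exact var _) (by omega)

omit hX in
theorem size_posFormula_le (D : Fin n) (s : Side) (v : X) :
    (posFormula (A := A) (S := S) D s v).size ≤ B ^ 8 := by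
  have hpos : ∀ k ≤ 2 * n, (posSum (A := A) (S := S) (n := n) k v).size ≤ B ^ 2 := fun k hk =>
    sum (i := 1) (j := 0) hB (by rw [Nat.card_Icc, pow_one]; omega) (fun j _ => var _) (by omega)
  refine binary (i := 7) (j := 7) hB (conj (i := 1) (j := 5) hB ?_ (fun k hk => ?_) (by omega))
    (conj (i := 1) (j := 5) hB ?_ (fun k hk => ?_) (by omega)) (by omega) (by omega)
  · rw [Nat.card_Icc, pow_one]; omega
  · exact binary hB
      (unary (k := 4) hB (binary (k := 3) hB (size_misCount_le hB hA _ _ _ _) zero (by omega)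
        (by omega)) (by omega))
      (binary (k := 3) hB (var _) (hpos k (Finset.mem_Icc.1 hk).2) (by omega) (by omega))
      (by omega) (by omega)
  · rw [Nat.card_Icc, pow_one]; omega
  · exact binary hB
      (unary (k := 2) hB (binary (k := 1) hB (var _) zero (by omega) (by omega)) (by omega))
      (binary (k := 4) hB (var _) (binary (k := 3) hB (hpos k (Finset.mem_Icc.1 hk).2) (one hB)
        (by omega) (by omega)) (by omega) (by omega))
      (by omega) (by omega)

omit hX in
theorem size_presentFormula_le (D : Fin n) (s : Side) (v : X) :
    (presentFormula (A := A) (S := S) D s v).size ≤ B ^ 8 :=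
  unary (i := 7) hB (binary hB
    (binary (k := 6) hB (size_misCount_le hB hA _ _ _ _)
      (sum (k := 5) (i := 1) (j := 3) hB (by rw [Nat.card_Icc, pow_one]; omega) (fun k _ =>
        binary hB (size_misCount_le hB hA _ _ _ _) (var _) (by omega) (by omega)) (by omega))
      (by omega) (by omega)) zero (by omega) (by omega)) (by omega)

omit hX in
theorem size_misFormula_le (D : Fin n) {l r : List X} (hl : l.length ≤ B) (hr : r.length ≤ B) :
    (misFormula (A := A) (S := S) D l r).size ≤ B ^ 15 := by
  refine disj (i := 2) (j := 12) hB ?_ (fun e _ => ?_) (by omega)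
  · rw [Finset.card_univ, Fintype.card_prod, Fintype.card_fin, Fintype.card_fin, pow_two]
    exact Nat.mul_le_mul hl hr
  · have htake : ∀ {l : List X} (k : ℕ), l.length ≤ B → (l.take k).length ≤ B := fun k h =>
      (List.length_take_le' k _).trans h
    exact binary hB (size_posFormula_le hB hA hn _ _ _)
      (binary (k := 11) hB (size_posFormula_le hB hA hn _ _ _)
        (binary (k := 10) hB
          (binary (k := 4) hB
            (binary (k := 3) hB (size_lenTerm_le hB (htake _ hl)) (var _) (by omega) (by omega))
            (binary (k := 3) hB (size_lenTerm_le hB (htake _ hr)) (var _) (by omega) (by omega))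
            (by omega) (by omega))
          (binary (k := 9) hB (size_presentFormula_le hB hA hn _ _ _)
            (size_presentFormula_le hB hA hn _ _ _) (by omega) (by omega))
          (by omega) (by omega)) (by omega) (by omega)) (by omega) (by omega)

theorem card_allTags_le : (allTags A X n).card ≤ B ^ 6 := by
  have h1 : (Finset.Icc 1 (2 * n) ×ˢ (Finset.univ : Finset (X × Fin n × Side × A))).card ≤
      B ^ 4 := by
    have : (2 * n + 1 - 1) * Fintype.card (X × Fin n × Side × A) =
        2 * n * (Fintype.card X * Fintype.card (Fin n × Side) * Fintype.card A) := by
      simp only [Fintype.card_prod]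
      rw [Nat.add_sub_cancel]
      ring
    rw [Finset.card_product, Finset.card_univ, Nat.card_Icc, this, card_sides]
    calc _ ≤ B * (B * B * B) :=
          Nat.mul_le_mul (by omega) (Nat.mul_le_mul (Nat.mul_le_mul hX (by omega)) hA)
      _ = B ^ 4 := by ring
  have h2 : (Finset.Icc 1 (2 * n) ×ˢ (Finset.univ : Finset (X × Fin n × Side))).card ≤ B ^ 4 := by
    rw [Finset.card_product, Finset.card_univ, Nat.card_Icc, Fintype.card_prod, card_sides]
    calc _ ≤ B * (B * B) := Nat.mul_le_mul (by omega) (Nat.mul_le_mul hX (by omega))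
      _ = B ^ 3 := by ring
      _ ≤ B ^ 4 := Nat.pow_le_pow_right (by omega) (by omega)
  have h3 : (Finset.Icc 1 (2 * n + 1) ×ˢ (Finset.univ : Finset X)).card ≤ B ^ 4 := by
    rw [Finset.card_product, Finset.card_univ, Nat.card_Icc]
    calc _ ≤ B * B := Nat.mul_le_mul (by omega) hX
      _ = B ^ 2 := by ring
      _ ≤ B ^ 4 := Nat.pow_le_pow_right (by omega) (by omega)
  have h4 : B ≤ B ^ 4 := Nat.le_self_pow (by omega) B
  -- There are five families of tags, each with at most `B ^ 4` members.
  have h5 : 9 * B ^ 4 ≤ B ^ 6 := by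
    rw [show B ^ 6 = B * B * B ^ 4 by ring]
    exact Nat.mul_le_mul_right _ (Nat.mul_le_mul hB hB)
  unfold allTags
  refine (Finset.card_union_le _ _).trans ?_
  refine (Nat.add_le_add_left (Finset.card_image_le.trans h3) _).trans ?_
  refine (Nat.add_le_add_right (Finset.card_union_le _ _) _).trans ?_
  refine (Nat.add_le_add_right (Nat.add_le_add_left (Finset.card_image_le.trans h2) _) _).trans ?_
  refine (Nat.add_le_add_right (Nat.add_le_add_right (Finset.card_union_le _ _) _) _).trans ?_
  refine (Nat.add_le_add_right (Nat.add_le_add_right (Nat.add_le_add_left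
    (Finset.card_image_le.trans h1) _) _) _).trans ?_
  refine (Nat.add_le_add_right (Nat.add_le_add_right (Nat.add_le_add_right
    (Finset.card_union_le _ _) _) _) _).trans ?_
  have h6 := (Finset.card_image_le (s := (Finset.univ : Finset A))
    (f := fun a => (Tag.sym a : Tag A X n))).trans (by simpa using hA)
  have h7 := (Finset.card_image_le (s := (Finset.univ : Finset X))
    (f := fun x => (Tag.len x : Tag A X n))).trans (by simpa using hX)
  omega

end

section

variable [Fintype A] [Fintype X] [∀ x, Fintype (Q x)] {B : ℕ}

theorem card_readMoves_le (hA : Fintype.card A ≤ B) (hX : Fintype.card X ≤ B)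
    (hQ : Fintype.card (Σ x, Q x) ≤ B) (M : TagAut (Tag A X n) (Σ x, Q x)) :
    (readMoves M).card ≤ B ^ 4 := by
  refine (Finset.card_filter_le _ _).trans ?_
  rw [Finset.card_univ]
  simp only [Fintype.card_prod]
  calc _ ≤ B * (B * (B * B)) :=
        Nat.mul_le_mul hQ (Nat.mul_le_mul hA (Nat.mul_le_mul hX hQ))
    _ = B ^ 4 := by ring

theorem card_epsMoves_le (hQ : Fintype.card (Σ x, Q x) ≤ B)
    (M : TagAut (Tag A X n) (Σ x, Q x)) : (epsMoves M).card ≤ B ^ 2 := by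
  refine (Finset.card_filter_le _ _).trans ?_
  rw [Finset.card_univ, Fintype.card_prod, pow_two]
  exact Nat.mul_le_mul hQ hQ

end

section

variable [Fintype A] [Fintype X] [LinearOrder X] [∀ x, Fintype (Q x)]
  (C : DiseqConstraint A X Q I n) {B : ℕ} (hB : 3 ≤ B) (hA : Fintype.card A ≤ B)
  (hX : Fintype.card X ≤ B) (hn : 2 * n + 1 ≤ B) (hQ : Fintype.card (Σ x, Q x) ≤ B)

include hB hA hX hn hQ

theorem card_multiAut_states_le : (multiAut C).states.card ≤ B ^ 2 := by
  rw [multiAut, Finset.card_product, Nat.card_Icc, pow_two]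
  exact Nat.mul_le_mul ((Finset.card_le_univ _).trans hQ) (by omega)

theorem card_multiAut_trans_le : (multiAut C).trans.card ≤ B ^ 8 := by
  have hread := card_readMoves_le hA hX hQ (conAut C)
  have heps := card_epsMoves_le hQ (conAut C)
  have h1 : (readMoves (conAut C) ×ˢ Finset.Icc 1 (2 * n + 1)).card ≤ B ^ 6 := by
    rw [Finset.card_product, Nat.card_Icc]
    calc _ ≤ B ^ 4 * B := Nat.mul_le_mul hread (by omega)
      _ = B ^ 5 := by ring
      _ ≤ B ^ 6 := Nat.pow_le_pow_right (by omega) (by omega)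
  have h2 : (epsMoves (conAut C) ×ˢ Finset.Icc 1 (2 * n + 1)).card ≤ B ^ 6 := by
    rw [Finset.card_product, Nat.card_Icc]
    calc _ ≤ B ^ 2 * B := Nat.mul_le_mul heps (by omega)
      _ = B ^ 3 := by ring
      _ ≤ B ^ 6 := Nat.pow_le_pow_right (by omega) (by omega)
  have h3 : (readMoves (conAut C) ×ˢ Finset.Icc 1 (2 * n) ×ˢ
      (Finset.univ : Finset (Fin n × Side))).card ≤ B ^ 6 := by
    rw [Finset.card_product, Finset.card_product, Nat.card_Icc, Finset.card_univ, card_sides]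
    calc _ ≤ B ^ 4 * (B * B) := Nat.mul_le_mul hread (Nat.mul_le_mul (by omega) (by omega))
      _ = B ^ 6 := by ring
  have h4 : ((conAut C).states ×ˢ Finset.Icc 2 (2 * n) ×ˢ
      (Finset.univ : Finset (X × Fin n × Side))).card ≤ B ^ 6 := by
    rw [Finset.card_product, Finset.card_product, Nat.card_Icc, Finset.card_univ,
      Fintype.card_prod, card_sides]
    calc _ ≤ B * (B * (B * B)) := Nat.mul_le_mul ((Finset.card_le_univ _).trans hQ)
          (Nat.mul_le_mul (by omega) (Nat.mul_le_mul hX (by omega)))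
      _ = B ^ 4 := by ring
      _ ≤ B ^ 6 := Nat.pow_le_pow_right (by omega) (by omega)
  -- There are four families of transitions, each with at most `B ^ 6` members.
  have h5 : 9 * B ^ 6 ≤ B ^ 8 := by
    rw [show B ^ 8 = B * B * B ^ 6 by ring]
    exact Nat.mul_le_mul_right _ (Nat.mul_le_mul hB hB)
  unfold multiAut
  refine (Finset.card_union_le _ _).trans ?_
  refine (Nat.add_le_add_left (Finset.card_image_le.trans h4) _).trans ?_
  refine (Nat.add_le_add_right (Finset.card_union_le _ _) _).trans ?_
  refine (Nat.add_le_add_right (Nat.add_le_add_left (Finset.card_image_le.trans h3) _) _).trans ?_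
  refine (Nat.add_le_add_right (Nat.add_le_add_right (Finset.card_union_le _ _) _) _).trans ?_
  refine (Nat.add_le_add_right (Nat.add_le_add_right (Nat.add_le_add
    (Finset.card_image_le.trans h1) (Finset.card_image_le.trans h2)) _) _).trans ?_
  omega

theorem size_formula_le (hm : C.maxSide ≤ B) : (formula C).size ≤ B ^ 26 := by
  have hside : ∀ D, (C.lhs D).length ≤ B ∧ (C.rhs D).length ≤ B := fun D =>
    max_le_iff.1 ((Finset.le_sup (f := fun D => max (C.lhs D).length (C.rhs D).length)
      (Finset.mem_univ D)).trans hm)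
  refine binary (i := 25) (j := 22) hB ?_
    (binary hB (size_fairFormula_le hB hA hX hn)
      (binary (k := 21) hB (size_consistFormula_le hB hA hX hn)
        (binary (k := 20) hB (size_copiesFormula_le hB hA hX hn)
          (conj (k := 19) (i := 1) (j := 17) hB (by rw [Finset.card_univ, Fintype.card_fin, pow_one]; omega)
            (fun D _ => binary hB
              (unary (k := 4) hB (binary (k := 3) hB (size_lenTerm_le hB (hside D).1)
                (size_lenTerm_le hB (hside D).2) (by omega) (by omega)) (by omega))
              (binary (k := 16) hB (size_misFormula_le hB hA hn D (hside D).1 (hside D).2)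
                (unary (k := 2) hB (binary (k := 1) hB (var _) (var _) (by omega) (by omega))
                  (by omega)) (by omega) (by omega)) (by omega) (by omega)) (by omega))
          (by omega) (by omega)) (by omega) (by omega)) (by omega) (by omega))
    (by omega) (by omega)
  rw [LIA.size_rename]
  exact TagAut.size_parikhTagFormula_le hB (wellFormed_multiAut C)
    (card_multiAut_states_le C hB hA hX hn hQ) (card_multiAut_trans_le C hB hA hX hn hQ)
    (card_allTags_le hB hA hX hn)

end

end MultiDiseq

theorem mainTheorem7 (A : Type uA) [Fintype A] :
    ∃ p : Polynomial ℕ,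
      ∀ (X : Type uX) [Fintype X] [LinearOrder X] [Nonempty X]
        (Q : X → Type uQ) [∀ x, Fintype (Q x)] (I : Type uI) (n : ℕ)
        (C : DiseqConstraint A X Q I n),
        (C.Satisfiable ↔ (MultiDiseq.fullFormula C).Satisfiable) ∧
        (1 ≤ n → 1 ≤ C.maxSide → (∀ x, Nonempty (Q x)) →
          (MultiDiseq.formula C).size ≤ p.eval (C.maxSide * n * C.regSize)) := by
  -- At the product of the three parameters, the polynomial inside the power is a base dominating
  -- `3`, the alphabet, the variables, the states, `2 * n + 1` and the side lengths; `26` is the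
  -- exponent of `size_formula_le`.
  refine ⟨(Polynomial.C 3 * Polynomial.X + Polynomial.C (Fintype.card A + 3)) ^ 26, ?_⟩
  intro X _ _ _ Q _ I n C
  refine ⟨MultiDiseq.satisfiable_iff C, fun hn hm hQ => ?_⟩
  have hQR : Fintype.card (Σ x, Q x) = C.regSize := Fintype.card_sigma
  -- Every automaton has a state, so the states outnumber or equal the variables. All three factors
  -- of the product are then positive, and each is bounded by the product.
  have hXR : Fintype.card X ≤ C.regSize := by
    rw [DiseqConstraint.regSize, ← Finset.card_univ, Finset.card_eq_sum_ones]
    exact Finset.sum_le_sum fun x _ => Fintype.card_pos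
  have hR : 1 ≤ C.regSize := le_trans Fintype.card_pos hXR
  have h1 : C.maxSide ≤ C.maxSide * n * C.regSize := by
    rw [mul_assoc]
    exact Nat.le_mul_of_pos_right _ (Nat.mul_pos hn hR)
  have h2 : n ≤ C.maxSide * n * C.regSize := by
    rw [mul_right_comm]
    exact Nat.le_mul_of_pos_left _ (Nat.mul_pos hm hR)
  have h3 : C.regSize ≤ C.maxSide * n * C.regSize :=
    Nat.le_mul_of_pos_left _ (Nat.mul_pos hm hn)
  simp only [Polynomial.eval_pow, Polynomial.eval_add, Polynomial.eval_mul, Polynomial.eval_C,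
    Polynomial.eval_X]
  exact MultiDiseq.size_formula_le C (by omega) (by omega) (by omega) (by omega) (by omega)
    (by omega)
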